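/- Let $R$ be a complex polynomial of degree $N\ge 2$ with $R(0)=0$, $c=R'(0)$ real, $c>1$, and Julia set $\mathcal J_R\subset\mathbb R_+=[0,\infty)$. Let $I$ be the convex hull of $\mathcal J_R$; it has a unique decomposition $I=\bigcup_{j=1}^N I_j$ into consecutive intervals with disjoint interiors, numbered from the left (starting at $0$), on each of which $R$ is monotone. Let $R_j^{-1}$ be the inverse branch of $R$ with values in $I_j$ and put $I_0=\bigcap_{j=1}^N R(I_j)$, $d_R=\frac{2\log N}{\log c}$. Let $\kappa$ be the balanced invariant probability measure on $\mathcal J_R$, i.e. $\kappa(R_{j_1}^{-1}\cdots R_{j_m}^{-1}(I))=N^{-m}$ for all $j_1,\dots,j_m$, and let $\mathcal R(z)=\lim_{n\to\infty}c^nR_1^{-n}(z)$, $\mathcal J_+=\mathcal J_R\cap\bigcup_{k=2}^N R_k^{-1}(I)$, and $$\xi_R(s)=\int_{\mathcal J_+}\mathcal R(z)^{-s/2}\,d\kappa(z).$$ For $z_0\in I_0$ and $\operatorname{Re} s>d_R$ let $$\zeta_{R,z_0}(s)=\lim_{n\to\infty}\ \sum_{z\in R^{-n}\{z_0\}\setminus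 0}(c^nz)^{-s/2},$$ where the preimages under the $n$-th iterate of $R$ are counted with multiplicity. Then $\xi_R$ is analytic in $\mathbb C$, and for every $z_0\in I_0$ the zeta function $\zeta_{R,z_0}$ (the limit exists for $\operatorname{Re}s>d_R$) has a meromorphic continuation of the form $$\zeta_{R,z_0}(s)=\frac{\xi_R(s)}{1-Nc^{-s/2}}+\psi_{R,z_0}(s),$$ where $\psi_{R,z_0}$ is analytic for $\operatorname{Re} s>0$. The set of poles of $\zeta_{R,z_0}$ is contained in $\{d_R+\frac{4\pi i n}{\log c}:n\in\mathbb Z\}$, and there is always a pole at $d_R$. If $\mathcal J_R$ is totally disconnected, then there is $\varepsilon>0$ (the same for all $z_0\in I_0$) such that every $\psi_{R,z_0}$ extends analytically to $\operatorname{Re} s>-\varepsilon$, and the statement on the poles holds for the resulting continuation. If, in addition, $R'\neq0$ on $\mathcal J_R$ and $r=\max_{z\in\mathcal J_R}|R'(z)|^{-1}<1$, then one can take $\varepsilon=-\frac{2\log r}{\log c}$. -/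

import Mathlib

open Polynomial Filter Topology MeasureTheory Set

noncomputable section

namespace PolyZeta

/-- The filled Julia set of a polynomial of degree at least two: the points with bounded orbit. -/
def filledJulia (R : ℂ[X]) : Set ℂ :=
  {z | Bornology.IsBounded (Set.range fun n : ℕ => (fun w : ℂ => R.eval w)^[n] z)}

/-- The Julia set of a polynomial of degree at least two: the boundary of the filled Julia set. -/
def julia (R : ℂ[X]) : Set ℂ := frontier (filledJulia R)

/-- The real points of the Julia set. -/
def realJulia (R : ℂ[X]) : Set ℝ := {x | (x : ℂ) ∈ julia R}

/-- The map that `R` induces on the real line (used only when `R` has real coefficients, where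
`R.eval x` is real for real `x`). -/
def realEval (R : ℂ[X]) (x : ℝ) : ℝ := (R.eval (x : ℂ)).re

/-- The interval `I`, the convex hull of the (real) Julia set. -/
def hull (R : ℂ[X]) : Set ℝ := convexHull ℝ (realJulia R)

/-- The `j`-th of the consecutive intervals cut out by the points `p 0 < p 1 < ⋯ < p N`. -/
def lap {N : ℕ} (p : Fin (N + 1) → ℝ) (j : Fin N) : Set ℝ := Set.Icc (p j.castSucc) (p j.succ)

/-- `p 0 < ⋯ < p N` cut the interval `I` into `N` consecutive intervals, numbered from the left,
on each of which `R` is monotone. -/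
structure IsMonotonePartition (R : ℂ[X]) {N : ℕ} (p : Fin (N + 1) → ℝ) : Prop where
  strictMono : StrictMono p
  hull_eq : hull R = Set.Icc (p 0) (p (Fin.last N))
  monotone : ∀ j, MonotoneOn (realEval R) (lap p j) ∨ AntitoneOn (realEval R) (lap p j)

/-- The interval `I₀`, the intersection of the images of the intervals of monotonicity. -/
def baseInterval (R : ℂ[X]) {N : ℕ} (p : Fin (N + 1) → ℝ) : Set ℝ :=
  ⋂ j, realEval R '' lap p j

/-- For a word `w = j₁ ⋯ jₘ` the set `R_{j₁}⁻¹ ⋯ R_{jₘ}⁻¹ (I)`, where `R_j⁻¹` is the inverse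
branch of `R` with values in the `j`-th interval of monotonicity. -/
def cell (R : ℂ[X]) {N : ℕ} (p : Fin (N + 1) → ℝ) : List (Fin N) → Set ℝ
  | [] => hull R
  | j :: w => lap p j ∩ realEval R ⁻¹' cell R p w

/-- `κ` is the balanced invariant probability measure on the Julia set. -/
structure IsBalancedMeasure (R : ℂ[X]) {N : ℕ} (p : Fin (N + 1) → ℝ) (κ : Measure ℝ) : Prop where
  isProbability : IsProbabilityMeasure κ
  support : κ (realJulia R)ᶜ = 0
  invariant : MeasurePreserving (realEval R) κ κ
  balanced : ∀ w : List (Fin N), κ (cell R p w) = ((N : ENNReal) ^ w.length)⁻¹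

/-- The inverse branch `R₁⁻¹` with values in the first interval of monotonicity. -/
def firstBranch (R : ℂ[X]) {N : ℕ} (p : Fin (N + 1) → ℝ) : ℝ → ℝ :=
  Function.invFunOn (realEval R) (Set.Icc (p 0) (p 1))

/-- The function `z ↦ lim cⁿ R₁⁻ⁿ(z)`. -/
def fatou (R : ℂ[X]) (c : ℝ) {N : ℕ} (p : Fin (N + 1) → ℝ) (x : ℝ) : ℝ :=
  limUnder atTop fun n : ℕ => c ^ n * (firstBranch R p)^[n] x

/-- The part `J₊` of the Julia set that lies in the images of the inverse branches of `R`
other than the first one. -/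
def juliaPlus (R : ℂ[X]) {N : ℕ} (p : Fin (N + 1) → ℝ) : Set ℝ :=
  realJulia R ∩ ⋃ (j : Fin N) (_ : (j : ℕ) ≠ 0), cell R p [j]

/-- The function `ξ_R`. -/
def xi (R : ℂ[X]) (c : ℝ) {N : ℕ} (p : Fin (N + 1) → ℝ) (κ : Measure ℝ) (s : ℂ) : ℂ :=
  ∫ x in juliaPlus R p, ((fatou R c p x : ℝ) : ℂ) ^ (-s / 2) ∂κ

/-- The sum of `(cⁿ z) ^ (-s / 2)` over the nonzero `z` among the preimages of `z₀` under the
`n`-th iterate of `R`, counted with multiplicity. -/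
def zetaApprox (R : ℂ[X]) (c z₀ : ℝ) (n : ℕ) (s : ℂ) : ℂ :=
  (((R.comp^[n] X - C (z₀ : ℂ)).roots.filter fun z => z ≠ 0).map
    fun z => ((c : ℂ) ^ n * z) ^ (-s / 2)).sum

/-- The number `d_R`. -/
def dR (N : ℕ) (c : ℝ) : ℝ := 2 * Real.log N / Real.log c

/-- `s ↦ ξ(s) / (1 - N c ^ (-s / 2)) + ψ(s)`. -/
def decomposed (N : ℕ) (c : ℝ) (ξ ψ : ℂ → ℂ) (s : ℂ) : ℂ :=
  ξ s / (1 - (N : ℂ) * (c : ℂ) ^ (-s / 2)) + ψ s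

/-- `ψ` is analytic on `Re s > η`, and `ξ(s) / (1 - N c ^ (-s / 2)) + ψ(s)` is a meromorphic
continuation to this half-plane of the zeta function of `R` at `z₀` (the limit of `zetaApprox` for
`Re s > d_R`), with a pole at `d_R` and all poles in `d_R + (4 π i / log c) ℤ`. -/
structure IsContinuation (R : ℂ[X]) (N : ℕ) (c z₀ : ℝ) (ξ ψ : ℂ → ℂ) (η : ℝ) : Prop where
  analytic : AnalyticOnNhd ℂ ψ {s | η < s.re}
  tendsto : ∀ s : ℂ, dR N c < s.re →
    Tendsto (fun n => zetaApprox R c z₀ n s) atTop (𝓝 (decomposed N c ξ ψ s))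
  meromorphic : MeromorphicOn (decomposed N c ξ ψ) {s | η < s.re}
  poles : ∀ s : ℂ, η < s.re → meromorphicOrderAt (decomposed N c ξ ψ) s < 0 →
    ∃ n : ℤ, s = dR N c + 4 * Real.pi * Complex.I * n / Real.log c
  pole_dR : meromorphicOrderAt (decomposed N c ξ ψ) (dR N c : ℂ) < 0

end PolyZeta

end

noncomputable section

/-! A boundary contained in the real line forces the filled Julia set to coincide with the Julia set
J, so R comes from a real polynomial P and every preimage of a point of J is real. With b = max J,
comparing the logarithmic derivatives of P and P - b shows that P has no critical value in (0, b).
Hence [0, b] splits into N laps, each mapped monotonically over [0, b], with global inverse branches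
`g j`.

Summing over preimages under the n-th iterate is applying the n-th power of the transfer operator L
f(x) = ∑ f(g_j x). Sorting preimages by the last branch other than the first
(`transfer_iterate_eq_sum`) and letting n tend to infinity gives, with w = c^(-s/2), φ_s = ℛ^(-s/2)
and L₊ the part of L without the first branch, ζ(s) = ∑ w^(m+1) L^m(L₊ φ_s)(z₀) + φ_s(z₀), without
the last term if z₀ = 0. The relation ℛ(x) = c ℛ(g_0 x) turns this by telescoping into ∑ w^m L^m
f_s(z₀), up to an elementary term, where f_s is φ_s cut off to a fundamental domain (a, P(a)]
(`tendsto_zetaApprox`).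

The measure κ satisfies N κ = ∑ (g_j)_* κ, so L multiplies integrals by N and L^m f_s has mean N^m
Ξ(s), with Ξ the integral of f_s. The means sum to Ξ/(1 - N w); the functional equation integrated
against κ (`integral_cutPow`) identifies this with ξ/(1 - N w) plus an entire function. The
remaining part of ψ is the series of w^m times the deviation of L^m f_s from its mean, and the
deviation is at most the oscillation of L^m f_s.

In general f_s is dominated by a monotone function, and the transfer operator does not increase the
variation of such a bound; the oscillation stays bounded and the series converges for Re s > 0. If J
is totally disconnected, a can be chosen off J, and f_s is a finite sum of Cauchy integrals over
circles avoiding J. Applied to the Cauchy kernel, L^m gives (R^m)'(t)/(R^m(t) - x), whose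
oscillation in x is superexponentially small because t escapes
(`exists_norm_transfer_iterate_inv_sub_le`). The series then converges in every half-plane, so every
ε > 0 is admissible, in particular the one given by r.

At a real point ξ is the integral of a positive function over a set of positive measure, hence
nonzero; so the zero of 1 - N w at d_R gives a genuine pole. -/

namespace PolyZeta

/-! ### Filled Julia set and escape to infinity -/

/-- A polynomial of degree at least two fixing the origin expands by any given factor outside a
large disc. -/
theorem exists_radius_expanding (R : ℂ[X]) (hN : 2 ≤ R.natDegree) (hR0 : R.eval 0 = 0) (B : ℝ) :
    ∃ ρ : ℝ, 1 ≤ ρ ∧ ∀ z : ℂ, ρ ≤ ‖z‖ → B * ‖z‖ ≤ ‖R.eval z‖ := by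
  have hd : 0 < R.divX.degree := by
    rw [← natDegree_pos_iff_degree_pos, natDegree_divX_eq_natDegree_tsub_one]; omega
  have h := R.divX.tendsto_norm_atTop hd (tendsto_norm_cobounded_atTop (E := ℂ))
  have h2 := (h.eventually_ge_atTop B)
  rw [← comap_norm_atTop, eventually_comap] at h2
  obtain ⟨a, ha⟩ := eventually_atTop.1 h2
  refine ⟨max a 1, le_max_right _ _, fun z hz => ?_⟩
  have h3 := ha ‖z‖ ((le_max_left _ _).trans hz) z rfl
  have h4 : R.eval z = R.divX.eval z * z := by
    conv_lhs => rw [← divX_mul_X_add R]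
    simp [coeff_zero_eq_eval_zero, hR0]
  rw [h4, norm_mul]
  exact mul_le_mul_of_nonneg_right h3 (norm_nonneg _)

theorem norm_iterate_ge_of_expanding {f : ℂ → ℂ} {B ρ : ℝ} (hB : 1 ≤ B)
    (hf : ∀ z : ℂ, ρ ≤ ‖z‖ → B * ‖z‖ ≤ ‖f z‖) {z : ℂ} (hz : ρ ≤ ‖z‖) (n : ℕ) :
    B ^ n * ‖z‖ ≤ ‖f^[n] z‖ ∧ ρ ≤ ‖f^[n] z‖ := by
  induction n with
  | zero => simpa using hz
  | succ n ih =>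
    rw [Function.iterate_succ_apply']
    have h := hf _ ih.2
    refine ⟨?_, ?_⟩
    · calc B ^ (n + 1) * ‖z‖ = B * (B ^ n * ‖z‖) := by ring
        _ ≤ B * ‖f^[n] z‖ := by gcongr; exact ih.1
        _ ≤ _ := h
    · calc ρ ≤ ‖f^[n] z‖ := ih.2
        _ ≤ B * ‖f^[n] z‖ := le_mul_of_one_le_left (norm_nonneg _) hB
        _ ≤ _ := h

/-- An orbit that once leaves the disc of radius ρ doubles its norm forever, so bounded orbits are
exactly those that never leave. This single radius gives closedness and boundedness of the filled
Julia set. -/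
theorem mem_filledJulia_iff {R : ℂ[X]} {ρ : ℝ}
    (hf : ∀ z : ℂ, ρ ≤ ‖z‖ → 2 * ‖z‖ ≤ ‖R.eval z‖) (hρ : 1 ≤ ρ) (z : ℂ) :
    z ∈ filledJulia R ↔ ∀ n : ℕ, ‖(fun w : ℂ => R.eval w)^[n] z‖ ≤ ρ := by
  constructor
  · intro hz n
    by_contra! hn
    have hz' : Bornology.IsBounded (Set.range fun n : ℕ => (fun w : ℂ => R.eval w)^[n] z) := hz
    obtain ⟨C, hC⟩ := isBounded_iff_forall_norm_le.1 hz'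
    obtain ⟨k, hk⟩ := pow_unbounded_of_one_lt C (one_lt_two (α := ℝ))
    have h1 := (norm_iterate_ge_of_expanding (f := fun w : ℂ => R.eval w) one_le_two
      hf hn.le k).1
    rw [← Function.iterate_add_apply] at h1
    have h2 := hC _ ⟨k + n, rfl⟩
    simp only at h2
    have h3 : (2 : ℝ) ^ k * 1 ≤ 2 ^ k * ‖(fun w : ℂ => R.eval w)^[n] z‖ := by
      gcongr; linarith
    linarith
  · intro h
    change Bornology.IsBounded (Set.range fun n : ℕ => (fun w : ℂ => R.eval w)^[n] z)
    refine isBounded_iff_forall_norm_le.2 ⟨ρ, ?_⟩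
    rintro _ ⟨n, rfl⟩
    exact h n

theorem continuous_eval_iterate (R : ℂ[X]) (n : ℕ) :
    Continuous ((fun w : ℂ => R.eval w)^[n]) :=
  Continuous.iterate R.continuous n

theorem isClosed_filledJulia {R : ℂ[X]} (hN : 2 ≤ R.natDegree) (hR0 : R.eval 0 = 0) :
    IsClosed (filledJulia R) := by
  obtain ⟨ρ, hρ, hf⟩ := exists_radius_expanding R hN hR0 2
  have : filledJulia R = ⋂ n : ℕ, {z | ‖(fun w : ℂ => R.eval w)^[n] z‖ ≤ ρ} := by
    ext z; simp [mem_filledJulia_iff hf hρ]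
  rw [this]
  exact isClosed_iInter fun n =>
    isClosed_le (continuous_eval_iterate R n).norm continuous_const

theorem isBounded_filledJulia {R : ℂ[X]} (hN : 2 ≤ R.natDegree) (hR0 : R.eval 0 = 0) :
    Bornology.IsBounded (filledJulia R) := by
  obtain ⟨ρ, hρ, hf⟩ := exists_radius_expanding R hN hR0 2
  refine isBounded_iff_forall_norm_le.2 ⟨ρ, fun z hz => ?_⟩
  simpa using (mem_filledJulia_iff hf hρ z).1 hz 0

theorem eval_mem_filledJulia_iff (R : ℂ[X]) (z : ℂ) :
    R.eval z ∈ filledJulia R ↔ z ∈ filledJulia R := by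
  have key : (Set.range fun n : ℕ => (fun w : ℂ => R.eval w)^[n] z) =
      insert z (Set.range fun n : ℕ => (fun w : ℂ => R.eval w)^[n] (R.eval z)) := by
    ext y
    simp only [mem_range, mem_insert_iff]
    constructor
    · rintro ⟨n, rfl⟩
      cases n with
      | zero => left; rfl
      | succ n => right; exact ⟨n, rfl⟩
    · rintro (rfl | ⟨n, rfl⟩)
      · exact ⟨0, rfl⟩
      · exact ⟨n + 1, rfl⟩
  simp only [filledJulia, mem_ofPred_eq]
  rw [key, Bornology.isBounded_insert]

/-- If the Julia set is real then it equals the filled Julia set. -/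
theorem julia_eq_filledJulia {R : ℂ[X]} (hN : 2 ≤ R.natDegree) (hR0 : R.eval 0 = 0)
    (hJ : ∀ z ∈ julia R, z.im = 0) : julia R = filledJulia R := by
  have hcl := isClosed_filledJulia hN hR0
  have hbd := isBounded_filledJulia hN hR0
  have hint : interior (filledJulia R) = ∅ := by
    by_contra hne
    obtain ⟨z, hz⟩ := nonempty_iff_ne_empty.2 hne
    obtain ⟨ε, hε, hball⟩ := Metric.isOpen_iff.1 isOpen_interior z hz
    obtain ⟨w, hw, hw0⟩ : ∃ w ∈ interior (filledJulia R), w.im ≠ 0 := by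
      by_cases h0 : z.im = 0
      · refine ⟨z + ((ε / 2 : ℝ) : ℂ) * Complex.I, hball ?_, ?_⟩
        · simp [abs_of_pos hε, hε]
        · simp [h0, hε.ne']
      · exact ⟨z, hz, h0⟩
    -- A connected set off the real axis misses the boundary of the filled Julia set. If it meets
    -- the interior it lies entirely inside, which is impossible for an unbounded half-plane.
    have main : ∀ U : Set ℂ, IsPreconnected U → (∀ u ∈ U, u.im ≠ 0) → w ∈ U →
        ¬ Bornology.IsBounded U → False := by
      intro U hU hU0 hwU hUb
      apply hUb
      refine hbd.subset ?_
      refine (hU.subset_of_closure_inter_subset isOpen_interior ⟨w, hwU, hw⟩ ?_).trans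
        interior_subset
      rintro y ⟨hy, hyU⟩
      by_contra hyi
      refine hU0 y hyU (hJ y ⟨closure_mono interior_subset hy, hyi⟩)
    rcases lt_or_gt_of_ne hw0 with h | h
    · refine main {z : ℂ | z.im < 0} (convex_halfSpace_im_lt 0).isPreconnected
        (fun u hu => ne_of_lt hu) h ?_
      intro hb
      obtain ⟨C, hC⟩ := isBounded_iff_forall_norm_le.1 hb
      have := hC (-(((|C| + 1 : ℝ) : ℂ) * Complex.I)) (by simp; linarith [abs_nonneg C])
      rw [norm_neg, norm_mul, Complex.norm_real, Complex.norm_I, mul_one, Real.norm_eq_abs,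
        abs_of_pos (by positivity)] at this
      linarith [le_abs_self C]
    · refine main {z : ℂ | 0 < z.im} (convex_halfSpace_im_gt 0).isPreconnected
        (fun u hu => ne_of_gt hu) h ?_
      intro hb
      obtain ⟨C, hC⟩ := isBounded_iff_forall_norm_le.1 hb
      have := hC ((((|C| + 1 : ℝ) : ℂ) * Complex.I)) (by simpa using (by positivity : (0 : ℝ) < |C| + 1))
      rw [norm_mul, Complex.norm_real, Complex.norm_I, mul_one, Real.norm_eq_abs,
        abs_of_pos (by positivity)] at this
      linarith [le_abs_self C]
  rw [julia, frontier, hcl.closure_eq, hint, sdiff_empty]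

/-- Points of a compact set off the filled Julia set escape uniformly and faster than any
geometric sequence. -/
theorem exists_uniform_escape {R : ℂ[X]} {γ : Set ℂ} (hγ : IsCompact γ) (hdisj : ∀ t ∈ γ, t ∉ filledJulia R) {B ρ : ℝ} (hB : 2 ≤ B)
    (hρ : 1 ≤ ρ) (hf : ∀ z : ℂ, ρ ≤ ‖z‖ → B * ‖z‖ ≤ ‖R.eval z‖) :
    ∃ n₀ : ℕ, ∀ t ∈ γ, ∀ k : ℕ, B ^ k ≤ ‖(fun w : ℂ => R.eval w)^[n₀ + k] t‖ ∧
      ρ ≤ ‖(fun w : ℂ => R.eval w)^[n₀ + k] t‖ := by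
  have hf2 : ∀ z : ℂ, ρ ≤ ‖z‖ → 2 * ‖z‖ ≤ ‖R.eval z‖ := fun z hz =>
    (mul_le_mul_of_nonneg_right hB (norm_nonneg _)).trans (hf z hz)
  have hB1 : 1 ≤ B := by linarith
  -- The open sets of points outside the escape radius at time n increase with n and cover the
  -- compact set, so one of them suffices.
  obtain ⟨n₀, hn₀⟩ := hγ.elim_directed_cover
    (fun n : ℕ => {t | ρ < ‖(fun w : ℂ => R.eval w)^[n] t‖})
    (fun n => isOpen_lt continuous_const (continuous_eval_iterate R n).norm)
    (fun t ht => by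
      have := hdisj t ht
      rw [mem_filledJulia_iff hf2 hρ] at this
      push Not at this
      exact mem_iUnion.2 this)
    (by
      refine directed_of_isDirected_le ?_
      intro m n hmn t ht
      obtain ⟨k, rfl⟩ := Nat.exists_eq_add_of_le hmn
      have h := norm_iterate_ge_of_expanding (f := fun w : ℂ => R.eval w) one_le_two
        hf2 (le_of_lt ht) k
      rw [← Function.iterate_add_apply, add_comm k m] at h
      refine lt_of_lt_of_le (lt_of_lt_of_le ht ?_) h.1
      exact le_mul_of_one_le_left (norm_nonneg _) (one_le_pow₀ one_le_two))
  refine ⟨n₀, fun t ht k => ?_⟩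
  have h0 : ρ ≤ ‖(fun w : ℂ => R.eval w)^[n₀] t‖ := le_of_lt (hn₀ ht)
  have h := norm_iterate_ge_of_expanding (f := fun w : ℂ => R.eval w) hB1 hf h0 k
  rw [← Function.iterate_add_apply, add_comm k n₀] at h
  refine ⟨le_trans ?_ h.1, h.2⟩
  exact le_mul_of_one_le_right (by positivity) (by linarith)

/-! ### Real-rootedness, critical values and laps -/

/-- Real roots determine a real polynomial up to the leading coefficient, and a nonzero real
derivative at 0 forces that coefficient to be real. -/
theorem exists_real_polynomial {R : ℂ[X]} {c : ℝ} (hRc : R.derivative.eval 0 = (c : ℂ))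
    (hc : c ≠ 0) (hreal : ∀ z, R.eval z = 0 → z.im = 0) :
    ∃ P : ℝ[X], R = P.map Complex.ofRealHom := by
  have hsp : R.Splits := IsAlgClosed.splits R
  have hR : R ≠ 0 := by
    rintro rfl
    simp at hRc; exact hc (by exact_mod_cast hRc.symm)
  set Q : ℝ[X] := ((R.roots.map Complex.re).map fun a => X - C a).prod with hQ
  have hQR : R = C R.leadingCoeff * Q.map Complex.ofRealHom := by
    conv_lhs => rw [hsp.eq_prod_roots]
    congr 1
    rw [hQ, Polynomial.map_multiset_prod, Multiset.map_map, Multiset.map_map]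
    congr 1
    refine Multiset.map_congr rfl fun z hz => ?_
    have hz0 := hreal z ((mem_roots hR).1 hz)
    simp only [Function.comp, Polynomial.map_sub, map_X, map_C]
    congr 2
    exact Complex.ext (by simp) (by simp [hz0])
  have h1 : R.leadingCoeff * ((Q.derivative.eval 0 : ℝ) : ℂ) = c := by
    rw [← hRc]
    conv_rhs => rw [hQR]
    rw [derivative_C_mul, eval_C_mul, derivative_map]
    congr 1
    rw [eval_zero_map]
    rfl
  have h2 : Q.derivative.eval 0 ≠ 0 := by
    intro h
    rw [h] at h1
    simp at h1; exact hc (by exact_mod_cast h1.symm)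
  refine ⟨C (c / Q.derivative.eval 0) * Q, ?_⟩
  conv_lhs => rw [hQR]
  rw [Polynomial.map_mul, map_C]
  congr 2
  simp only [Complex.ofRealHom_eq_coe, Complex.ofReal_div]
  rw [eq_div_iff (by exact_mod_cast h2)]
  exact h1

theorem splits_of_complex_roots_real {Q : ℝ[X]}
    (h : ∀ z : ℂ, (Q.map Complex.ofRealHom).eval z = 0 → z.im = 0) : Q.Splits := by
  by_cases hQ : Q = 0
  · rw [hQ]; exact Splits.zero
  refine Splits.of_splits_map Complex.ofRealHom (IsAlgClosed.splits _) fun a ha => ?_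
  have := h a ((mem_roots'.1 ha).2)
  exact ⟨a.re, Complex.ext (by simp) (by simp [this])⟩

/-- The logarithmic derivative is the sum of 1/(x - z) over the real roots z, and each summand
decreases on an interval that contains no root. -/
theorem logDeriv_lt_of_splits {Q : ℝ[X]} (hQ : Q.Splits) (hdeg : 0 < Q.natDegree) {x y : ℝ}
    (hxy : x < y) (h : ∀ t ∈ Icc x y, Q.eval t ≠ 0) :
    Q.derivative.eval y / Q.eval y < Q.derivative.eval x / Q.eval x := by
  rw [hQ.eval_derivative_div_eval_of_ne_zero (h x ⟨le_rfl, hxy.le⟩),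
    hQ.eval_derivative_div_eval_of_ne_zero (h y ⟨hxy.le, le_rfl⟩)]
  have hne : Q.roots ≠ 0 := hQ.roots_ne_zero hdeg.ne'
  refine Multiset.sum_lt_sum_of_nonempty hne fun z hz => ?_
  have hz0 : Q.eval z = 0 := (mem_roots'.1 hz).2
  rcases lt_or_ge z x with hzx | hzx
  · exact one_div_lt_one_div_of_lt (by linarith) (by linarith)
  · have hzy : y < z := by
      by_contra! hc
      exact h z ⟨hzx, hc⟩ hz0
    exact one_div_lt_one_div_of_neg_of_lt (by linarith) (by linarith)

/-- At a critical point x with P(x) in (0, b), the logarithmic derivatives of P and P - b both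
vanish, hence are negative just to the right. As P > 0 > P - b there, P' would be both negative and
positive. -/
theorem derivative_ne_zero_of_mem_Ioo {P : ℝ[X]} {b : ℝ} (hP : P.Splits) (hPb : (P - C b).Splits)
    (hdeg : 0 < P.natDegree) {x : ℝ} (h0 : 0 < P.eval x) (hb : P.eval x < b) :
    P.derivative.eval x ≠ 0 := by
  intro hx
  have hnear : ∀ᶠ t in 𝓝 x, P.eval t ∈ Ioo 0 b :=
    P.continuous.continuousAt.eventually (Ioo_mem_nhds h0 hb)
  obtain ⟨ε, hε, hball⟩ := Metric.eventually_nhds_iff_ball.1 hnear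
  set y := x + ε / 2
  have hIcc : ∀ t ∈ Icc x y, P.eval t ∈ Ioo 0 b := fun t ht => hball t (by
    rw [Real.ball_eq_Ioo]; exact ⟨by linarith [ht.1], by have := ht.2; simp only [y] at this; linarith⟩)
  have hxy : x < y := by simp [y, hε]
  have hy := hIcc y ⟨hxy.le, le_rfl⟩
  have h1 := logDeriv_lt_of_splits hP hdeg hxy fun t ht => (hIcc t ht).1.ne'
  have h2 := logDeriv_lt_of_splits hPb (by simpa using hdeg) hxy fun t ht => by
    have := (hIcc t ht).2
    simp only [eval_sub, eval_C]; linarith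
  simp only [derivative_sub, derivative_C, sub_zero, eval_sub, eval_C, hx, zero_div] at h1 h2
  rw [div_lt_iff₀ hy.1] at h1
  rw [div_lt_iff_of_neg (by linarith [hy.2])] at h2
  linarith

/-- Consecutive intervals on which a polynomial is strictly monotone and covers `[0, b]`. -/
structure IsLapPartition (P : ℝ[X]) (b : ℝ) {N : ℕ} (p : Fin (N + 1) → ℝ) : Prop where
  strictMono : StrictMono p
  zero : p 0 = 0
  last : p (Fin.last N) = b
  derivative_ne_zero : ∀ j : Fin N, ∀ x ∈ Ioo (p j.castSucc) (p j.succ), P.derivative.eval x ≠ 0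
  derivative_eq_zero : ∀ i, i ≠ 0 → i ≠ Fin.last N → P.derivative.eval (p i) = 0
  lap : ∀ j : Fin N,
    (StrictMonoOn (fun x => P.eval x) (Icc (p j.castSucc) (p j.succ)) ∧
      P.eval (p j.castSucc) ≤ 0 ∧ b ≤ P.eval (p j.succ)) ∨
    (StrictAntiOn (fun x => P.eval x) (Icc (p j.castSucc) (p j.succ)) ∧
      P.eval (p j.succ) ≤ 0 ∧ b ≤ P.eval (p j.castSucc))

/-- No critical value lies in (0, b), so y₀ has N simple real preimages. Rolle puts a zero of P' in
each of the N - 1 gaps, which exhausts the degree of P'. Between these zeros P is monotone, crosses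
the level y₀, and has endpoint values outside (0, b); so every lap covers [0, b]. -/
theorem exists_isLapPartition {P : ℝ[X]} {N : ℕ} {b y₀ : ℝ} (hdeg : P.natDegree = N) (hN : 2 ≤ N)
    (hP : P.Splits) (hPb : (P - C b).Splits) (hPy : (P - C y₀).Splits) (hy0 : 0 < y₀)
    (hyb : y₀ < b) (hroots : ∀ x, P.eval x = y₀ → 0 < x ∧ x < b) (hP0 : P.eval 0 = 0)
    (hPend : P.eval b ≤ 0 ∨ b ≤ P.eval b) :
    ∃ p : Fin (N + 1) → ℝ, IsLapPartition P b p := by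
  have hder : ∀ x, P.eval x ∈ Ioo 0 b → P.derivative.eval x ≠ 0 := fun x hx =>
    derivative_ne_zero_of_mem_Ioo hP hPb (by omega) hx.1 hx.2
  have hdegy : (P - C y₀).natDegree = N := by rw [natDegree_sub_C, hdeg]
  have hne : P - C y₀ ≠ 0 := by
    intro h; rw [h] at hdegy; simp at hdegy; omega
  have hmem : ∀ x, x ∈ (P - C y₀).roots ↔ P.eval x = y₀ := fun x => by
    rw [mem_roots hne, IsRoot, eval_sub, eval_C, sub_eq_zero]
  have hnodup : (P - C y₀).roots.Nodup := by
    rw [Multiset.nodup_iff_count_le_one]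
    intro x
    rw [count_roots]
    by_contra! hlt
    obtain ⟨h1, h2⟩ := (one_lt_rootMultiplicity_iff_isRoot hne).1 hlt
    simp only [IsRoot, derivative_sub, derivative_C, sub_zero, eval_sub, eval_C] at h1 h2
    refine hder x ?_ h2
    rw [sub_eq_zero.1 h1]; exact ⟨hy0, hyb⟩
  have hcard : (P - C y₀).roots.toFinset.card = N := by
    rw [Multiset.toFinset_card_of_nodup hnodup, ← hPy.natDegree_eq_card_roots, hdegy]
  set x : Fin N ↪o ℝ := (P - C y₀).roots.toFinset.orderEmbOfFin hcard
  have hx : ∀ j, P.eval (x j) = y₀ := fun j => by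
    rw [← hmem, ← Multiset.mem_toFinset]
    exact Finset.orderEmbOfFin_mem _ hcard j
  have hex : ∀ i : Fin (N + 1), ∃ q : ℝ, (i = 0 → q = 0) ∧ (i = Fin.last N → q = b) ∧
      (i ≠ 0 → i ≠ Fin.last N → P.derivative.eval q = 0) ∧
      (∀ j : Fin N, j.castSucc = i → q < x j) ∧ (∀ j : Fin N, j.succ = i → x j < q) := by
    intro i
    by_cases hi0 : i = 0
    · refine ⟨0, fun _ => rfl, fun h => ?_, fun h => absurd hi0 h, fun j _ => (hroots _ (hx j)).1,
        fun j hj => absurd (hj.trans hi0) (Fin.succ_ne_zero j)⟩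
      rw [hi0] at h
      have := congrArg Fin.val h
      simp at this; omega
    by_cases hil : i = Fin.last N
    · refine ⟨b, fun h => absurd h hi0, fun _ => rfl, fun _ h => absurd hil h, fun j hj => ?_,
        fun j _ => (hroots _ (hx j)).2⟩
      exact absurd (hj.trans hil) (Fin.castSucc_ne_last j)
    have hv0 : (i : ℕ) ≠ 0 := fun h => hi0 (Fin.ext (by simpa using h))
    have hvl : (i : ℕ) ≠ N := fun h => hil (Fin.ext (by simpa using h))
    have hvlt := i.isLt
    set j0 : Fin N := ⟨i - 1, by omega⟩
    set j1 : Fin N := ⟨i, by omega⟩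
    have hlt : x j0 < x j1 := x.strictMono (Fin.lt_def.2 (by show (i : ℕ) - 1 < i; omega))
    obtain ⟨q, hq, hq0⟩ := exists_hasDerivAt_eq_zero hlt P.continuous.continuousOn
      ((hx j0).trans (hx j1).symm) fun t _ => P.hasDerivAt t
    refine ⟨q, fun h => absurd h hi0, fun h => absurd h hil, fun _ _ => hq0, fun j hj => ?_,
      fun j hj => ?_⟩
    · have : j = j1 := Fin.ext (by simp [j1, ← hj])
      rw [this]; exact hq.2
    · have : j = j0 := Fin.ext (by simp [j0, ← hj])
      rw [this]; exact hq.1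
  choose p hp0 hpl hpc hplt hpgt using hex
  have hleft : ∀ j : Fin N, p j.castSucc < x j := fun j => hplt _ j rfl
  have hright : ∀ j : Fin N, x j < p j.succ := fun j => hpgt _ j rfl
  have hmono : StrictMono p := Fin.strictMono_iff_lt_succ.2 fun j => (hleft j).trans (hright j)
  have hval : ∀ i, P.eval (p i) ∉ Ioo 0 b := by
    intro i hi
    by_cases hi0 : i = 0
    · rw [hp0 i hi0, hP0] at hi; exact lt_irrefl _ hi.1
    by_cases hil : i = Fin.last N
    · rw [hpl i hil] at hi
      rcases hPend with h | h
      · linarith [hi.1]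
      · linarith [hi.2]
    exact hder _ hi (hpc i hi0 hil)
  have hdn : ∀ j : Fin N, ∀ t ∈ Ioo (p j.castSucc) (p j.succ), P.derivative.eval t ≠ 0 := by
    intro j t ht ht0
    have hder_ne : P.derivative ≠ 0 := by
      intro h
      have := derivative_eq_zero.1 h
      omega
    have htp : ∀ i, t ≠ p i := by
      rintro i rfl
      have h1 := hmono.lt_iff_lt.1 ht.1
      have h2 := hmono.lt_iff_lt.1 ht.2
      rw [Fin.lt_def] at h1 h2
      simp at h1 h2; omega
    -- A further critical point t inside a lap would take the place of the unused endpoint p 0 and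
    -- give N distinct zeros of P', one too many.
    let f : Fin N → ℝ := fun i => if (i : ℕ) = 0 then t else p i.castSucc
    have hf : Function.Injective f := by
      intro i k hik
      simp only [f] at hik
      split_ifs at hik with h1 h2 h2
      · exact Fin.ext (h1.trans h2.symm)
      · exact absurd hik (htp _)
      · exact absurd hik.symm (htp _)
      · exact Fin.castSucc_injective _ (hmono.injective hik)
    have hsub : Finset.univ.image f ⊆ P.derivative.roots.toFinset := by
      intro a ha
      obtain ⟨i, -, rfl⟩ := Finset.mem_image.1 ha
      rw [Multiset.mem_toFinset, mem_roots hder_ne, IsRoot]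
      simp only [f]
      split_ifs with h
      · exact ht0
      · refine hpc _ (fun h' => h ?_) (Fin.castSucc_ne_last i)
        simpa using congrArg Fin.val h'
    have h1 := Finset.card_le_card hsub
    rw [Finset.card_image_of_injective _ hf, Finset.card_univ, Fintype.card_fin] at h1
    have h2 := (Multiset.toFinset_card_le P.derivative.roots).trans (card_roots' _)
    have h3 := natDegree_derivative_lt (p := P) (by omega)
    omega
  refine ⟨p, hmono, hp0 0 rfl, hpl _ rfl, hdn, hpc, fun j => ?_⟩
  have hlt : p j.castSucc < p j.succ := (hleft j).trans (hright j)
  have hinj : InjOn (fun x => P.eval x) (Icc (p j.castSucc) (p j.succ)) := by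
    have key : ∀ u ∈ Icc (p j.castSucc) (p j.succ), ∀ v ∈ Icc (p j.castSucc) (p j.succ), u < v →
        P.eval u ≠ P.eval v := by
      intro u hu v hv huv heq
      obtain ⟨q, hq, hq0⟩ := exists_hasDerivAt_eq_zero huv P.continuous.continuousOn heq
        fun t _ => P.hasDerivAt t
      exact hdn j q ⟨hu.1.trans_lt hq.1, hq.2.trans_le hv.2⟩ hq0
    intro u hu v hv heq
    rcases lt_trichotomy u v with h | h | h
    · exact absurd heq (key u hu v hv h)
    · exact h
    · exact absurd heq.symm (key v hv u hu h)
  have hxm : x j ∈ Icc (p j.castSucc) (p j.succ) := ⟨(hleft j).le, (hright j).le⟩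
  have hv1 := hval j.castSucc
  have hv2 := hval j.succ
  rcases ContinuousOn.strictMonoOn_of_injOn_Icc' hlt.le P.continuous.continuousOn hinj with h | h
  · left
    have h1 := h ⟨le_rfl, hlt.le⟩ hxm (hleft j)
    have h2 := h hxm ⟨hlt.le, le_rfl⟩ (hright j)
    simp only [hx] at h1 h2
    refine ⟨h, ?_, ?_⟩
    · by_contra! hc; exact hv1 ⟨hc, by linarith⟩
    · by_contra! hc; exact hv2 ⟨by linarith, hc⟩
  · right
    have h1 := h ⟨le_rfl, hlt.le⟩ hxm (hleft j)
    have h2 := h hxm ⟨hlt.le, le_rfl⟩ (hright j)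
    simp only [hx] at h1 h2
    refine ⟨h, ?_, ?_⟩
    · by_contra! hc; exact hv2 ⟨hc, by linarith⟩
    · by_contra! hc; exact hv1 ⟨by linarith, hc⟩

/-! ### The real model of the dynamics -/

/-- `P` is the real polynomial inducing `R`, whose Julia set has convex hull `[0, b]`. -/
structure IsRealModel (R : ℂ[X]) (P : ℝ[X]) (c b : ℝ) : Prop where
  map_eq : R = P.map Complex.ofRealHom
  eval_zero : P.eval 0 = 0
  derivative_eval_zero : P.derivative.eval 0 = c
  b_pos : 0 < b
  julia_eq : julia R = filledJulia R
  im_eq_zero : ∀ z ∈ julia R, z.im = 0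
  subset_Icc : realJulia R ⊆ Icc 0 b
  zero_mem : 0 ∈ realJulia R
  b_mem : b ∈ realJulia R
  eval_mem_iff : ∀ x, P.eval x ∈ realJulia R ↔ x ∈ realJulia R
  splits : ∀ y ∈ realJulia R, (P - C y).Splits
  exists_mem_Ioo : ∃ y ∈ realJulia R, y ∈ Ioo 0 b
  isCompact : IsCompact (realJulia R)

theorem eval_ofReal_map (P : ℝ[X]) (x : ℝ) :
    (P.map Complex.ofRealHom).eval (x : ℂ) = ((P.eval x : ℝ) : ℂ) :=
  eval_map_apply (p := P) (f := Complex.ofRealHom) x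

theorem IsRealModel.realEval_eq {R : ℂ[X]} {P : ℝ[X]} {c b : ℝ} (h : IsRealModel R P c b) (x : ℝ) :
    realEval R x = P.eval x := by
  rw [realEval, h.map_eq, eval_ofReal_map, Complex.ofReal_re]

theorem iterate_eval_ofReal (P : ℝ[X]) (n : ℕ) (x : ℝ) :
    (fun w : ℂ => (P.map Complex.ofRealHom).eval w)^[n] (x : ℂ) =
      (((fun y : ℝ => P.eval y)^[n] x : ℝ) : ℂ) := by
  induction n generalizing x with
  | zero => rfl
  | succ n ih => rw [Function.iterate_succ_apply, Function.iterate_succ_apply, eval_ofReal_map, ih]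

theorem IsRealModel.mem_of_forall_iterate {R : ℂ[X]} {P : ℝ[X]} {c b : ℝ}
    (h : IsRealModel R P c b) {x : ℝ} (hx : ∀ n : ℕ, (fun y : ℝ => P.eval y)^[n] x ∈ Icc 0 b) :
    x ∈ realJulia R := by
  rw [realJulia, mem_ofPred_eq, h.julia_eq]
  change Bornology.IsBounded (Set.range fun n : ℕ => (fun w : ℂ => R.eval w)^[n] x)
  refine isBounded_iff_forall_norm_le.2 ⟨b, ?_⟩
  rintro _ ⟨n, rfl⟩
  simp only
  rw [h.map_eq, iterate_eval_ofReal, Complex.norm_real, Real.norm_eq_abs, abs_of_nonneg (hx n).1]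
  exact (hx n).2

theorem exists_isRealModel {R : ℂ[X]} {c : ℝ} (hN : 2 ≤ R.natDegree)
    (hR0 : R.eval 0 = 0) (hRc : R.derivative.eval 0 = (c : ℂ)) (hc : 1 < c)
    (hJ : ∀ z ∈ julia R, z.im = 0 ∧ 0 ≤ z.re) :
    ∃ (P : ℝ[X]) (b : ℝ), IsRealModel R P c b := by
  have hJK := julia_eq_filledJulia hN hR0 fun z hz => (hJ z hz).1
  have hzero : (0 : ℂ) ∈ filledJulia R := by
    change Bornology.IsBounded (Set.range fun n : ℕ => (fun w : ℂ => R.eval w)^[n] 0)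
    have : ∀ n : ℕ, (fun w : ℂ => R.eval w)^[n] 0 = 0 := fun n =>
      Function.iterate_fixed hR0 n
    simp [this]
  obtain ⟨P, hP⟩ := exists_real_polynomial hRc (by linarith) fun z hz =>
    (hJ z (by rw [hJK, ← eval_mem_filledJulia_iff, hz]; exact hzero)).1
  have hdeg : P.natDegree = R.natDegree := by
    rw [hP, natDegree_map_eq_of_injective Complex.ofRealHom.injective]
  have hP0 : P.eval 0 = 0 := by
    have h := eval_ofReal_map P 0
    rw [← hP, Complex.ofReal_zero, hR0] at h
    exact_mod_cast h.symm
  have hPc : P.derivative.eval 0 = c := by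
    have h := eval_ofReal_map P.derivative 0
    rw [← derivative_map, ← hP, Complex.ofReal_zero, hRc] at h
    exact_mod_cast h.symm
  have hmem : ∀ x : ℝ, P.eval x ∈ realJulia R ↔ x ∈ realJulia R := fun x => by
    rw [realJulia, mem_ofPred_eq, mem_ofPred_eq, hJK, ← eval_ofReal_map, ← hP,
      eval_mem_filledJulia_iff]
  have hroot : ∀ y ∈ realJulia R, ∀ z : ℂ, R.eval z = (y : ℂ) → z ∈ julia R := by
    intro y hy z hz
    rw [hJK, ← eval_mem_filledJulia_iff, hz, ← hJK]
    exact hy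
  have hsplits : ∀ y ∈ realJulia R, (P - C y).Splits := by
    intro y hy
    refine splits_of_complex_roots_real fun z hz => (hJ z (hroot y hy z ?_)).1
    rw [Polynomial.map_sub, map_C, ← hP, eval_sub, eval_C, sub_eq_zero] at hz
    exact hz
  have hnn : ∀ x ∈ realJulia R, 0 ≤ x := fun x hx => by simpa using (hJ x hx).2
  have hzero' : 0 ∈ realJulia R := by
    rw [realJulia, mem_ofPred_eq, hJK]; simpa using hzero
  have hcl : IsClosed (realJulia R) := by
    have : IsClosed (julia R) := isClosed_frontier
    exact this.preimage Complex.continuous_ofReal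
  have hcpt : IsCompact (realJulia R) := by
    refine Metric.isCompact_of_isClosed_isBounded hcl ?_
    obtain ⟨C, hC⟩ := isBounded_iff_forall_norm_le.1 (isBounded_filledJulia hN hR0)
    refine isBounded_iff_forall_norm_le.2 ⟨C, fun x hx => ?_⟩
    have := hC (x : ℂ) (by rw [← hJK]; exact hx)
    simpa using this
  set b := sSup (realJulia R)
  have hb : b ∈ realJulia R := hcpt.sSup_mem ⟨0, hzero'⟩
  have hle : ∀ x ∈ realJulia R, x ≤ b := fun x hx => le_csSup hcpt.bddAbove hx
  have hPs : P.Splits := by simpa using hsplits 0 hzero'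
  have hPne : P ≠ 0 := by
    rintro rfl; simp at hdeg; omega
  -- If 0 were the only root, P would be a multiple of X^N with N at least 2, and its derivative at
  -- 0 would vanish.
  obtain ⟨z, hz0, hz⟩ : ∃ z : ℝ, z ≠ 0 ∧ P.eval z = 0 := by
    by_contra! hall
    have hrep : P.roots = Multiset.replicate R.natDegree 0 := by
      rw [Multiset.eq_replicate]
      refine ⟨by rw [← hPs.natDegree_eq_card_roots, hdeg], fun a ha => ?_⟩
      by_contra hne
      exact hall a hne ((mem_roots hPne).1 ha)
    have h1 := hPs.eq_prod_roots
    rw [hrep] at h1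
    rw [h1] at hPc
    simp only [map_zero, sub_zero, Multiset.map_replicate, Multiset.prod_replicate,
      derivative_C_mul, derivative_X_pow, eval_mul, eval_pow, eval_X] at hPc
    rw [zero_pow (by omega)] at hPc
    simp at hPc; linarith
  have hzJ : z ∈ realJulia R := by rw [← hmem, hz]; exact hzero'
  have hzpos : 0 < z := lt_of_le_of_ne (hnn z hzJ) hz0.symm
  have hbpos : 0 < b := hzpos.trans_le (hle z hzJ)
  refine ⟨P, b, hP, hP0, hPc, hbpos, hJK, fun z hz => (hJ z hz).1,
    fun x hx => ⟨hnn x hx, hle x hx⟩, hzero', hb, hmem, hsplits, ?_, hcpt⟩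
  -- Were J contained in {0, b}, the nonzero root z would be b, so P would vanish at both candidates
  -- for a preimage of b.
  by_contra! hall
  have hdich : ∀ x ∈ realJulia R, x = 0 ∨ x = b := by
    intro x hx
    by_contra! hne
    exact hall x hx ⟨lt_of_le_of_ne (hnn x hx) hne.1.symm, lt_of_le_of_ne (hle x hx) hne.2⟩
  have hzb : z = b := (hdich z hzJ).resolve_left hz0
  obtain ⟨w, hw⟩ := (hsplits b hb).exists_eval_eq_zero (by
    rw [← Nat.cast_zero (R := WithBot ℕ)]
    refine fun h => ?_
    have := natDegree_eq_of_degree_eq_some h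
    rw [natDegree_sub_C] at this
    omega)
  rw [eval_sub, eval_C, sub_eq_zero] at hw
  have hwJ : w ∈ realJulia R := by rw [← hmem, hw]; exact hb
  rcases hdich w hwJ with rfl | rfl
  · rw [hP0] at hw; exact hbpos.ne hw
  · rw [← hzb, hz] at hw; exact hz0 hw.symm

/-- If P(b) lay in (0, b), the unbounded P would take the value 0 or b at a point beyond b. That
point would belong to J by complete invariance, contradicting the maximality of b. -/
theorem IsRealModel.eval_b {R : ℂ[X]} {P : ℝ[X]} {c b : ℝ} (h : IsRealModel R P c b)
    (hdeg : 0 < P.natDegree) : P.eval b ≤ 0 ∨ b ≤ P.eval b := by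
  by_contra! hc
  obtain ⟨x, hx, hbx⟩ := (((P.abs_tendsto_atTop (natDegree_pos_iff_degree_pos.1 hdeg)).eventually_gt_atTop
    b).and (eventually_gt_atTop b)).exists
  have key : ∀ y ∈ realJulia R, y ∈ P.eval '' Icc b x → y = P.eval b := by
    rintro y hy ⟨t, ht, rfl⟩
    rw [h.eval_mem_iff] at hy
    rw [le_antisymm (h.subset_Icc hy).2 ht.1]
  rcases lt_abs.1 hx with h1 | h1
  · have := key b h.b_mem (intermediate_value_Icc hbx.le P.continuous.continuousOn
      ⟨hc.2.le, h1.le⟩)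
    linarith
  · have := key 0 h.zero_mem (intermediate_value_Icc' hbx.le P.continuous.continuousOn
      ⟨by linarith [h.b_pos], hc.1.le⟩)
    linarith

theorem IsRealModel.exists_isLapPartition {R : ℂ[X]} {P : ℝ[X]} {c b : ℝ} {N : ℕ}
    (h : IsRealModel R P c b) (hdeg : P.natDegree = N) (hN : 2 ≤ N) :
    ∃ p : Fin (N + 1) → ℝ, IsLapPartition P b p := by
  obtain ⟨y, hy, hy0, hyb⟩ := h.exists_mem_Ioo
  have hend := h.eval_b (by omega)
  refine PolyZeta.exists_isLapPartition hdeg hN (by simpa using h.splits 0 h.zero_mem)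
    (h.splits b h.b_mem) (h.splits y hy) hy0 hyb (fun x hx => ?_) h.eval_zero hend
  have hxJ : x ∈ realJulia R := by rw [← h.eval_mem_iff, hx]; exact hy
  have hxI := h.subset_Icc hxJ
  refine ⟨lt_of_le_of_ne hxI.1 ?_, lt_of_le_of_ne hxI.2 ?_⟩
  · rintro rfl; rw [h.eval_zero] at hx; exact hy0.ne hx
  · rintro rfl
    rw [hx] at hend
    rcases hend with h | h <;> linarith

/-! ### Inverse branches and multiplicities of preimages -/

/-- A continuous strictly increasing function on a compact interval has a globally defined
continuous monotone left inverse. -/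
theorem exists_monotone_inverse {f : ℝ → ℝ} (hf : Continuous f) {u v : ℝ} (huv : u ≤ v)
    (h : StrictMonoOn f (Icc u v)) :
    ∃ g : ℝ → ℝ, Continuous g ∧ Monotone g ∧ (∀ x, g x ∈ Icc u v) ∧
      ∀ x ∈ Icc u v, g (f x) = x := by
  let cl : ℝ → ℝ := fun x => max u (min v x)
  have hclc : Continuous cl := by fun_prop
  have hclm : Monotone cl := fun x y hxy => max_le_max le_rfl (min_le_min le_rfl hxy)
  have hclI : ∀ x, cl x ∈ Icc u v := fun x => ⟨le_max_left _ _, max_le huv (min_le_left _ _)⟩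
  have hcle : ∀ x ∈ Icc u v, cl x = x := fun x hx => by simp [cl, hx.1, hx.2]
  have hcl1 : ∀ x y, x ≤ y → cl y - cl x ≤ y - x := by
    intro x y hxy
    simp only [cl]
    grind
  -- Continuing f with slope one on both sides gives an increasing homeomorphism of the line; its
  -- inverse, clamped to [u, v], is the required left inverse.
  let F : ℝ → ℝ := fun x => f (cl x) + (x - cl x)
  have hFc : Continuous F := by fun_prop
  have hFm : StrictMono F := by
    intro x y hxy
    simp only [F]
    have h1 := hcl1 x y hxy.le
    rcases (hclm hxy.le).eq_or_lt with h2 | h2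
    · rw [h2]; linarith
    · have := h (hclI x) (hclI y) h2
      linarith
  have hfu : ∀ x, f u ≤ f (cl x) := fun x =>
    h.monotoneOn ⟨le_rfl, huv⟩ (hclI x) (hclI x).1
  have hfv : ∀ x, f (cl x) ≤ f v := fun x =>
    h.monotoneOn (hclI x) ⟨huv, le_rfl⟩ (hclI x).2
  have hFs : Function.Surjective F := by
    refine hFc.surjective ?_ ?_
    · refine tendsto_atTop_mono (f := fun x => x + (f u - v)) (fun x => ?_)
        (tendsto_atTop_add_const_right _ _ tendsto_id)
      have := hfu x; have := (hclI x).2; simp only [F]; linarith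
    · refine tendsto_atBot_mono (f := fun x => x + (f v - u)) (fun x => ?_)
        (tendsto_atBot_add_const_right _ _ tendsto_id)
      have := hfv x; have := (hclI x).1; simp only [F]; linarith
  let e := StrictMono.orderIsoOfSurjective F hFm hFs
  refine ⟨fun x => cl (e.symm x), hclc.comp e.symm.continuous,
    fun x y hxy => hclm (e.symm.monotone hxy), fun x => hclI _, fun x hx => ?_⟩
  have : f x = e x := by
    change f x = F x
    simp [F, hcle x hx]
  simp only [this, e.symm_apply_apply, hcle x hx]

theorem exists_inverse_branch {f : ℝ → ℝ} (hf : Continuous f) {u v : ℝ} (huv : u ≤ v)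
    (h : StrictMonoOn f (Icc u v) ∨ StrictAntiOn f (Icc u v)) :
    ∃ g : ℝ → ℝ, Continuous g ∧ (Monotone g ∨ Antitone g) ∧
      (StrictMonoOn f (Icc u v) → Monotone g) ∧ (∀ x, g x ∈ Icc u v) ∧
      ∀ x ∈ Icc u v, g (f x) = x := by
  by_cases hm : StrictMonoOn f (Icc u v)
  · obtain ⟨g, h1, h2, h3, h4⟩ := exists_monotone_inverse hf huv hm
    exact ⟨g, h1, Or.inl h2, fun _ => h2, h3, h4⟩
  · have ha := h.resolve_left hm
    obtain ⟨g, h1, h2, h3, h4⟩ := exists_monotone_inverse hf.neg huv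
      (fun x hx y hy hxy => neg_lt_neg (ha hx hy hxy))
    refine ⟨fun x => g (-x), h1.comp continuous_neg,
      Or.inr fun x y hxy => h2 (neg_le_neg hxy), fun h => absurd h hm, fun x => h3 _, h4⟩

/-- Globally defined continuous monotone inverse branches `g j` of `P` on the intervals of a lap
partition. -/
structure IsBranchSystem (P : ℝ[X]) (b : ℝ) {N : ℕ} (p : Fin (N + 1) → ℝ) (g : Fin N → ℝ → ℝ) :
    Prop where
  laps : IsLapPartition P b p
  natDegree_eq : P.natDegree = N
  eval_zero : P.eval 0 = 0
  b_pos : 0 < b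
  continuous : ∀ j, Continuous (g j)
  mono : ∀ j, Monotone (g j) ∨ Antitone (g j)
  mono_of : ∀ j, StrictMonoOn (fun x => P.eval x) (lap p j) → Monotone (g j)
  mem_lap : ∀ j x, g j x ∈ lap p j
  left_inv : ∀ j, ∀ x ∈ lap p j, g j (P.eval x) = x

/-- The common image of the intervals of monotonicity. -/
def imageInter (P : ℝ[X]) {N : ℕ} (p : Fin (N + 1) → ℝ) : Set ℝ :=
  ⋂ j, (fun x => P.eval x) '' lap p j

theorem IsLapPartition.exists_isBranchSystem {P : ℝ[X]} {b : ℝ} {N : ℕ} {p : Fin (N + 1) → ℝ}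
    (h : IsLapPartition P b p) (hdeg : P.natDegree = N) (h0 : P.eval 0 = 0) (hb : 0 < b) :
    ∃ g : Fin N → ℝ → ℝ, IsBranchSystem P b p g := by
  have := fun j : Fin N => exists_inverse_branch P.continuous
    (h.strictMono.monotone (Fin.castSucc_lt_succ (i := j)).le)
    ((h.lap j).imp And.left And.left)
  choose g h1 h2 h3 h4 h5 using this
  exact ⟨g, h, hdeg, h0, hb, h1, h2, h3, h4, h5⟩

namespace IsBranchSystem

variable {P : ℝ[X]} {b : ℝ} {N : ℕ} {p : Fin (N + 1) → ℝ} {g : Fin N → ℝ → ℝ}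

theorem castSucc_le_succ (h : IsBranchSystem P b p g) (j : Fin N) : p j.castSucc ≤ p j.succ :=
  h.laps.strictMono.monotone (Fin.castSucc_lt_succ (i := j)).le

theorem lap_subset (h : IsBranchSystem P b p g) (j : Fin N) : lap p j ⊆ Icc 0 b := by
  rw [← h.laps.zero, ← h.laps.last]
  exact Icc_subset_Icc (h.laps.strictMono.monotone (Fin.zero_le _))
    (h.laps.strictMono.monotone (Fin.le_last _))

theorem mem_Icc (h : IsBranchSystem P b p g) (j : Fin N) (x : ℝ) : g j x ∈ Icc 0 b :=
  h.lap_subset j (h.mem_lap j x)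

theorem right_inv (h : IsBranchSystem P b p g) {x : ℝ} (hx : x ∈ imageInter P p) (j : Fin N) :
    P.eval (g j x) = x := by
  obtain ⟨y, hy, rfl⟩ := mem_iInter.1 hx j
  simp only
  rw [h.left_inv j y hy]

theorem Icc_subset_imageInter (h : IsBranchSystem P b p g) : Icc 0 b ⊆ imageInter P p := by
  intro x hx
  refine mem_iInter.2 fun j => ?_
  rcases h.laps.lap j with ⟨-, h1, h2⟩ | ⟨-, h1, h2⟩
  · exact intermediate_value_Icc (h.castSucc_le_succ j) P.continuous.continuousOn
      ⟨h1.trans hx.1, hx.2.trans h2⟩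
  · exact intermediate_value_Icc' (h.castSucc_le_succ j) P.continuous.continuousOn
      ⟨h1.trans hx.1, hx.2.trans h2⟩

theorem mem_imageInter (h : IsBranchSystem P b p g) (j : Fin N) (x : ℝ) :
    g j x ∈ imageInter P p :=
  h.Icc_subset_imageInter (h.mem_Icc j x)

theorem strictMonoOn_zero [NeZero N] (h : IsBranchSystem P b p g) :
    StrictMonoOn (fun x => P.eval x) (lap p 0) := by
  rcases h.laps.lap 0 with ⟨h1, -, -⟩ | ⟨-, -, h1⟩
  · exact h1
  · rw [Fin.castSucc_zero', h.laps.zero, h.eval_zero] at h1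
    exact absurd h1 (not_le.2 h.b_pos)

theorem monotone_zero [NeZero N] (h : IsBranchSystem P b p g) : Monotone (g 0) :=
  h.mono_of 0 h.strictMonoOn_zero

theorem zero_mem_lap [NeZero N] (h : IsBranchSystem P b p g) : 0 ∈ lap p 0 := by
  refine ⟨by rw [Fin.castSucc_zero', h.laps.zero], ?_⟩
  rw [← h.laps.zero]
  exact h.laps.strictMono.monotone (Fin.zero_le _)

theorem g_zero_zero [NeZero N] (h : IsBranchSystem P b p g) : g 0 0 = 0 := by
  have := h.left_inv 0 0 h.zero_mem_lap
  rwa [h.eval_zero] at this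

theorem nonneg_of_mem [NeZero N] (h : IsBranchSystem P b p g) {x : ℝ} (hx : x ∈ imageInter P p) :
    0 ≤ x := by
  obtain ⟨y, hy, rfl⟩ := mem_iInter.1 hx 0
  have := h.strictMonoOn_zero.monotoneOn h.zero_mem_lap hy (h.lap_subset 0 hy).1
  simpa [h.eval_zero] using this

theorem isCompact_imageInter [NeZero N] : IsCompact (imageInter P p) := by
  refine IsCompact.of_isClosed_subset (s := (fun x => P.eval x) '' lap p 0)
    (isCompact_Icc.image P.continuous) (isClosed_iInter fun j => ?_) (iInter_subset _ 0)
  exact (isCompact_Icc.image P.continuous).isClosed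

theorem g_eq_zero [NeZero N] (h : IsBranchSystem P b p g) {x : ℝ} (hx : x ∈ imageInter P p)
    {j : Fin N} (hj : g j x = 0) : j = 0 ∧ x = 0 := by
  have hx0 : x = 0 := by rw [← h.right_inv hx j, hj, h.eval_zero]
  refine ⟨?_, hx0⟩
  by_contra hne
  have h1 := (h.mem_lap j x).1
  rw [hj] at h1
  have h2 := h.laps.strictMono (show (0 : Fin (N + 1)) < j.castSucc from by
    rw [Fin.lt_def]
    have : (j : ℕ) ≠ 0 := fun hv => hne (Fin.ext (by simpa using hv))
    simp only [Fin.val_zero, Fin.val_castSucc]; omega)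
  rw [h.laps.zero] at h2
  linarith

theorem eq_of_mem_two_laps (h : IsBranchSystem P b p g) {i j : Fin N} (hij : i < j) {t : ℝ}
    (hi : t ∈ lap p i) (hj : t ∈ lap p j) : (j : ℕ) = i + 1 ∧ t = p j.castSucc := by
  have h1 : p j.castSucc ≤ p i.succ := hj.1.trans hi.2
  have h2 := h.laps.strictMono.le_iff_le.1 h1
  rw [Fin.le_def] at h2
  rw [Fin.lt_def] at hij
  simp only [Fin.val_castSucc, Fin.val_succ] at h2
  have h3 : j.castSucc = i.succ := Fin.ext (by simp; omega)
  refine ⟨by omega, le_antisymm ?_ hj.1⟩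
  rw [h3]; exact hi.2

/-- Two branch values can coincide only at a common endpoint of adjacent laps. That is a critical
point, hence a root of multiplicity at least two, and no three laps meet. So the branch values form
a submultiset of the roots, and there are already N of them. -/
theorem roots_sub_C (h : IsBranchSystem P b p g) (hN : 2 ≤ N) {x : ℝ}
    (hx : x ∈ imageInter P p) :
    (P - C x).roots = (Finset.univ : Finset (Fin N)).val.map fun j => g j x := by
  classical
  have hdegx : (P - C x).natDegree = N := by rw [natDegree_sub_C, h.natDegree_eq]
  have hne : P - C x ≠ 0 := by
    intro h'; rw [h'] at hdegx; simp at hdegx; omega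
  symm
  refine Multiset.eq_of_le_of_card_le ?_ ?_
  · rw [Multiset.le_iff_count]
    intro t
    rw [count_roots, Multiset.count_map]
    have hcard : ((Finset.univ : Finset (Fin N)).val.filter fun j => t = g j x).card =
        ((Finset.univ : Finset (Fin N)).filter fun j => t = g j x).card := rfl
    rw [hcard]
    set s := (Finset.univ : Finset (Fin N)).filter fun j => t = g j x with hs
    have hmem : ∀ j ∈ s, t = g j x := fun j hj => (Finset.mem_filter.1 hj).2
    rcases le_or_gt s.card 1 with hle | hgt
    · rcases s.eq_empty_or_nonempty with he | ⟨j, hj⟩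
      · simp [he]
      · refine hle.trans ((rootMultiplicity_pos hne).2 ?_)
        rw [IsRoot, eval_sub, eval_C, hmem j hj, h.right_inv hx, sub_self]
    · have hlap : ∀ j ∈ s, t ∈ lap p j := fun j hj => by rw [hmem j hj]; exact h.mem_lap j x
      obtain ⟨i, hi, j, hj, hij⟩ : ∃ i ∈ s, ∃ j ∈ s, i < j := by
        obtain ⟨i, hi, j, hj, hne⟩ := Finset.one_lt_card.1 hgt
        rcases lt_or_gt_of_ne hne with h' | h'
        · exact ⟨i, hi, j, hj, h'⟩
        · exact ⟨j, hj, i, hi, h'⟩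
      have hadj : ∀ k ∈ s, ∀ l ∈ s, k < l → (l : ℕ) = k + 1 := fun k hk l hl hkl =>
        (h.eq_of_mem_two_laps hkl (hlap k hk) (hlap l hl)).1
      have h2 : s.card ≤ 2 := by
        refine (Finset.card_le_card (t := {i, j}) fun k hk => ?_).trans Finset.card_le_two
        rw [Finset.mem_insert, Finset.mem_singleton]
        by_contra! hk'
        have e1 := hadj i hi j hj hij
        rcases lt_or_gt_of_ne hk'.1 with h1 | h1
        · have e2 := hadj k hk i hi h1
          have e3 := hadj k hk j hj (h1.trans hij)
          omega
        · have e2 := hadj i hi k hk h1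
          exact hk'.2 (Fin.ext (by omega))
      refine h2.trans ((one_lt_rootMultiplicity_iff_isRoot hne).2 ⟨?_, ?_⟩)
      · rw [IsRoot, eval_sub, eval_C, hmem j hj, h.right_inv hx, sub_self]
      · rw [IsRoot, derivative_sub, derivative_C, sub_zero,
          (h.eq_of_mem_two_laps hij (hlap i hi) (hlap j hj)).2]
        refine h.laps.derivative_eq_zero _ ?_ (Fin.castSucc_ne_last j)
        intro h0
        have h0' := congrArg Fin.val h0
        rw [Fin.lt_def] at hij
        simp at h0'; omega
  · rw [Multiset.card_map, Finset.card_val, Finset.card_univ, Fintype.card_fin, ← hdegx]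
    exact card_roots' _

theorem sub_C_eq_prod (h : IsBranchSystem P b p g) (hN : 2 ≤ N) {x : ℝ}
    (hx : x ∈ imageInter P p) :
    P - C x = C P.leadingCoeff * ∏ j, (X - C (g j x)) := by
  have hroots := h.roots_sub_C hN hx
  have hdegx : (P - C x).natDegree = N := by rw [natDegree_sub_C, h.natDegree_eq]
  have hsp : (P - C x).Splits := by
    rw [splits_iff_card_roots, hroots, hdegx]; simp
  have hlc : (P - C x).leadingCoeff = P.leadingCoeff := by
    refine leadingCoeff_sub_of_degree_lt ?_
    refine lt_of_le_of_lt degree_C_le ?_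
    rw [← natDegree_pos_iff_degree_pos, h.natDegree_eq]; omega
  conv_lhs => rw [hsp.eq_prod_roots, hroots, Multiset.map_map, hlc]
  rfl

end IsBranchSystem

/-! ### The transfer operator as a sum over preimages -/

/-- The operator summing a function over the images under the maps `g j`. -/
def transfer {N : ℕ} {E : Type*} [AddCommMonoid E] (g : Fin N → ℝ → ℝ) (f : ℝ → E) : ℝ → E :=
  fun x => ∑ j, f (g j x)

namespace IsBranchSystem

variable {P : ℝ[X]} {b : ℝ} {N : ℕ} {p : Fin (N + 1) → ℝ} {g : Fin N → ℝ → ℝ}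

/-- Summing over the preimages under an iterate, counted with multiplicity, is iterating the
transfer operator. -/
theorem sum_roots_iterate (h : IsBranchSystem P b p g) (hN : 2 ≤ N) (f : ℂ → ℂ) (n : ℕ) {x : ℝ}
    (hx : x ∈ imageInter P p) :
    ((((P.map Complex.ofRealHom).comp^[n] X - C (x : ℂ)).roots).map f).sum =
      (transfer g)^[n] (fun y : ℝ => f y) x := by
  set R := P.map Complex.ofRealHom with hR
  have hRdeg : R.natDegree = N := by
    rw [hR, natDegree_map_eq_of_injective Complex.ofRealHom.injective, h.natDegree_eq]
  have hfac : ∀ y ∈ imageInter P p,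
      R - C (y : ℂ) = C (P.leadingCoeff : ℂ) * ∏ j, (X - C ((g j y : ℝ) : ℂ)) := by
    intro y hy
    have := congrArg (Polynomial.map Complex.ofRealHom) (h.sub_C_eq_prod hN hy)
    simpa [Polynomial.map_prod] using this
  have hlc : (P.leadingCoeff : ℂ) ≠ 0 := by
    have : P ≠ 0 := by
      rintro rfl
      have := h.natDegree_eq
      simp at this; omega
    exact_mod_cast leadingCoeff_ne_zero.2 this
  have hdeg : ∀ m : ℕ, 0 < (R.comp^[m] X).natDegree := by
    intro m
    induction m with
    | zero => simp
    | succ m ih =>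
      rw [Function.iterate_succ_apply', natDegree_comp]
      exact Nat.mul_pos (by omega) ih
  have hsubne : ∀ (m : ℕ) (a : ℂ), R.comp^[m] X - C a ≠ 0 := by
    intro m a h0
    have := hdeg m
    rw [sub_eq_zero.1 h0] at this
    simp at this
  induction n generalizing x with
  | zero => simp
  | succ n ih =>
    rw [Function.iterate_succ_apply', Function.iterate_succ_apply']
    -- Factoring the outermost R splits the preimages of x into the n-th preimages of the points
    -- g_j(x), with multiplicities added.
    have h1 : R.comp (R.comp^[n] X) - C (x : ℂ) =
        C (P.leadingCoeff : ℂ) * ∏ j, (R.comp^[n] X - C ((g j x : ℝ) : ℂ)) := by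
      have := congrArg (fun Q : ℂ[X] => Q.comp (R.comp^[n] X)) (hfac x hx)
      simpa [Polynomial.prod_comp] using this
    rw [h1, roots_C_mul _ hlc, roots_prod _ _ (Finset.prod_ne_zero_iff.2 fun j _ => hsubne n _)]
    rw [Multiset.map_bind, Multiset.sum_bind, transfer]
    change ∑ j, _ = _
    exact Finset.sum_congr rfl fun j _ => ih (h.mem_imageInter j x)

end IsBranchSystem

/-! ### Existence and properties of the balanced measure -/

open scoped BoundedContinuousFunction in
/-- Continuous self-maps of the line with values in a common compact set have a balanced
probability measure. -/
theorem exists_balanced_measure {N : ℕ} (hN : 0 < N) {g : Fin N → ℝ → ℝ}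
    (hg : ∀ j, Continuous (g j)) {K : Set ℝ} (hK : IsCompact K) (hgK : ∀ j x, g j x ∈ K) :
    ∃ κ : Measure ℝ, IsProbabilityMeasure κ ∧ κ Kᶜ = 0 ∧
      (N : ENNReal) • κ = ∑ j, κ.map (g j) := by
  have hN0 : (N : ENNReal) ≠ 0 := by exact_mod_cast hN.ne'
  have hNt : (N : ENNReal) ≠ ⊤ := ENNReal.natCast_ne_top N
  have hNR : (0 : ℝ) < N := by exact_mod_cast hN
  let T : Measure ℝ → Measure ℝ := fun μ => (N : ENNReal)⁻¹ • ∑ j, μ.map (g j)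
  have hTint : ∀ (μ : Measure ℝ) [IsFiniteMeasure μ] (f : ℝ →ᵇ ℝ),
      ∫ x, f x ∂(T μ) = (N : ℝ)⁻¹ * ∑ j, ∫ x, f (g j x) ∂μ := by
    intro μ _ f
    simp only [T]
    rw [integral_smul_measure, integral_finsetSum_measure fun j _ => f.integrable _]
    simp only [ENNReal.toReal_inv, ENNReal.toReal_natCast, smul_eq_mul]
    congr 1
    exact Finset.sum_congr rfl fun j _ =>
      integral_map (hg j).aemeasurable f.continuous.aestronglyMeasurable
  have hTprob : ∀ μ : Measure ℝ, IsProbabilityMeasure μ → IsProbabilityMeasure (T μ) := by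
    intro μ hμ
    refine ⟨?_⟩
    simp only [T, Measure.smul_apply, Measure.coe_finsetSum, Finset.sum_apply]
    rw [Finset.sum_congr rfl fun j _ => by
      rw [Measure.map_apply (hg j).measurable MeasurableSet.univ, preimage_univ, measure_univ]]
    simp [ENNReal.inv_mul_cancel hN0 hNt]
  have hTK : ∀ μ : Measure ℝ, T μ Kᶜ = 0 := by
    intro μ
    simp only [T, Measure.smul_apply, Measure.coe_finsetSum, Finset.sum_apply]
    rw [Finset.sum_eq_zero, smul_zero]
    intro j _
    rw [Measure.map_apply (hg j).measurable hK.measurableSet.compl]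
    convert! measure_empty (μ := μ)
    ext x
    simp [hgK j x]
  -- Krylov–Bogoliubov: the fixed point of the averaging operator T is a limit of Cesàro means of an
  -- orbit. The first iterate is skipped because the Dirac mass need not live on K, whereas every T
  -- μ does.
  let ν : ℕ → Measure ℝ := fun n => T^[n + 1] (Measure.dirac 0)
  have hνs : ∀ n, ν (n + 1) = T (ν n) := fun n => Function.iterate_succ_apply' _ _ _
  have hνp : ∀ n, IsProbabilityMeasure (ν n) := by
    intro n
    induction n with
    | zero => exact hTprob _ inferInstance
    | succ n ih => rw [hνs]; exact hTprob _ ih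
  have hνK : ∀ n, ν n Kᶜ = 0 := by
    intro n
    simp only [ν, Function.iterate_succ_apply']
    exact hTK _
  let σ : ℕ → Measure ℝ := fun n => ((n + 1 : ℕ) : ENNReal)⁻¹ • ∑ k ∈ Finset.range (n + 1), ν k
  have hσp : ∀ n, IsProbabilityMeasure (σ n) := by
    intro n
    refine ⟨?_⟩
    simp only [σ, Measure.smul_apply, Measure.coe_finsetSum, Finset.sum_apply]
    rw [Finset.sum_congr rfl fun k _ => (hνp k).measure_univ, Finset.sum_const, Finset.card_range,
      nsmul_eq_mul, mul_one, smul_eq_mul]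
    exact ENNReal.inv_mul_cancel (by simp) (ENNReal.natCast_ne_top _)
  have hσK : ∀ n, σ n Kᶜ = 0 := by
    intro n
    simp only [σ, Measure.smul_apply, Measure.coe_finsetSum, Finset.sum_apply]
    rw [Finset.sum_eq_zero fun k _ => hνK k, smul_zero]
  have hσint : ∀ (n : ℕ) (f : ℝ →ᵇ ℝ),
      ∫ x, f x ∂(σ n) = ((n + 1 : ℕ) : ℝ)⁻¹ * ∑ k ∈ Finset.range (n + 1), ∫ x, f x ∂(ν k) := by
    intro n f
    simp only [σ]
    rw [integral_smul_measure, integral_finsetSum_measure fun k _ => f.integrable _,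
      ENNReal.toReal_inv, ENNReal.toReal_natCast, smul_eq_mul]
  let F : ℕ → FiniteMeasure ℝ := fun n => ⟨σ n, inferInstance⟩
  have hF : ∀ n, F n ∈ {μ : FiniteMeasure ℝ | μ.mass ≤ 1 ∧ μ Kᶜ = 0} := by
    intro n
    refine ⟨?_, ?_⟩
    · have : (F n).mass = 1 := by
        rw [← ENNReal.coe_inj, FiniteMeasure.ennreal_mass]
        exact (hσp n).measure_univ
      exact this.le
    · rw [FiniteMeasure.null_iff_toMeasure_null]
      exact hσK n
  -- Compactness of the measures of mass at most one on K yields a limit along a nonprincipal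
  -- ultrafilter, which replaces the passage to a subsequence.
  obtain ⟨κ, hκ, hlim⟩ := (isCompact_setOfPred_finiteMeasure_le_of_isCompact (E := ℝ) 1
    hK).ultrafilter_le_nhds' (Ultrafilter.map F (hyperfilter ℕ))
    (Ultrafilter.mem_map.2 (Filter.mem_of_superset univ_mem fun n _ => hF n))
  have hlim' : Tendsto F (hyperfilter ℕ : Filter ℕ) (𝓝 κ) := hlim
  have hint : ∀ f : ℝ →ᵇ ℝ, Tendsto (fun n => ∫ x, f x ∂(σ n)) (hyperfilter ℕ : Filter ℕ)
      (𝓝 (∫ x, f x ∂(κ : Measure ℝ))) :=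
    fun f => FiniteMeasure.tendsto_iff_forall_integral_tendsto.1 hlim' f
  have hle : (hyperfilter ℕ : Filter ℕ) ≤ atTop := by
    rw [← Nat.cofinite_eq_atTop]; exact hyperfilter_le_cofinite
  have hTlim : ∀ f : ℝ →ᵇ ℝ, Tendsto (fun n => ∫ x, f x ∂(T (σ n))) (hyperfilter ℕ : Filter ℕ)
      (𝓝 (∫ x, f x ∂(T κ))) := by
    intro f
    have h1 : ∀ μ : Measure ℝ, IsFiniteMeasure μ → ∫ x, f x ∂(T μ) =
        (N : ℝ)⁻¹ * ∑ j, ∫ x, (f.compContinuous ⟨g j, hg j⟩) x ∂μ := fun μ _ => hTint μ f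
    rw [h1 κ inferInstance]
    have h2 : (fun n => ∫ x, f x ∂(T (σ n))) = fun n =>
        (N : ℝ)⁻¹ * ∑ j, ∫ x, (f.compContinuous ⟨g j, hg j⟩) x ∂(σ n) :=
      funext fun n => h1 (σ n) inferInstance
    rw [h2]
    exact (tendsto_finsetSum _ fun j _ => hint _).const_mul _
  -- Applying T to a Cesàro mean telescopes: only the first and last terms survive, divided by n +
  -- 1, so the limit is fixed by T.
  have hTsig : ∀ (n : ℕ) (f : ℝ →ᵇ ℝ), ∫ x, f x ∂(T (σ n)) - ∫ x, f x ∂(σ n) =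
      ((n + 1 : ℕ) : ℝ)⁻¹ * (∫ x, f x ∂(ν (n + 1)) - ∫ x, f x ∂(ν 0)) := by
    intro n f
    have h1 : ∫ x, f x ∂(T (σ n)) = ((n + 1 : ℕ) : ℝ)⁻¹ *
        ∑ k ∈ Finset.range (n + 1), ∫ x, f x ∂(ν (k + 1)) := by
      rw [hTint]
      have h2 : ∀ j, ∫ x, f (g j x) ∂(σ n) = ((n + 1 : ℕ) : ℝ)⁻¹ *
          ∑ k ∈ Finset.range (n + 1), ∫ x, f (g j x) ∂(ν k) := fun j =>
        hσint n (f.compContinuous ⟨g j, hg j⟩)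
      simp only [h2, hνs, hTint]
      rw [← Finset.mul_sum, Finset.sum_comm, ← Finset.mul_sum]
      ring
    rw [h1, hσint, ← mul_sub, ← Finset.sum_sub_distrib, Finset.sum_range_sub (fun k =>
      ∫ x, f x ∂(ν k))]
  have hfix : (κ : Measure ℝ) = T κ := by
    have : IsFiniteMeasure (T κ) := by
      refine ⟨?_⟩
      simp only [T, Measure.smul_apply, Measure.coe_finsetSum, Finset.sum_apply, smul_eq_mul]
      exact ENNReal.mul_lt_top (by simpa using hN)
        (ENNReal.sum_lt_top.2 fun j _ => measure_lt_top _ _)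
    refine ext_of_forall_integral_eq_of_IsFiniteMeasure fun f => ?_
    have h1 := (hTlim f).sub (hint f)
    have h2 : Tendsto (fun n => ∫ x, f x ∂(T (σ n)) - ∫ x, f x ∂(σ n))
        (hyperfilter ℕ : Filter ℕ) (𝓝 0) := by
      refine Tendsto.mono_left ?_ hle
      have h3 : Tendsto (fun n : ℕ => ((n + 1 : ℕ) : ℝ)⁻¹ * (2 * ‖f‖)) atTop (𝓝 0) := by
        have := (tendsto_inv_atTop_zero.comp (tendsto_natCast_atTop_atTop (R := ℝ))).comp
          (tendsto_add_atTop_nat 1)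
        simpa using this.mul_const (2 * ‖f‖)
      refine squeeze_zero_norm (fun n => ?_) h3
      rw [hTsig, norm_mul, norm_inv, Real.norm_natCast]
      refine mul_le_mul_of_nonneg_left ?_ (by positivity)
      have hb : ∀ k, ‖∫ x, f x ∂(ν k)‖ ≤ ‖f‖ := fun k => by
        have := hνp k
        exact f.norm_integral_le_norm _
      calc _ ≤ ‖∫ x, f x ∂(ν (n + 1))‖ + ‖∫ x, f x ∂(ν 0)‖ := norm_sub_le _ _
        _ ≤ _ := by linarith [hb (n + 1), hb 0]
    exact (sub_eq_zero.1 (tendsto_nhds_unique h1 h2)).symm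
  refine ⟨κ, ⟨?_⟩, ?_, ?_⟩
  · have h1 := hint (BoundedContinuousFunction.const ℝ 1)
    simp only [BoundedContinuousFunction.const_apply, integral_const, smul_eq_mul, mul_one] at h1
    have h2 : Tendsto (fun n => (σ n).real univ) (hyperfilter ℕ : Filter ℕ) (𝓝 1) := by
      have : (fun n => (σ n).real univ) = fun _ => 1 := funext fun n => by
        simp [Measure.real]
      rw [this]; exact tendsto_const_nhds
    have h3 := tendsto_nhds_unique h1 h2
    rw [Measure.real, ENNReal.toReal_eq_one_iff] at h3
    exact h3
  · exact (FiniteMeasure.null_iff_toMeasure_null κ Kᶜ).1 hκ.2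
  · conv_lhs => rw [hfix]
    simp only [T]
    rw [smul_smul, ENNReal.mul_inv_cancel hN0 hNt, one_smul]

/-- `κ` is a probability measure on `[0, b]` which is the average of its images under the maps
`g j`. -/
structure IsSelfSimilar (b : ℝ) {N : ℕ} (g : Fin N → ℝ → ℝ) (κ : Measure ℝ) : Prop where
  isProbability : IsProbabilityMeasure κ
  compl_Icc : κ (Icc 0 b)ᶜ = 0
  smul_eq : (N : ENNReal) • κ = ∑ j, κ.map (g j)

namespace IsSelfSimilar

variable {P : ℝ[X]} {b : ℝ} {N : ℕ} {p : Fin (N + 1) → ℝ} {g : Fin N → ℝ → ℝ} {κ : Measure ℝ}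

theorem mul_measure (hκ : IsSelfSimilar b g κ) (h : IsBranchSystem P b p g) {A : Set ℝ}
    (hA : MeasurableSet A) : (N : ENNReal) * κ A = ∑ j, κ (g j ⁻¹' A) := by
  have := congrArg (fun μ : Measure ℝ => μ A) hκ.smul_eq
  simp only [Measure.smul_apply, Measure.coe_finsetSum, Finset.sum_apply, smul_eq_mul] at this
  rw [this]
  exact Finset.sum_congr rfl fun j _ => Measure.map_apply (h.continuous j).measurable hA

theorem measure_mono (hκ : IsSelfSimilar b g κ) {A B : Set ℝ} (hAB : A ∩ Icc 0 b ⊆ B) :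
    κ A ≤ κ B := by
  have := hκ.isProbability
  calc κ A ≤ κ (A ∩ Icc 0 b) + κ (A \ Icc 0 b) := measure_le_inter_add_sdiff _ _ _
    _ ≤ κ B + 0 := by
      gcongr
      exact (MeasureTheory.measure_mono (fun x hx => hx.2)).trans hκ.compl_Icc.le
    _ = κ B := add_zero _

theorem measure_congr (hκ : IsSelfSimilar b g κ) {A B : Set ℝ}
    (hAB : ∀ x ∈ Icc 0 b, x ∈ A ↔ x ∈ B) : κ A = κ B :=
  le_antisymm (hκ.measure_mono fun x hx => (hAB x hx.2).1 hx.1)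
    (hκ.measure_mono fun x hx => (hAB x hx.2).2 hx.1)

/-- Any point of [0, b] sent to t by a branch is P(t), and only branches of laps through t
contribute. With few such laps the mass of t is small compared with that of P(t), which excludes
atoms at the endpoints. -/
theorem mul_measure_singleton_le (hκ : IsSelfSimilar b g κ) (h : IsBranchSystem P b p g) (t : ℝ)
    (s : Finset (Fin N)) (hs : ∀ j, t ∈ lap p j → j ∈ s) :
    (N : ENNReal) * κ {t} ≤ s.card * κ {P.eval t} := by
  rw [hκ.mul_measure h (measurableSet_singleton t)]
  have : ∀ j, κ (g j ⁻¹' {t}) ≤ if j ∈ s then κ {P.eval t} else 0 := by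
    intro j
    split_ifs with hj
    · refine hκ.measure_mono ?_
      rintro x ⟨hx, hxI⟩
      have hx' : g j x = t := hx
      rw [mem_singleton_iff, ← hx', h.right_inv (h.Icc_subset_imageInter hxI)]
    · refine le_of_eq ?_
      convert! measure_empty (μ := κ)
      ext x
      simp only [mem_preimage, mem_singleton_iff, mem_empty_iff_false, iff_false]
      intro hx
      exact hj (hs j (hx ▸ h.mem_lap j x))
  refine (Finset.sum_le_sum fun j _ => this j).trans (le_of_eq ?_)
  simp

theorem eq_zero_of_mul_le (hκ : IsSelfSimilar b g κ) (hN : 2 ≤ N) {t : ℝ}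
    (ht : (N : ENNReal) * κ {t} ≤ κ {t}) : κ {t} = 0 := by
  have := hκ.isProbability
  by_contra hne
  have h1 : (N : ENNReal) * κ {t} ≤ 1 * κ {t} := by simpa using ht
  have h2 := (ENNReal.mul_le_mul_iff_left hne (measure_ne_top κ {t})).1 h1
  have : N ≤ 1 := by exact_mod_cast h2
  omega

theorem measure_zero (hκ : IsSelfSimilar b g κ) [NeZero N] (h : IsBranchSystem P b p g)
    (hN : 2 ≤ N) : κ {0} = 0 := by
  refine hκ.eq_zero_of_mul_le hN ?_
  have := hκ.mul_measure_singleton_le h 0 {0} fun j hj => by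
    rw [Finset.mem_singleton]
    have h1 := h.left_inv j 0 hj
    rw [h.eval_zero] at h1
    exact (h.g_eq_zero (h.Icc_subset_imageInter ⟨le_rfl, h.b_pos.le⟩) h1).1
  simpa [h.eval_zero] using this

/-- Only the last lap contains b, so N κ{b} ≤ κ{P(b)}. Here P(b) is b itself, or the null point 0,
or lies outside [0, b]. -/
theorem measure_b (hκ : IsSelfSimilar b g κ) [NeZero N] (h : IsBranchSystem P b p g)
    (hN : 2 ≤ N) (hb : P.eval b ≤ 0 ∨ b ≤ P.eval b) : κ {b} = 0 := by
  have h1 := hκ.mul_measure_singleton_le h b {⟨N - 1, by omega⟩} fun j hj => by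
    rw [Finset.mem_singleton]
    have h2 := hj.2
    rw [← h.laps.last] at h2
    have h3 := h.laps.strictMono.le_iff_le.1 h2
    rw [Fin.le_def] at h3
    simp only [Fin.val_last, Fin.val_succ] at h3
    exact Fin.ext (by simp; omega)
  rw [Finset.card_singleton, Nat.cast_one, one_mul] at h1
  by_cases hbb : P.eval b = b
  · rw [hbb] at h1
    exact hκ.eq_zero_of_mul_le hN h1
  · have h2 : κ {P.eval b} = 0 := by
      refine le_antisymm ((hκ.measure_mono (B := {0}) ?_).trans (hκ.measure_zero h hN).le) bot_le
      rintro x ⟨rfl, hx⟩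
      rw [mem_singleton_iff]
      rcases hb with hb | hb
      · exact le_antisymm hb hx.1
      · exact absurd (le_antisymm hx.2 hb) hbb
    rw [h2] at h1
    have h3 := le_antisymm h1 bot_le
    rcases mul_eq_zero.1 h3 with h4 | h4
    · have : N = 0 := by exact_mod_cast h4
      omega
    · exact h4

theorem measure_eval_singleton (hκ : IsSelfSimilar b g κ) [NeZero N] (h : IsBranchSystem P b p g)
    (hN : 2 ≤ N) (i : Fin (N + 1)) : κ {P.eval (p i)} = 0 := by
  have key : ∀ t : ℝ, t ≤ 0 ∨ b ≤ t → P.eval b ≤ 0 ∨ b ≤ P.eval b → κ {t} = 0 := by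
    intro t ht hb
    refine le_antisymm ((hκ.measure_mono (B := {0} ∪ {b}) ?_).trans ?_) bot_le
    · rintro x ⟨rfl, hx⟩
      rcases ht with ht | ht
      · left; exact le_antisymm ht hx.1
      · right; exact le_antisymm hx.2 ht
    · refine (measure_union_le _ _).trans ?_
      rw [hκ.measure_zero h hN, hκ.measure_b h hN hb, add_zero]
  have hend : ∀ i, P.eval (p i) ≤ 0 ∨ b ≤ P.eval (p i) := by
    intro i
    rcases Fin.eq_castSucc_or_eq_last i with ⟨j, rfl⟩ | rfl
    · rcases h.laps.lap j with h1 | h1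
      · exact Or.inl h1.2.1
      · exact Or.inr h1.2.2
    · have hl : Fin.last N = (⟨N - 1, by omega⟩ : Fin N).succ := Fin.ext (by simp; omega)
      rw [hl]
      rcases h.laps.lap ⟨N - 1, by omega⟩ with h1 | h1
      · exact Or.inr h1.2.2
      · exact Or.inl h1.2.1
  refine key _ (hend i) ?_
  have := hend (Fin.last N)
  rwa [h.laps.last] at this

/-- Distinct laps share at most a division point, which a branch attains on [0, b] only at the value
of P there. Those values are outside (0, b) and carry no mass, so the laps can be treated as
disjoint. -/
theorem measure_preimage_lap (hκ : IsSelfSimilar b g κ) [NeZero N] (h : IsBranchSystem P b p g)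
    (hN : 2 ≤ N) {i j : Fin N} (hij : i ≠ j) : κ (g i ⁻¹' lap p j) = 0 := by
  refine le_antisymm ((hκ.measure_mono (B := ⋃ k, {P.eval (p k)}) ?_).trans ?_) bot_le
  · rintro x ⟨hx, hxI⟩
    have h1 : g i x ∈ lap p i := h.mem_lap i x
    have h2 : g i x ∈ lap p j := hx
    have h3 := h.right_inv (h.Icc_subset_imageInter hxI) i
    rcases lt_or_gt_of_ne hij with h4 | h4
    · refine mem_iUnion.2 ⟨j.castSucc, ?_⟩
      rw [mem_singleton_iff, ← (h.eq_of_mem_two_laps h4 h1 h2).2, h3]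
    · refine mem_iUnion.2 ⟨i.castSucc, ?_⟩
      rw [mem_singleton_iff, ← (h.eq_of_mem_two_laps h4 h2 h1).2, h3]
  · refine (measure_iUnion_le _).trans ?_
    simp [hκ.measure_eval_singleton h hN]

theorem measurePreserving (hκ : IsSelfSimilar b g κ) [NeZero N] (h : IsBranchSystem P b p g) :
    MeasurePreserving (fun x => P.eval x) κ κ := by
  refine ⟨P.continuous.measurable, Measure.ext fun A hA => ?_⟩
  rw [Measure.map_apply P.continuous.measurable hA]
  have h1 := hκ.mul_measure h (P.continuous.measurable hA)
  have h2 : ∀ j, κ (g j ⁻¹' ((fun x => P.eval x) ⁻¹' A)) = κ A := fun j =>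
    hκ.measure_congr fun x hx => by
      rw [mem_preimage, mem_preimage, h.right_inv (h.Icc_subset_imageInter hx)]
  rw [Finset.sum_congr rfl fun j _ => h2 j, Finset.sum_const, Finset.card_univ, Fintype.card_fin,
    nsmul_eq_mul] at h1
  exact (ENNReal.mul_right_inj (by simpa using NeZero.ne N) (ENNReal.natCast_ne_top N)).1 h1

/-- A point whose orbit stays in [0, b] belongs to J, and by invariance almost no orbit leaves [0,
b]. For the masses of cells, the first letter of the word is removed by self-similarity: only the
branch of that letter contributes. -/
theorem isBalancedMeasure (hκ : IsSelfSimilar b g κ) [NeZero N] (h : IsBranchSystem P b p g)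
    (hN : 2 ≤ N) {R : ℂ[X]} {c : ℝ} (hm : IsRealModel R P c b)
    (hhull : hull R = Icc 0 b) : IsBalancedMeasure R p κ := by
  have := hκ.isProbability
  have hev : realEval R = fun x => P.eval x := funext hm.realEval_eq
  have hpres : MeasurePreserving (fun x => P.eval x) κ κ := hκ.measurePreserving h
  have hcell : ∀ w : List (Fin N), MeasurableSet (cell R p w) := by
    intro w
    induction w with
    | nil => rw [cell, hhull]; exact measurableSet_Icc
    | cons j w ih =>
      rw [cell, hev]
      exact measurableSet_Icc.inter (P.continuous.measurable ih)
  refine ⟨hκ.isProbability, ?_, by rw [hev]; exact hpres, ?_⟩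
  · have hsub : (realJulia R)ᶜ ⊆ ⋃ n : ℕ, (fun x => P.eval x)^[n] ⁻¹' (Icc 0 b)ᶜ := by
      intro x hx
      by_contra hc
      simp only [mem_iUnion, mem_preimage, mem_compl_iff, not_exists, not_not] at hc
      exact hx (hm.mem_of_forall_iterate hc)
    refine measure_mono_null hsub (measure_iUnion_null fun n => ?_)
    rw [(hpres.iterate n).measure_preimage measurableSet_Icc.compl.nullMeasurableSet]
    exact hκ.compl_Icc
  · intro w
    induction w with
    | nil =>
      rw [cell, hhull, List.length_nil, pow_zero, inv_one]
      exact (prob_compl_eq_zero_iff measurableSet_Icc).1 hκ.compl_Icc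
    | cons j w ih =>
      have h1 := hκ.mul_measure h (hcell (j :: w))
      have h2 : ∀ i, κ (g i ⁻¹' cell R p (j :: w)) = if i = j then κ (cell R p w) else 0 := by
        intro i
        split_ifs with hij
        · subst hij
          refine hκ.measure_congr fun x hx => ?_
          rw [mem_preimage, cell, hev, mem_inter_iff, mem_preimage,
            h.right_inv (h.Icc_subset_imageInter hx)]
          exact ⟨fun h => h.2, fun hx => ⟨h.mem_lap i x, hx⟩⟩
        · refine measure_mono_null ?_ (hκ.measure_preimage_lap h hN hij)
          rw [cell]
          exact fun x hx => hx.1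
      rw [Finset.sum_congr rfl fun i _ => h2 i, Finset.sum_ite_eq' , if_pos (Finset.mem_univ _),
        ih] at h1
      rw [List.length_cons, pow_succ, ENNReal.mul_inv (by simp) (by simp), ← h1, mul_comm, ← mul_assoc,
        ENNReal.inv_mul_cancel (by simpa using NeZero.ne N) (ENNReal.natCast_ne_top N), one_mul]

theorem integrable_map (hκ : IsSelfSimilar b g κ) {f : ℝ → ℂ}
    (hf : Integrable f κ) (j : Fin N) : Integrable f (κ.map (g j)) := by
  have h1 : κ.map (g j) ≤ (N : ENNReal) • κ := by
    rw [hκ.smul_eq]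
    exact Measure.le_iff.2 fun A _ => by
      rw [Measure.coe_finsetSum, Finset.sum_apply]
      exact Finset.single_le_sum (f := fun i => κ.map (g i) A) (fun _ _ => bot_le) (Finset.mem_univ j)
  exact (hf.smul_measure (ENNReal.natCast_ne_top N)).mono_measure h1

theorem integrable_transfer (hκ : IsSelfSimilar b g κ) (h : IsBranchSystem P b p g) {f : ℝ → ℂ}
    (hf : Integrable f κ) :
    Integrable (transfer g f) κ ∧ ∫ x, transfer g f x ∂κ = N * ∫ x, f x ∂κ := by
  have h1 : ∀ j, Integrable (fun x => f (g j x)) κ := fun j =>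
    (hκ.integrable_map hf j).comp_aemeasurable (h.continuous j).aemeasurable
  refine ⟨integrable_finsetSum _ fun j _ => h1 j, ?_⟩
  have h2 := congrArg (fun μ : Measure ℝ => ∫ x, f x ∂μ) hκ.smul_eq
  rw [integral_smul_measure, integral_finsetSum_measure fun j _ => hκ.integrable_map hf j] at h2
  simp only [transfer]
  rw [integral_finsetSum _ fun j _ => h1 j]
  rw [Finset.sum_congr rfl fun j _ => (integral_map (h.continuous j).aemeasurable
    (hκ.integrable_map hf j).aestronglyMeasurable)] at h2
  rw [← h2, ENNReal.toReal_natCast]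
  simp

theorem integrable_transfer_iterate (hκ : IsSelfSimilar b g κ) (h : IsBranchSystem P b p g)
    {f : ℝ → ℂ} (hf : Integrable f κ) (n : ℕ) :
    Integrable ((transfer g)^[n] f) κ ∧
      ∫ x, (transfer g)^[n] f x ∂κ = (N : ℂ) ^ n * ∫ x, f x ∂κ := by
  induction n with
  | zero => simpa using hf
  | succ n ih =>
    rw [Function.iterate_succ_apply']
    refine ⟨(hκ.integrable_transfer h ih.1).1, ?_⟩
    rw [(hκ.integrable_transfer h ih.1).2, ih.2, pow_succ]
    ring

/-- The iterates of the transfer operator deviate from the mean by at most their oscillation. -/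
theorem norm_transfer_iterate_sub_le (hκ : IsSelfSimilar b g κ) (h : IsBranchSystem P b p g)
    {f : ℝ → ℂ} (hf : Integrable f κ) (n : ℕ) {z : ℝ} {C : ℝ}
    (hC : ∀ y ∈ Icc 0 b, ‖(transfer g)^[n] f z - (transfer g)^[n] f y‖ ≤ C) :
    ‖(transfer g)^[n] f z - (N : ℂ) ^ n * ∫ x, f x ∂κ‖ ≤ C := by
  have := hκ.isProbability
  have h1 := hκ.integrable_transfer_iterate h hf n
  have h2 : (transfer g)^[n] f z - (N : ℂ) ^ n * ∫ x, f x ∂κ =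
      ∫ y, ((transfer g)^[n] f z - (transfer g)^[n] f y) ∂κ := by
    rw [integral_sub (integrable_const _) h1.1, h1.2]
    simp
  rw [h2]
  have h3 : ∀ᵐ y ∂κ, ‖(transfer g)^[n] f z - (transfer g)^[n] f y‖ ≤ C := by
    have : ∀ᵐ y ∂κ, y ∈ Icc 0 b := by
      rw [ae_iff]; exact hκ.compl_Icc
    filter_upwards [this] with y hy using hC y hy
  simpa using norm_integral_le_of_norm_le_const h3

end IsSelfSimilar

/-! ### Koenigs linearization at the repelling fixed point -/

theorem exists_holomorphic_local_inverse {f : ℂ → ℂ} (hf : Differentiable ℂ f) {a : ℂ}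
    (ha : deriv f a ≠ 0) :
    ∃ G : ℂ → ℂ, (∀ᶠ z in 𝓝 (f a), DifferentiableAt ℂ G z) ∧ (∀ᶠ z in 𝓝 (f a), f (G z) = z) ∧
      (∀ᶠ w in 𝓝 a, G (f w) = w) ∧ G (f a) = a := by
  have h1 : ContDiffAt ℂ 1 f a := hf.contDiff.contDiffAt
  have h2 := (hf a).hasDerivAt.hasFDerivAt_equiv ha
  have h3 := h1.hasStrictFDerivAt' h2 one_ne_zero
  refine ⟨h1.localInverse h2 one_ne_zero, ?_, h3.eventually_right_inverse,
    h3.eventually_left_inverse, h1.localInverse_apply_image h2 one_ne_zero⟩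
  have h4 := h1.to_localInverse h2 one_ne_zero
  filter_upwards [h4.eventually (by simp)] with z hz using hz.differentiableAt one_ne_zero

/-- The linearizing function at a repelling fixed point, as a limit of rescaled iterates of the
local inverse. -/
theorem exists_koenigs {R : ℂ[X]} {c : ℝ} (hc : 1 < c) (hR0 : R.eval 0 = 0)
    (hRc : R.derivative.eval 0 = (c : ℂ)) :
    ∃ δ > 0, ∃ G f : ℂ → ℂ, (∀ᶠ w in 𝓝 (0 : ℂ), G (R.eval w) = w) ∧
      DifferentiableOn ℂ f (Metric.ball 0 δ) ∧
      ∀ z ∈ Metric.ball (0 : ℂ) δ, Tendsto (fun k : ℕ => (c : ℂ) ^ k * G^[k] z) atTop (𝓝 (f z)) := by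
  set Q := R.divX.divX with hQ
  have hRQ : ∀ w : ℂ, R.eval w = w ^ 2 * Q.eval w + c * w := by
    intro w
    have h1 : R.coeff 0 = 0 := by rw [coeff_zero_eq_eval_zero, hR0]
    have h2 : R.divX.coeff 0 = c := by
      rw [coeff_divX, ← hRc, ← coeff_zero_eq_eval_zero, coeff_derivative]; simp
    conv_lhs => rw [← divX_mul_X_add R, ← divX_mul_X_add R.divX]
    simp [h1, h2]
    ring
  obtain ⟨M, hM⟩ := (isCompact_closedBall (0 : ℂ) 1).exists_bound_of_continuousOn
    Q.continuous.continuousOn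
  have hM0 : 0 ≤ M := (norm_nonneg _).trans (hM 0 (by simp))
  set s := Real.sqrt c
  have hs : s ^ 2 = c := Real.sq_sqrt (by linarith)
  have hs1 : 1 < s := by
    rw [← Real.sqrt_one]; exact Real.sqrt_lt_sqrt zero_le_one hc
  -- This lies strictly between √c and c. Being below c, it is a valid expansion rate near 0; being
  -- above √c, it makes c/c'² < 1, the ratio of the series of corrections.
  set c' := s * (s + 1) / 2 with hc'
  have hc'c : c' < c := by rw [← hs, hc']; nlinarith
  have hc'1 : 1 < c' := by rw [hc']; nlinarith
  have hcc' : c < c' ^ 2 := by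
    rw [← hs, hc']
    have : s ^ 2 * 1 < s ^ 2 * ((s + 1) / 2) ^ 2 := by
      apply mul_lt_mul_of_pos_left _ (by positivity)
      nlinarith
    nlinarith
  clear_value c'
  set δ₁ := min 1 ((c - c') / (M + 1))
  have hδ₁ : 0 < δ₁ := lt_min one_pos (div_pos (by linarith) (by linarith))
  have hexp : ∀ w : ℂ, ‖w‖ < δ₁ → c' * ‖w‖ ≤ ‖R.eval w‖ := by
    intro w hw
    have h1 : ‖w‖ < 1 := hw.trans_le (min_le_left _ _)
    have h2 : ‖w‖ * (M + 1) ≤ c - c' :=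
      ((lt_div_iff₀ (by linarith)).1 (hw.trans_le (min_le_right _ _))).le
    have h3 : ‖(c : ℂ) * w‖ - ‖w ^ 2 * Q.eval w‖ ≤ ‖R.eval w‖ := by
      rw [hRQ, add_comm]
      exact norm_sub_le_norm_add _ _
    rw [norm_mul, norm_mul, norm_pow, Complex.norm_real, Real.norm_eq_abs,
      abs_of_pos (by linarith)] at h3
    have h4 : ‖w‖ ^ 2 * ‖Q.eval w‖ ≤ ‖w‖ ^ 2 * M :=
      mul_le_mul_of_nonneg_left (hM w (by simpa using h1.le)) (by positivity)
    nlinarith [norm_nonneg w]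
  have hder : deriv (fun w : ℂ => R.eval w) 0 ≠ 0 := by
    rw [Polynomial.deriv, hRc]
    exact_mod_cast (by linarith : c ≠ 0)
  obtain ⟨G, hG1, hG2, hG3, hG4⟩ := exists_holomorphic_local_inverse R.differentiable hder
  simp only [hR0] at hG1 hG2 hG4
  have hGc : ∀ᶠ z in 𝓝 (0 : ℂ), ‖G z‖ < δ₁ := by
    have h1 : ContinuousAt G 0 := hG1.self_of_nhds.continuousAt
    have h2 : Tendsto (fun z => ‖G z‖) (𝓝 0) (𝓝 ‖G 0‖) := h1.norm
    rw [hG4, norm_zero] at h2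
    exact h2.eventually_lt_const hδ₁
  obtain ⟨δ, hδ, hball⟩ := Metric.eventually_nhds_iff_ball.1 (hG1.and (hG2.and hGc))
  have hcontr : ∀ z ∈ Metric.ball (0 : ℂ) δ, c' * ‖G z‖ ≤ ‖z‖ := by
    intro z hz
    obtain ⟨-, h2, h3⟩ := hball z hz
    have := hexp _ h3
    rwa [h2] at this
  have hmaps : MapsTo G (Metric.ball 0 δ) (Metric.ball 0 δ) := by
    intro z hz
    have h1 := hcontr z hz
    rw [mem_ball_zero_iff] at hz ⊢
    nlinarith [norm_nonneg (G z)]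
  have hiter : ∀ (k : ℕ), ∀ z ∈ Metric.ball (0 : ℂ) δ, c' ^ k * ‖G^[k] z‖ ≤ δ := by
    intro k z hz
    induction k with
    | zero => simpa using (mem_ball_zero_iff.1 hz).le
    | succ k ih =>
      rw [Function.iterate_succ_apply', pow_succ, mul_assoc]
      exact (mul_le_mul_of_nonneg_left (hcontr _ (hmaps.iterate k hz)) (by positivity)).trans ih
  let u : ℕ → ℂ → ℂ := fun k z => (c : ℂ) ^ k * G^[k] z
  have hGd : DifferentiableOn ℂ G (Metric.ball 0 δ) := fun z hz =>
    (hball z hz).1.differentiableWithinAt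
  have hud : ∀ k, DifferentiableOn ℂ (u k) (Metric.ball 0 δ) := fun k =>
    (hGd.iterate hmaps k).const_mul _
  -- Since R(w) = c w + w² Q(w), one step of the rescaled inverse changes the value only by c^k
  -- times a quadratic term, and the k-th iterate has size at most δ/c'^k.
  have hbound : ∀ k, ∀ z ∈ Metric.ball (0 : ℂ) δ,
      ‖u (k + 1) z - u k z‖ ≤ M * δ ^ 2 * (c / c' ^ 2) ^ k := by
    intro k z hz
    set y := G^[k] z
    have hy : y ∈ Metric.ball (0 : ℂ) δ := hmaps.iterate k hz
    obtain ⟨-, h2, h3⟩ := hball y hy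
    have h4 : u (k + 1) z - u k z = -((c : ℂ) ^ k * ((G y) ^ 2 * Q.eval (G y))) := by
      simp only [u, Function.iterate_succ_apply']
      have := hRQ (G y)
      rw [h2] at this
      change (c : ℂ) ^ (k + 1) * G y - (c : ℂ) ^ k * y = _
      linear_combination (-(c : ℂ) ^ k) * this
    have h5 := hiter (k + 1) z hz
    rw [Function.iterate_succ_apply'] at h5
    have h6 : ‖G y‖ ≤ δ / c' ^ k := by
      rw [le_div_iff₀ (by positivity), mul_comm]
      refine le_trans ?_ h5
      refine mul_le_mul_of_nonneg_right ?_ (norm_nonneg _)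
      exact pow_le_pow_right₀ hc'1.le (Nat.le_succ k)
    rw [h4, norm_neg, norm_mul, norm_mul, norm_pow, norm_pow, Complex.norm_real, Real.norm_eq_abs,
      abs_of_pos (by linarith)]
    have h7 : ‖Q.eval (G y)‖ ≤ M := hM _ (by simpa using (h3.trans_le (min_le_left _ _)).le)
    calc c ^ k * (‖G y‖ ^ 2 * ‖Q.eval (G y)‖) ≤ c ^ k * ((δ / c' ^ k) ^ 2 * M) := by gcongr
      _ = M * δ ^ 2 * (c / c' ^ 2) ^ k := by
        rw [div_pow, div_pow, ← pow_mul, ← pow_mul, mul_comm k 2]; ring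
  have hsum : Summable fun k : ℕ => M * δ ^ 2 * (c / c' ^ 2) ^ k :=
    (summable_geometric_of_lt_one (by positivity)
      ((div_lt_one (by positivity)).2 hcc')).mul_left _
  refine ⟨δ, hδ, G, fun z => z + ∑' k, (u (k + 1) z - u k z), hG3, ?_, ?_⟩
  · exact differentiableOn_id.add (Complex.differentiableOn_tsum_of_summable_norm hsum
      (fun k => (hud (k + 1)).sub (hud k)) Metric.isOpen_ball hbound)
  · intro z hz
    have h1 : Summable fun k => u (k + 1) z - u k z :=
      Summable.of_norm_bounded hsum fun k => hbound k z hz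
    have h2 := h1.hasSum.tendsto_sum_nat.const_add z
    refine h2.congr fun n => ?_
    rw [Finset.sum_range_sub (fun k => u k z)]
    simp [u]

/-! ### Concavity on the first lap and the rescaled iterates -/

namespace IsBranchSystem

variable {P : ℝ[X]} {b c : ℝ} {N : ℕ} {p : Fin (N + 1) → ℝ} {g : Fin N → ℝ → ℝ}

/-- All critical points of `P` are the interior points of the lap partition. -/
theorem derivative_roots (h : IsBranchSystem P b p g) (hN : 2 ≤ N) :
    P.derivative.Splits ∧ ∀ z, P.derivative.eval z = 0 → ∃ i, i ≠ 0 ∧ z = p i := by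
  have hne : P.derivative ≠ 0 := by
    intro h0
    have := derivative_eq_zero.1 h0
    rw [h.natDegree_eq] at this; omega
  set s : Finset ℝ := (Finset.univ.filter fun i : Fin (N + 1) => i ≠ 0 ∧ i ≠ Fin.last N).image p
    with hs
  have hcard : s.card = N - 1 := by
    rw [hs, Finset.card_image_of_injective _ h.laps.strictMono.injective]
    have : (Finset.univ.filter fun i : Fin (N + 1) => i ≠ 0 ∧ i ≠ Fin.last N) =
        (Finset.univ.erase 0).erase (Fin.last N) := by
      ext i; simp [and_comm]
    rw [this, Finset.card_erase_of_mem, Finset.card_erase_of_mem (Finset.mem_univ _),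
      Finset.card_univ, Fintype.card_fin]
    · omega
    · rw [Finset.mem_erase]
      refine ⟨fun h0 => ?_, Finset.mem_univ _⟩
      have := congrArg Fin.val h0
      simp at this; omega
  have hdeg : P.derivative.natDegree ≤ N - 1 := by
    have := natDegree_derivative_lt (p := P) (by rw [h.natDegree_eq]; omega)
    rw [h.natDegree_eq] at this; omega
  have hle : s.val ≤ P.derivative.roots := by
    rw [Multiset.le_iff_subset s.nodup]
    intro z hz
    rw [Finset.mem_val] at hz
    obtain ⟨i, hi, rfl⟩ := Finset.mem_image.1 hz
    rw [Finset.mem_filter] at hi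
    rw [mem_roots hne]
    exact h.laps.derivative_eq_zero i hi.2.1 hi.2.2
  have heq : s.val = P.derivative.roots :=
    Multiset.eq_of_le_of_card_le hle ((card_roots' _).trans (hdeg.trans hcard.ge))
  refine ⟨?_, fun z hz => ?_⟩
  · rw [splits_iff_card_roots]
    refine le_antisymm (card_roots' _) ?_
    rw [← heq]
    exact hdeg.trans hcard.ge
  · have : z ∈ s.val := by rw [heq, mem_roots hne]; exact hz
    rw [Finset.mem_val] at this
    obtain ⟨i, hi, rfl⟩ := Finset.mem_image.1 this
    exact ⟨i, (Finset.mem_filter.1 hi).2.1, rfl⟩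

variable [NeZero N]

theorem lap_zero (h : IsBranchSystem P b p g) : lap p 0 = Icc 0 (p (0 : Fin N).succ) := by
  rw [lap, Fin.castSucc_zero', h.laps.zero]

theorem succ_zero_pos (h : IsBranchSystem P b p g) : 0 < p (0 : Fin N).succ := by
  rw [← h.laps.zero]
  exact h.laps.strictMono (Fin.succ_pos _)

theorem succ_zero_lt (h : IsBranchSystem P b p g) (hN : 2 ≤ N) : p (0 : Fin N).succ < b := by
  rw [← h.laps.last]
  refine h.laps.strictMono (Fin.lt_def.2 ?_)
  simp only [Fin.val_succ, Fin.coe_ofNat_eq_mod, Nat.zero_mod, Fin.val_last]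
  omega

theorem le_eval_succ_zero (h : IsBranchSystem P b p g) : b ≤ P.eval (p (0 : Fin N).succ) := by
  rcases h.laps.lap 0 with ⟨-, -, h1⟩ | ⟨-, -, h1⟩
  · exact h1
  · rw [Fin.castSucc_zero', h.laps.zero, h.eval_zero] at h1
    exact absurd h1 (not_le.2 h.b_pos)

/-- On the interior of the first lap P' is positive and all its zeros are real and lie to the right.
Hence P''/P', the sum of 1/(x - zero), is not positive. -/
theorem concaveOn_lap_zero (h : IsBranchSystem P b p g) (hN : 2 ≤ N)
    (hc : 0 < P.derivative.eval 0) : ConcaveOn ℝ (lap p 0) (fun x => P.eval x) := by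
  have hd : deriv (fun x => P.eval x) = fun x => P.derivative.eval x :=
    funext fun x => Polynomial.deriv P
  have hd2 : deriv (fun x => P.derivative.eval x) = fun x => P.derivative.derivative.eval x :=
    funext fun x => Polynomial.deriv _
  refine concaveOn_of_deriv2_nonpos (convex_Icc _ _) P.continuous.continuousOn
    P.differentiable.differentiableOn ?_ ?_
  · rw [hd]; exact P.derivative.differentiable.differentiableOn
  · intro x hx
    rw [Function.iterate_succ_apply', Function.iterate_one, hd, hd2]
    rw [interior_Icc] at hx
    obtain ⟨hsp, hroots⟩ := h.derivative_roots hN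
    have hx0 : 0 < x := by
      have := hx.1
      rwa [Fin.castSucc_zero', h.laps.zero] at this
    have hpos : 0 < P.derivative.eval x := by
      by_contra! hle
      obtain ⟨t, ht, ht0⟩ := intermediate_value_Icc' hx0.le
        P.derivative.continuous.continuousOn ⟨hle, hc.le⟩
      refine h.laps.derivative_ne_zero 0 t ⟨?_, ht.2.trans_lt hx.2⟩ ht0
      rw [Fin.castSucc_zero', h.laps.zero]
      refine lt_of_le_of_ne ht.1 ?_
      rintro rfl
      exact hc.ne' ht0
    have h1 := hsp.eval_derivative_div_eval_of_ne_zero hpos.ne'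
    have h2 : (P.derivative.roots.map fun z => 1 / (x - z)).sum ≤ 0 := by
      refine (Multiset.sum_le_card_nsmul _ 0 fun a ha => ?_).trans (by simp)
      obtain ⟨z, hz, rfl⟩ := Multiset.mem_map.1 ha
      obtain ⟨i, hi, rfl⟩ := hroots z (mem_roots'.1 hz).2
      have : p (0 : Fin N).succ ≤ p i := by
        refine h.laps.strictMono.monotone (Fin.le_def.2 ?_)
        have : (i : ℕ) ≠ 0 := fun hv => hi (Fin.ext (by simpa using hv))
        simp only [Fin.val_succ, Fin.coe_ofNat_eq_mod, Nat.zero_mod]; omega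
      exact one_div_nonpos.2 (by linarith [hx.2])
    rw [← h1, div_le_iff₀ hpos, zero_mul] at h2
    exact h2

/-- The graph lies below its tangent at 0. For the inverse branch this makes c^k R₁^(-k)(x)
nondecreasing in k, the source of all bounds uniform in k. -/
theorem eval_le_mul (h : IsBranchSystem P b p g) (hN : 2 ≤ N) (hPc : P.derivative.eval 0 = c)
    (hc : 1 < c) {u : ℝ} (hu : u ∈ lap p 0) : P.eval u ≤ c * u := by
  have hu0 : 0 ≤ u := (h.lap_subset 0 hu).1
  rcases hu0.eq_or_lt with rfl | hu1
  · simp [h.eval_zero]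
  · have h1 := (h.concaveOn_lap_zero hN (by linarith)).slope_le_of_hasDerivAt h.zero_mem_lap hu
      hu1 (P.hasDerivAt 0)
    rw [slope_def_field, h.eval_zero, hPc, sub_zero, sub_zero, div_le_iff₀ hu1] at h1
    exact h1

/-- By concavity the graph lies above the chord over the first lap. Its slope is at least b divided
by the length of the lap, which exceeds 1, so the first branch contracts geometrically to 0. -/
theorem mul_le_eval (h : IsBranchSystem P b p g) (hN : 2 ≤ N) (hc : 0 < P.derivative.eval 0)
    {u : ℝ} (hu : u ∈ lap p 0) : b / p (0 : Fin N).succ * u ≤ P.eval u := by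
  have hp := h.succ_zero_pos
  have hu' := hu
  rw [h.lap_zero] at hu'
  have h1 := (h.concaveOn_lap_zero hN hc).2 h.zero_mem_lap
    (show p (0 : Fin N).succ ∈ lap p 0 from ⟨h.castSucc_le_succ 0, le_rfl⟩)
    (show 0 ≤ 1 - u / p (0 : Fin N).succ by rw [sub_nonneg, div_le_one hp]; exact hu'.2)
    (div_nonneg hu'.1 hp.le) (by ring)
  simp only [smul_eq_mul, h.eval_zero, mul_zero, zero_add, div_mul_cancel₀ _ hp.ne'] at h1
  refine le_trans ?_ h1
  rw [div_mul_eq_mul_div, mul_comm b u, mul_div_right_comm]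
  exact mul_le_mul_of_nonneg_left h.le_eval_succ_zero (div_nonneg hu'.1 hp.le)

theorem le_mul_g_zero (h : IsBranchSystem P b p g) (hN : 2 ≤ N) (hPc : P.derivative.eval 0 = c)
    (hc : 1 < c) {x : ℝ} (hx : x ∈ imageInter P p) : x ≤ c * g 0 x := by
  have := h.eval_le_mul hN hPc hc (h.mem_lap 0 x)
  rwa [h.right_inv hx] at this

theorem tendsto_g_zero_iterate (h : IsBranchSystem P b p g) (hN : 2 ≤ N)
    (hc : 0 < P.derivative.eval 0) {x : ℝ} (hx : x ∈ imageInter P p) :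
    Tendsto (fun k => (g 0)^[k] x) atTop (𝓝 0) := by
  have hmem : ∀ k, (g 0)^[k] x ∈ imageInter P p := by
    intro k
    induction k with
    | zero => exact hx
    | succ k ih => rw [Function.iterate_succ_apply']; exact h.mem_imageInter 0 _
  set r := p (0 : Fin N).succ / b
  have hr0 : 0 ≤ r := div_nonneg h.succ_zero_pos.le h.b_pos.le
  have hr1 : r < 1 := (div_lt_one h.b_pos).2 (h.succ_zero_lt hN)
  have hle : ∀ k, (g 0)^[k] x ≤ r ^ k * x := by
    intro k
    induction k with
    | zero => simp
    | succ k ih =>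
      have h1 := h.mul_le_eval hN hc (h.mem_lap 0 ((g 0)^[k] x))
      rw [h.right_inv (hmem k), ← Function.iterate_succ_apply' (g 0)] at h1
      have h2 : (g 0)^[k + 1] x ≤ r * (g 0)^[k] x := by
        simp only [r]
        rw [div_mul_eq_mul_div, le_div_iff₀ h.b_pos]
        rw [div_mul_eq_mul_div, div_le_iff₀ h.succ_zero_pos] at h1
        linarith
      rw [pow_succ, mul_comm (r ^ k), mul_assoc]
      exact h2.trans (mul_le_mul_of_nonneg_left ih hr0)
  refine squeeze_zero (fun k => h.nonneg_of_mem (hmem k)) hle ?_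
  simpa using (tendsto_pow_atTop_nhds_zero_of_lt_one hr0 hr1).mul_const x

theorem iterate_g_zero_mem (h : IsBranchSystem P b p g) {x : ℝ} (hx : x ∈ imageInter P p) (k : ℕ) :
    (g 0)^[k] x ∈ imageInter P p := by
  cases k with
  | zero => exact hx
  | succ k => rw [Function.iterate_succ_apply']; exact h.mem_imageInter 0 _

/-- The Koenigs limit is about a complex local inverse. Near 0 this agrees with the real branch `g
0`, and since `g 0` does not exceed its argument, the agreement persists along the whole orbit. -/
theorem exists_tendsto_rescaled (h : IsBranchSystem P b p g) (hN : 2 ≤ N)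
    (hPc : P.derivative.eval 0 = c) (hc : 1 < c) :
    ∃ δ > 0, ∃ f : ℂ → ℂ, DifferentiableOn ℂ f (Metric.ball 0 δ) ∧
      ∀ x ∈ imageInter P p, x < δ →
        Tendsto (fun k : ℕ => ((c ^ k * (g 0)^[k] x : ℝ) : ℂ)) atTop (𝓝 (f x)) := by
  obtain ⟨δ, hδ, G, f, hG, hf, hlim⟩ := exists_koenigs (R := P.map Complex.ofRealHom) hc
    (by
      have := eval_ofReal_map P 0
      rw [h.eval_zero] at this
      exact_mod_cast this)
    (by
      have := eval_ofReal_map P.derivative 0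
      rw [hPc] at this
      rw [derivative_map]
      simpa using this)
  obtain ⟨δ', hδ', hball⟩ := Metric.eventually_nhds_iff_ball.1 hG
  have hpos : ∀ x ∈ imageInter P p, g 0 x ≤ x := by
    intro x hx
    have h1 := h.mul_le_eval hN (by linarith) (h.mem_lap 0 x)
    rw [h.right_inv hx] at h1
    have h2 : 1 ≤ b / p (0 : Fin N).succ := by
      rw [one_le_div h.succ_zero_pos]; exact (h.succ_zero_lt hN).le
    nlinarith [(h.mem_Icc 0 x).1]
  have hGx : ∀ x ∈ imageInter P p, x < δ' → G x = (g 0 x : ℝ) := by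
    intro x hx hxδ
    have h1 := hball ((g 0 x : ℝ) : ℂ) (by
      rw [mem_ball_zero_iff, Complex.norm_real, Real.norm_eq_abs, abs_of_nonneg (h.mem_Icc 0 x).1]
      exact (hpos x hx).trans_lt hxδ)
    rw [eval_ofReal_map, h.right_inv hx] at h1
    exact h1
  have hiter : ∀ (k : ℕ), ∀ x ∈ imageInter P p, x < δ' → G^[k] x = ((g 0)^[k] x : ℝ) := by
    intro k
    induction k with
    | zero => intro x _ _; rfl
    | succ k ih =>
      intro x hx hxδ
      rw [Function.iterate_succ_apply, Function.iterate_succ_apply, hGx x hx hxδ]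
      exact ih _ (h.mem_imageInter 0 x) ((hpos x hx).trans_lt hxδ)
  refine ⟨min δ δ', lt_min hδ hδ', f, hf.mono (Metric.ball_subset_ball (min_le_left _ _)),
    fun x hx hxδ => ?_⟩
  have h1 := hlim x (by
    rw [mem_ball_zero_iff, Complex.norm_real, Real.norm_eq_abs, abs_of_nonneg (h.nonneg_of_mem hx)]
    exact hxδ.trans_le (min_le_left _ _))
  refine h1.congr fun k => ?_
  rw [hiter k x hx (hxδ.trans_le (min_le_right _ _))]
  push_cast
  rfl

end IsBranchSystem

namespace IsBranchSystem

variable {R : ℂ[X]} {P : ℝ[X]} {b c : ℝ} {N : ℕ} {p : Fin (N + 1) → ℝ} {g : Fin N → ℝ → ℝ}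
  [NeZero N]

theorem firstBranch_iterate (h : IsBranchSystem P b p g) (hev : ∀ x, realEval R x = P.eval x)
    {x : ℝ} (hx : x ∈ imageInter P p) (k : ℕ) : (firstBranch R p)^[k] x = (g 0)^[k] x := by
  have hlap : Icc (p 0) (p 1) = lap p 0 := by
    rw [lap, Fin.castSucc_zero', Fin.succ_zero_eq_one']
  have h1 : ∀ y ∈ imageInter P p, firstBranch R p y = g 0 y := by
    intro y hy
    have hex : ∃ a ∈ Icc (p 0) (p 1), realEval R a = y :=
      ⟨g 0 y, by rw [hlap]; exact h.mem_lap 0 y, by rw [hev, h.right_inv hy]⟩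
    have h2 := Function.invFunOn_mem hex
    have h3 := Function.invFunOn_eq hex
    rw [hev] at h3
    rw [hlap] at h2
    have h4 := h.left_inv 0 _ h2
    rw [hlap] at h3
    rw [h3] at h4
    rw [firstBranch, hlap, h4]
  induction k with
  | zero => rfl
  | succ k ih =>
    rw [Function.iterate_succ_apply', Function.iterate_succ_apply', ih,
      h1 _ (h.iterate_g_zero_mem hx k)]

theorem tendsto_fatou (h : IsBranchSystem P b p g) (hN : 2 ≤ N)
    (hev : ∀ x, realEval R x = P.eval x) (hPc : P.derivative.eval 0 = c) (hc : 1 < c)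
    {x : ℝ} (hx : x ∈ imageInter P p) :
    Tendsto (fun k : ℕ => c ^ k * (g 0)^[k] x) atTop (𝓝 (fatou R c p x)) := by
  obtain ⟨δ, hδ, f, -, hlim⟩ := h.exists_tendsto_rescaled hN hPc hc
  -- Finitely many steps bring x into the disc where the Koenigs limit exists; the factor c^k₀
  -- undoes them.
  obtain ⟨k₀, hk₀⟩ := ((h.tendsto_g_zero_iterate hN (by linarith) hx).eventually_lt_const
    hδ).exists
  have h1 := hlim _ (h.iterate_g_zero_mem hx k₀) hk₀
  have h2 := ((Complex.continuous_re.tendsto _).comp h1).const_mul (c ^ k₀)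
  have h3 : Tendsto (fun k : ℕ => c ^ k * (g 0)^[k] x) atTop
      (𝓝 (c ^ k₀ * (f ((g 0)^[k₀] x : ℝ)).re)) := by
    rw [← tendsto_add_atTop_iff_nat k₀]
    refine h2.congr fun k => ?_
    simp only [Function.comp, Complex.ofReal_re]
    rw [Function.iterate_add_apply, pow_add]
    ring
  have h4 : fatou R c p x = c ^ k₀ * (f ((g 0)^[k₀] x : ℝ)).re := by
    rw [fatou]
    simp only [h.firstBranch_iterate hev hx]
    exact h3.limUnder_eq
  rw [h4]
  exact h3

theorem monotone_rescaled (h : IsBranchSystem P b p g) (hN : 2 ≤ N)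
    (hPc : P.derivative.eval 0 = c) (hc : 1 < c) {x : ℝ} (hx : x ∈ imageInter P p) :
    Monotone fun k : ℕ => c ^ k * (g 0)^[k] x := by
  refine monotone_nat_of_le_succ fun k => ?_
  rw [Function.iterate_succ_apply', pow_succ, mul_assoc]
  exact mul_le_mul_of_nonneg_left (h.le_mul_g_zero hN hPc hc (h.iterate_g_zero_mem hx k))
    (by positivity)

theorem rescaled_le_fatou (h : IsBranchSystem P b p g) (hN : 2 ≤ N)
    (hev : ∀ x, realEval R x = P.eval x) (hPc : P.derivative.eval 0 = c) (hc : 1 < c)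
    {x : ℝ} (hx : x ∈ imageInter P p) (k : ℕ) : c ^ k * (g 0)^[k] x ≤ fatou R c p x :=
  (h.monotone_rescaled hN hPc hc hx).ge_of_tendsto (h.tendsto_fatou hN hev hPc hc hx) k

theorem le_rescaled (h : IsBranchSystem P b p g) (hN : 2 ≤ N)
    (hPc : P.derivative.eval 0 = c) (hc : 1 < c)
    {x : ℝ} (hx : x ∈ imageInter P p) (k : ℕ) : x ≤ c ^ k * (g 0)^[k] x := by
  simpa using h.monotone_rescaled hN hPc hc hx (Nat.zero_le k)

theorem le_fatou (h : IsBranchSystem P b p g) (hN : 2 ≤ N)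
    (hev : ∀ x, realEval R x = P.eval x) (hPc : P.derivative.eval 0 = c) (hc : 1 < c)
    {x : ℝ} (hx : x ∈ imageInter P p) : x ≤ fatou R c p x := by
  simpa using h.rescaled_le_fatou hN hev hPc hc hx 0

theorem fatou_eq_mul (h : IsBranchSystem P b p g) (hN : 2 ≤ N)
    (hev : ∀ x, realEval R x = P.eval x) (hPc : P.derivative.eval 0 = c) (hc : 1 < c)
    {x : ℝ} (hx : x ∈ imageInter P p) : fatou R c p x = c * fatou R c p (g 0 x) := by
  have h1 := (h.tendsto_fatou hN hev hPc hc (h.mem_imageInter 0 x)).const_mul c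
  have h2 := (tendsto_add_atTop_iff_nat 1).2 (h.tendsto_fatou hN hev hPc hc hx)
  refine tendsto_nhds_unique h2 (h1.congr fun k => ?_)
  rw [Function.iterate_succ_apply, pow_succ]
  ring

theorem monotoneOn_fatou (h : IsBranchSystem P b p g) (hN : 2 ≤ N)
    (hev : ∀ x, realEval R x = P.eval x) (hPc : P.derivative.eval 0 = c) (hc : 1 < c) :
    MonotoneOn (fatou R c p) (imageInter P p) := by
  intro x hx y hy hxy
  refine le_of_tendsto_of_tendsto' (h.tendsto_fatou hN hev hPc hc hx)
    (h.tendsto_fatou hN hev hPc hc hy) fun k => ?_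
  exact mul_le_mul_of_nonneg_left (h.monotone_zero.iterate k hxy) (by positivity)

theorem exists_fatou_le (h : IsBranchSystem P b p g) (hN : 2 ≤ N)
    (hev : ∀ x, realEval R x = P.eval x) (hPc : P.derivative.eval 0 = c) (hc : 1 < c) :
    ∃ A, ∀ x ∈ imageInter P p, fatou R c p x ≤ A := by
  have hne : (imageInter P p).Nonempty := ⟨0, h.Icc_subset_imageInter ⟨le_rfl, h.b_pos.le⟩⟩
  have hcpt : IsCompact (imageInter P p) := isCompact_imageInter
  exact ⟨fatou R c p (sSup (imageInter P p)), fun x hx =>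
    h.monotoneOn_fatou hN hev hPc hc hx (hcpt.sSup_mem hne) (le_csSup hcpt.bddAbove hx)⟩

end IsBranchSystem

/-! ### Iterating the transfer operator -/

section Transfer

variable {N : ℕ} {g : Fin N → ℝ → ℝ}

theorem transfer_iterate_congr {E : Type*} [AddCommMonoid E] {S : Set ℝ}
    (hS : ∀ j, ∀ x ∈ S, g j x ∈ S) {f f' : ℝ → E} (hf : ∀ x ∈ S, f x = f' x) (m : ℕ) :
    ∀ x ∈ S, (transfer g)^[m] f x = (transfer g)^[m] f' x := by
  induction m with
  | zero => exact hf
  | succ m ih =>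
    intro x hx
    rw [Function.iterate_succ_apply', Function.iterate_succ_apply']
    exact Finset.sum_congr rfl fun j _ => ih _ (hS j x hx)

theorem transfer_iterate_add (f f' : ℝ → ℂ) (m : ℕ) (x : ℝ) :
    (transfer g)^[m] (fun y => f y + f' y) x =
      (transfer g)^[m] f x + (transfer g)^[m] f' x := by
  induction m generalizing x with
  | zero => rfl
  | succ m ih =>
    simp only [Function.iterate_succ_apply', transfer, ih, Finset.sum_add_distrib]

theorem transfer_iterate_const_mul (a : ℂ) (f : ℝ → ℂ) (m : ℕ) (x : ℝ) :
    (transfer g)^[m] (fun y => a * f y) x = a * (transfer g)^[m] f x := by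
  induction m generalizing x with
  | zero => rfl
  | succ m ih =>
    simp only [Function.iterate_succ_apply', transfer, ih, Finset.mul_sum]

theorem norm_transfer_iterate_le {S : Set ℝ} (hS : ∀ j, ∀ x ∈ S, g j x ∈ S) {f : ℝ → ℂ} {C : ℝ}
    (hf : ∀ x ∈ S, ‖f x‖ ≤ C) (m : ℕ) : ∀ x ∈ S, ‖(transfer g)^[m] f x‖ ≤ (N : ℝ) ^ m * C := by
  induction m with
  | zero => simpa using hf
  | succ m ih =>
    intro x hx
    rw [Function.iterate_succ_apply', transfer]
    refine (norm_sum_le _ _).trans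
      ((Finset.sum_le_sum fun j _ => ih _ (hS j x hx)).trans (le_of_eq ?_))
    rw [Finset.sum_const, Finset.card_univ, Fintype.card_fin, nsmul_eq_mul, pow_succ]
    ring

theorem tendsto_transfer_iterate {S : Set ℝ} (hS : ∀ j, ∀ x ∈ S, g j x ∈ S) {f : ℕ → ℝ → ℂ}
    {f' : ℝ → ℂ} (hf : ∀ x ∈ S, Tendsto (fun k => f k x) atTop (𝓝 (f' x))) (m : ℕ) :
    ∀ x ∈ S, Tendsto (fun k => (transfer g)^[m] (f k) x) atTop (𝓝 ((transfer g)^[m] f' x)) := by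
  induction m with
  | zero => exact hf
  | succ m ih =>
    intro x hx
    simp only [Function.iterate_succ_apply', transfer]
    exact tendsto_finsetSum _ fun j _ => ih _ (hS j x hx)

theorem differentiable_transfer_iterate {f : ℂ → ℝ → ℂ} (hf : ∀ x, Differentiable ℂ fun s => f s x)
    (m : ℕ) (x : ℝ) : Differentiable ℂ fun s => (transfer g)^[m] (f s) x := by
  induction m generalizing x with
  | zero => exact hf x
  | succ m ih =>
    simp only [Function.iterate_succ_apply', transfer]
    exact Differentiable.fun_sum fun j _ => ih _

variable [NeZero N]

/-- The part of the transfer operator coming from all branches but the first one. -/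
def transferPlus (g : Fin N → ℝ → ℝ) (f : ℝ → ℂ) : ℝ → ℂ :=
  fun x => ∑ j ∈ Finset.univ.erase 0, f (g j x)

theorem transfer_eq_add (f : ℝ → ℂ) : transfer g f = fun x => f (g 0 x) + transferPlus g f x := by
  funext x
  rw [transfer, transferPlus, Finset.add_sum_erase _ (fun j => f (g j x)) (Finset.mem_univ _)]

/-- A word of branches is sorted by the position of its last letter other than the first branch;
after that letter only `g 0` is applied. The isolated term is the word consisting of `g 0` alone. -/
theorem transfer_iterate_eq_sum (f : ℝ → ℂ) (n : ℕ) (x : ℝ) :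
    (transfer g)^[n] f x = ∑ m ∈ Finset.range n,
      (transfer g)^[m] (transferPlus g fun y => f ((g 0)^[n - 1 - m] y)) x + f ((g 0)^[n] x) := by
  induction n generalizing f with
  | zero => simp
  | succ n ih =>
    rw [Function.iterate_succ_apply, transfer_eq_add, transfer_iterate_add, ih,
      Finset.sum_range_succ]
    have h1 : ∀ m ∈ Finset.range n,
        (transfer g)^[m] (transferPlus g fun y => f (g 0 ((g 0)^[n - 1 - m] y))) x =
        (transfer g)^[m] (transferPlus g fun y => f ((g 0)^[n + 1 - 1 - m] y)) x := by
      intro m hm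
      have h2 : n + 1 - 1 - m = (n - 1 - m) + 1 := by
        have := Finset.mem_range.1 hm; omega
      simp only [h2, Function.iterate_succ_apply']
    rw [Finset.sum_congr rfl h1]
    have h3 : n + 1 - 1 - n = 0 := by omega
    rw [h3, Function.iterate_succ_apply']
    simp only [Function.iterate_zero, id_eq]
    ring

end Transfer

theorem norm_ofReal_cpow_le {a D : ℝ} (ha : 0 < a) (hD : |Real.log a| ≤ D) (s : ℂ) :
    ‖(a : ℂ) ^ (-s / 2)‖ ≤ Real.exp (‖s‖ * D) := by
  rw [Complex.norm_cpow_eq_rpow_re_of_pos ha, Real.rpow_def_of_pos ha]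
  apply Real.exp_le_exp.2
  have h1 : |(-s / 2).re| ≤ ‖s‖ := by
    refine (Complex.abs_re_le_norm _).trans ?_
    rw [norm_div, norm_neg]
    simp only [Complex.norm_ofNat]
    linarith [norm_nonneg s]
  calc Real.log a * (-s / 2).re ≤ |Real.log a * (-s / 2).re| := le_abs_self _
    _ = |(-s / 2).re| * |Real.log a| := by rw [abs_mul, mul_comm]
    _ ≤ ‖s‖ * D := mul_le_mul h1 hD (abs_nonneg _) (norm_nonneg _)

theorem ofReal_pow_cpow {c : ℝ} (hc : 0 ≤ c) (k : ℕ) (w : ℂ) :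
    ((c ^ k : ℝ) : ℂ) ^ w = ((c : ℂ) ^ w) ^ k := by
  induction k with
  | zero => simp
  | succ k ih =>
    rw [pow_succ, Complex.ofReal_mul, Complex.mul_cpow_ofReal_nonneg (by positivity) hc, ih,
      pow_succ]

theorem differentiable_ofReal_cpow {a : ℝ} (ha : 0 < a) :
    Differentiable ℂ fun s : ℂ => (a : ℂ) ^ (-s / 2) := by
  have : (a : ℂ) ≠ 0 := by exact_mod_cast ha.ne'
  exact (differentiable_id.neg.div_const 2).const_cpow (Or.inl this)

/-! ### The approximating sums and the pole -/

namespace IsBranchSystem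

variable {R : ℂ[X]} {P : ℝ[X]} {b c : ℝ} {N : ℕ} {p : Fin (N + 1) → ℝ} {g : Fin N → ℝ → ℝ}
  [NeZero N]

theorem succ_zero_le_g (h : IsBranchSystem P b p g) {j : Fin N} (hj : j ≠ 0) (x : ℝ) :
    p (0 : Fin N).succ ≤ g j x := by
  refine le_trans (h.laps.strictMono.monotone (Fin.le_def.2 ?_)) (h.mem_lap j x).1
  have : (j : ℕ) ≠ 0 := fun hv => hj (Fin.ext (by simpa using hv))
  simp only [Fin.val_succ, Fin.coe_ofNat_eq_mod, Nat.zero_mod, Fin.val_castSucc]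
  omega

/-- The rescaled powers `(cᵏ R₁⁻ᵏ(x)) ^ (-s / 2)`, with value zero at the origin. -/
def rescaledPow (c : ℝ) (g : Fin N → ℝ → ℝ) (k : ℕ) (s : ℂ) (x : ℝ) : ℂ :=
  if x = 0 then 0 else ((c ^ k * (g 0)^[k] x : ℝ) : ℂ) ^ (-s / 2)

theorem iterate_g_zero_pos (h : IsBranchSystem P b p g) {x : ℝ} (hx : x ∈ imageInter P p)
    (hx0 : x ≠ 0) (k : ℕ) : 0 < (g 0)^[k] x := by
  induction k with
  | zero => exact lt_of_le_of_ne (h.nonneg_of_mem hx) hx0.symm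
  | succ k ih =>
    rw [Function.iterate_succ_apply']
    refine lt_of_le_of_ne (h.mem_Icc 0 _).1 fun h0 => ?_
    exact ih.ne' (h.g_eq_zero (h.iterate_g_zero_mem hx k) h0.symm).2

/-- Of the n factors c, those matching the final run of the first branch are absorbed into the
rescaled iterate; the other m + 1 become powers of c^(-s/2). Assigning the value zero at the origin
accounts for the omitted preimage 0. -/
theorem zetaApprox_eq (h : IsBranchSystem P b p g) (hN : 2 ≤ N)
    (hR : R = P.map Complex.ofRealHom) (hc : 1 < c) {z₀ : ℝ} (hz : z₀ ∈ imageInter P p)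
    (n : ℕ) (s : ℂ) :
    zetaApprox R c z₀ n s = ∑ m ∈ Finset.range n, ((c : ℂ) ^ (-s / 2)) ^ (m + 1) *
      (transfer g)^[m] (transferPlus g (rescaledPow c g (n - 1 - m) s)) z₀ +
        rescaledPow c g n s z₀ := by
  have hS : ∀ j, ∀ x ∈ imageInter P p, g j x ∈ imageInter P p := fun j x _ => h.mem_imageInter j x
  let f : ℂ → ℂ := fun z => if z ≠ 0 then ((c : ℂ) ^ n * z) ^ (-s / 2) else 0
  have hfilter : ∀ M : Multiset ℂ,
      ((M.filter fun z => z ≠ 0).map fun z => ((c : ℂ) ^ n * z) ^ (-s / 2)).sum =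
        (M.map f).sum := by
    intro M
    induction M using Multiset.induction_on with
    | empty => simp
    | cons a M ih =>
      by_cases ha : a ≠ 0
      · rw [Multiset.filter_cons_of_pos (p := fun z : ℂ => z ≠ 0) _ ha, Multiset.map_cons, Multiset.map_cons,
          Multiset.sum_cons, Multiset.sum_cons, ih]
        simp [f, ha]
      · rw [Multiset.filter_cons_of_neg (p := fun z : ℂ => z ≠ 0) _ ha, Multiset.map_cons, Multiset.sum_cons, ih]
        simp [f, not_not.1 ha]
  rw [zetaApprox, hfilter, hR, h.sum_roots_iterate hN f n hz, transfer_iterate_eq_sum]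
  have hf : ∀ k ≤ n, ∀ y ∈ imageInter P p, f ((g 0)^[k] y : ℝ) =
      ((c : ℂ) ^ (-s / 2)) ^ (n - k) * rescaledPow c g k s y := by
    intro k hk y hy
    by_cases hy0 : y = 0
    · have h0 : (g 0)^[k] 0 = 0 := Function.iterate_fixed h.g_zero_zero k
      simp [f, rescaledPow, hy0, h0]
    · have hpos := h.iterate_g_zero_pos hy hy0 k
      have hc0 : 0 < c := by linarith
      have h1 : (((g 0)^[k] y : ℝ) : ℂ) ≠ 0 := by exact_mod_cast hpos.ne'
      simp only [f, rescaledPow, if_neg hy0, ne_eq, h1, not_false_eq_true, if_true]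
      have h2 : (c : ℂ) ^ n * (((g 0)^[k] y : ℝ) : ℂ) =
          ((c ^ (n - k) : ℝ) : ℂ) * ((c ^ k * (g 0)^[k] y : ℝ) : ℂ) := by
        push_cast
        rw [← mul_assoc, ← pow_add, Nat.sub_add_cancel hk]
      rw [h2, Complex.mul_cpow_ofReal_nonneg (by positivity) (by positivity)]
      congr 1
      exact ofReal_pow_cpow hc0.le _ _
  congr 1
  · refine Finset.sum_congr rfl fun m hm => ?_
    have hm' := Finset.mem_range.1 hm
    rw [← transfer_iterate_const_mul]
    refine transfer_iterate_congr hS (fun x hx => ?_) m z₀ hz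
    rw [transferPlus, transferPlus, Finset.mul_sum]
    refine Finset.sum_congr rfl fun j _ => ?_
    rw [hf (n - 1 - m) (by omega) _ (hS j x hx)]
    congr 2
    omega
  · rw [hf n le_rfl z₀ hz, Nat.sub_self, pow_zero, one_mul]

end IsBranchSystem

/-- The power `ℛ(x) ^ (-s / 2)` of the linearizing function. -/
def fatouPow (R : ℂ[X]) (c : ℝ) {N : ℕ} (p : Fin (N + 1) → ℝ) (s : ℂ) (x : ℝ) : ℂ :=
  ((fatou R c p x : ℝ) : ℂ) ^ (-s / 2)

/-- The restriction of `ℛ(x) ^ (-s / 2)` to a fundamental domain `(a, P(a)]`. -/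
def cutPow (R : ℂ[X]) (P : ℝ[X]) (c : ℝ) {N : ℕ} (p : Fin (N + 1) → ℝ) (a : ℝ) (s : ℂ) : ℝ → ℂ :=
  (Ioc a (P.eval a)).indicator (fatouPow R c p s)

/-- The deviation of the iterated transfer operator from its mean. -/
def deviation {N : ℕ} (g : Fin N → ℝ → ℝ) (f : ℂ → ℝ → ℂ) (Ξ : ℂ → ℂ) (m : ℕ) (s : ℂ) (z : ℝ) : ℂ :=
  (transfer g)^[m] (f s) z - (N : ℂ) ^ m * Ξ s

/-- The analytic part of the zeta function. -/
def regularPart (R : ℂ[X]) (P : ℝ[X]) (c : ℝ) {N : ℕ} (p : Fin (N + 1) → ℝ) (g : Fin N → ℝ → ℝ)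
    (a : ℝ) (ξ M Ξ : ℂ → ℂ) (z₀ : ℝ) (s : ℂ) : ℂ :=
  (if 0 < z₀ ∧ z₀ ≤ a then fatouPow R c p s z₀ else 0) + (M s - ξ s) +
    ∑' m : ℕ, ((c : ℂ) ^ (-s / 2)) ^ m * deviation g (cutPow R P c p a) Ξ m s z₀

theorem norm_cpow_neg_half {c : ℝ} (hc : 0 < c) (s : ℂ) :
    ‖(c : ℂ) ^ (-s / 2)‖ = c ^ (-s.re / 2) := by
  rw [Complex.norm_cpow_eq_rpow_re_of_pos hc]
  congr 1
  simp

theorem rpow_mul_lt_one_of_dR_lt {c : ℝ} (hc : 1 < c) {N : ℕ} (hN : 2 ≤ N) {x : ℝ}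
    (hx : dR N c < x) : c ^ (-x / 2) * N < 1 := by
  have hc0 : 0 < c := by linarith
  have hN0 : (0 : ℝ) < N := by exact_mod_cast (by omega : 0 < N)
  have hlog : 0 < Real.log c := Real.log_pos hc
  rw [dR, div_lt_iff₀ hlog] at hx
  have : (N : ℝ) < c ^ (x / 2) := by
    rw [← Real.log_lt_log_iff hN0 (Real.rpow_pos_of_pos hc0 _), Real.log_rpow hc0]
    linarith
  rw [neg_div, Real.rpow_neg hc0.le, inv_mul_lt_iff₀ (Real.rpow_pos_of_pos hc0 _), mul_one]
  exact this

theorem exists_int_of_denominator_eq_zero {c : ℝ} (hc : 1 < c) {N : ℕ} (hN : 2 ≤ N) {s : ℂ}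
    (hs : 1 - (N : ℂ) * (c : ℂ) ^ (-s / 2) = 0) :
    ∃ n : ℤ, s = dR N c + 4 * Real.pi * Complex.I * n / Real.log c := by
  have hc0 : (c : ℂ) ≠ 0 := by exact_mod_cast (by linarith : c ≠ 0)
  have hN0 : (N : ℂ) ≠ 0 := by exact_mod_cast (by omega : N ≠ 0)
  have hlog : (Real.log c : ℂ) ≠ 0 := by exact_mod_cast (Real.log_pos hc).ne'
  have h1 : Complex.exp ((Real.log N : ℂ) + Real.log c * (-s / 2)) = 1 := by
    rw [Complex.exp_add, Complex.ofReal_log (by positivity), Complex.ofReal_log (by linarith),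
      Complex.ofReal_natCast, Complex.exp_log hN0, ← Complex.cpow_def_of_ne_zero hc0]
    exact (sub_eq_zero.1 hs).symm
  obtain ⟨n, hn⟩ := Complex.exp_eq_one_iff.1 h1
  refine ⟨-n, ?_⟩
  rw [dR, Complex.ofReal_div, Complex.ofReal_mul, Complex.ofReal_ofNat, Int.cast_neg]
  field_simp
  linear_combination (-2) * hn

theorem denominator_dR {c : ℝ} (hc : 1 < c) {N : ℕ} (hN : 2 ≤ N) :
    1 - (N : ℂ) * (c : ℂ) ^ (-(dR N c : ℂ) / 2) = 0 := by
  have hc0 : (c : ℂ) ≠ 0 := by exact_mod_cast (by linarith : c ≠ 0)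
  have hN0 : (N : ℂ) ≠ 0 := by exact_mod_cast (by omega : N ≠ 0)
  have hlog : (Real.log c : ℂ) ≠ 0 := by exact_mod_cast (Real.log_pos hc).ne'
  rw [Complex.cpow_def_of_ne_zero hc0, ← Complex.ofReal_log (by linarith), dR,
    Complex.ofReal_div, Complex.ofReal_mul, Complex.ofReal_ofNat]
  have : (Real.log c : ℂ) * (-(2 * (Real.log N : ℂ) / (Real.log c : ℂ)) / 2) = -Real.log N := by
    field_simp
  rw [this, Complex.exp_neg, Complex.ofReal_log (by positivity), Complex.ofReal_natCast,
    Complex.exp_log hN0, mul_inv_cancel₀ hN0, sub_self]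

theorem hasDerivAt_denominator {c : ℝ} (hc : 1 < c) (N : ℕ) (s : ℂ) :
    HasDerivAt (fun s : ℂ => 1 - (N : ℂ) * (c : ℂ) ^ (-s / 2))
      ((N : ℂ) * (c : ℂ) ^ (-s / 2) * Complex.log c / 2) s := by
  have hc0 : (c : ℂ) ≠ 0 := by exact_mod_cast (by linarith : c ≠ 0)
  have h1 : HasDerivAt (fun s : ℂ => -s / 2) (-1 / 2) s := ((hasDerivAt_id s).neg).div_const 2
  have h2 := ((h1.const_cpow (Or.inl hc0)).const_mul (N : ℂ)).const_sub 1
  convert! h2 using 1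
  ring

theorem differentiable_denominator {c : ℝ} (hc : 1 < c) (N : ℕ) :
    Differentiable ℂ fun s : ℂ => 1 - (N : ℂ) * (c : ℂ) ^ (-s / 2) :=
  fun s => (hasDerivAt_denominator hc N s).differentiableAt

/-- A nonnegative order would give a finite limit at d_R. Multiplying by the denominator, which
tends to 0 there, would force ξ(d_R) = 0. -/
theorem meromorphicOrderAt_decomposed_dR {c : ℝ} (hc : 1 < c) {N : ℕ} (hN : 2 ≤ N) {ξ ψ : ℂ → ℂ}
    (hξ : Differentiable ℂ ξ) (hξ0 : ξ ((dR N c : ℝ) : ℂ) ≠ 0)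
    (hψ : AnalyticAt ℂ ψ ((dR N c : ℝ) : ℂ)) :
    meromorphicOrderAt (decomposed N c ξ ψ) (dR N c : ℂ) < 0 := by
  set d : ℂ := ((dR N c : ℝ) : ℂ)
  let D : ℂ → ℂ := fun s => 1 - (N : ℂ) * (c : ℂ) ^ (-s / 2)
  have hD0 : D d = 0 := denominator_dR hc hN
  have hDd := hasDerivAt_denominator hc N d
  have hmer : MeromorphicAt (decomposed N c ξ ψ) d :=
    (((hξ.analyticAt d).meromorphicAt).fun_div
      ((differentiable_denominator hc N).analyticAt d).meromorphicAt).fun_add hψ.meromorphicAt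
  have hne : ∀ᶠ s in 𝓝[≠] d, D s ≠ 0 := by
    refine hDd.eventually_ne ?_
    have h1 : (N : ℂ) * (c : ℂ) ^ (-d / 2) = 1 := (sub_eq_zero.1 hD0).symm
    rw [h1, one_mul, ← Complex.ofReal_log (by linarith)]
    have : (Real.log c : ℂ) ≠ 0 := by exact_mod_cast (Real.log_pos hc).ne'
    exact div_ne_zero this two_ne_zero
  by_contra! hge
  obtain ⟨y, hy⟩ := (tendsto_nhds_iff_meromorphicOrderAt_nonneg hmer).2 hge
  have hDt : Tendsto D (𝓝[≠] d) (𝓝 0) := by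
    rw [← hD0]
    exact hDd.continuousAt.tendsto.mono_left nhdsWithin_le_nhds
  have hψt : Tendsto ψ (𝓝[≠] d) (𝓝 (ψ d)) :=
    hψ.continuousAt.tendsto.mono_left nhdsWithin_le_nhds
  have hξt : Tendsto ξ (𝓝[≠] d) (𝓝 (ξ d)) :=
    (hξ.continuous.tendsto d).mono_left nhdsWithin_le_nhds
  have h1 := (hy.sub hψt).mul hDt
  rw [mul_zero] at h1
  refine hξ0 (tendsto_nhds_unique (hξt.congr' ?_) h1)
  filter_upwards [hne] with s hs
  rw [decomposed, add_sub_cancel_right]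
  exact (div_mul_cancel₀ _ hs).symm

section Deviation

variable {N : ℕ} {g : Fin N → ℝ → ℝ}

theorem differentiable_deviation {f : ℂ → ℝ → ℂ} {Ξ : ℂ → ℂ}
    (hf : ∀ x, Differentiable ℂ fun s => f s x) (hΞ : Differentiable ℂ Ξ) (m : ℕ) (z : ℝ) :
    Differentiable ℂ fun s => deviation g f Ξ m s z :=
  (differentiable_transfer_iterate hf m z).sub (hΞ.const_mul _)

/-- One application of the branches moves any point into [0, b], so bounds known there pass to
arbitrary base points. -/
theorem deviation_succ (f : ℂ → ℝ → ℂ) (Ξ : ℂ → ℂ) (m : ℕ) (s : ℂ) (z : ℝ) :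
    deviation g f Ξ (m + 1) s z = ∑ j, deviation g f Ξ m s (g j z) := by
  simp only [deviation, Function.iterate_succ_apply', Finset.sum_sub_distrib, Finset.sum_const,
    Finset.card_univ, Fintype.card_fin, nsmul_eq_mul]
  rw [transfer]
  ring

end Deviation

/-! ### Convergence of the zeta function and its decomposition -/

namespace IsBranchSystem

variable {R : ℂ[X]} {P : ℝ[X]} {b c : ℝ} {N : ℕ} {p : Fin (N + 1) → ℝ} {g : Fin N → ℝ → ℝ}

/-- A geometric bound for the deviations on `[0, b]` and large indices extends to the common image
of the laps and all indices. -/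
theorem exists_norm_deviation_le (h : IsBranchSystem P b p g) {f : ℂ → ℝ → ℂ} {Ξ : ℂ → ℂ}
    (hf : ∀ x, Differentiable ℂ fun s => f s x) (hΞ : Differentiable ℂ Ξ) {q : ℝ} (hq : 0 < q)
    (hb : ∀ T : ℝ, ∃ (C : ℝ) (m₀ : ℕ), ∀ m ≥ m₀, ∀ z ∈ Icc 0 b, ∀ s : ℂ, ‖s‖ ≤ T →
      ‖deviation g f Ξ m s z‖ ≤ C * q ^ m) (T : ℝ) (z₀ : ℝ) :
    ∃ C : ℝ, ∀ m, ∀ s : ℂ, ‖s‖ ≤ T → ‖deviation g f Ξ m s z₀‖ ≤ C * q ^ m := by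
  obtain ⟨C, m₀, hC⟩ := hb T
  have h1 : ∀ m, ∃ B : ℝ, ∀ s : ℂ, ‖s‖ ≤ T → ‖deviation g f Ξ m s z₀‖ ≤ B := by
    intro m
    obtain ⟨B, hB⟩ := (isCompact_closedBall (0 : ℂ) T).exists_bound_of_continuousOn
      (differentiable_deviation hf hΞ m z₀).continuous.continuousOn
    exact ⟨B, fun s hs => hB s (by simpa using hs)⟩
  choose B hB using h1
  refine ⟨N * |C| / q + ∑ m ∈ Finset.range (m₀ + 1), |B m| / q ^ m, fun m s hs => ?_⟩
  rw [add_mul]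
  have hnn : 0 ≤ ∑ m ∈ Finset.range (m₀ + 1), |B m| / q ^ m :=
    Finset.sum_nonneg fun m _ => by positivity
  by_cases hm : m < m₀ + 1
  · have h2 : |B m| / q ^ m ≤ ∑ m ∈ Finset.range (m₀ + 1), |B m| / q ^ m :=
      Finset.single_le_sum (f := fun m => |B m| / q ^ m) (fun m _ => by positivity)
        (Finset.mem_range.2 hm)
    have h3 := mul_le_mul_of_nonneg_right h2 (pow_pos hq m).le
    rw [div_mul_cancel₀ _ (pow_pos hq m).ne'] at h3
    have h4 : 0 ≤ N * |C| / q * q ^ m := by positivity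
    linarith [hB m s hs, le_abs_self (B m)]
  · obtain ⟨k, rfl⟩ : ∃ k, m = k + 1 := ⟨m - 1, by omega⟩
    have h5 : ‖deviation g f Ξ (k + 1) s z₀‖ ≤ N * (|C| * q ^ k) := by
      rw [deviation_succ]
      refine (norm_sum_le _ _).trans ((Finset.sum_le_card_nsmul _ _ (|C| * q ^ k)
        fun j _ => ?_).trans ?_)
      · refine (hC k (by omega) _ (h.mem_Icc j z₀) s hs).trans ?_
        exact mul_le_mul_of_nonneg_right (le_abs_self C) (by positivity)
      · rw [nsmul_eq_mul, Finset.card_univ, Fintype.card_fin]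
    refine h5.trans ?_
    have h6 : N * (|C| * q ^ k) = N * |C| / q * q ^ (k + 1) := by
      field_simp
      ring
    rw [h6]
    have : 0 ≤ (∑ m ∈ Finset.range (m₀ + 1), |B m| / q ^ m) * q ^ (k + 1) := by positivity
    linarith

variable [NeZero N]

/-- For y ≥ a the chain a ≤ y ≤ c^k R₁^(-k)(y) ≤ ℛ(y) ≤ A confines all these quantities to a fixed
compact subset of the positive axis. This supplies the domination for the limit in n. -/
theorem exists_abs_log_le (h : IsBranchSystem P b p g) (hN : 2 ≤ N)
    (hev : ∀ x, realEval R x = P.eval x) (hPc : P.derivative.eval 0 = c) (hc : 1 < c) {a : ℝ}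
    (ha : 0 < a) :
    ∃ D, ∀ y ∈ imageInter P p, a ≤ y → |Real.log (fatou R c p y)| ≤ D ∧
      ∀ k : ℕ, |Real.log (c ^ k * (g 0)^[k] y)| ≤ D := by
  obtain ⟨A, hA⟩ := h.exists_fatou_le hN hev hPc hc
  have key : ∀ t : ℝ, a ≤ t → t ≤ A → |Real.log t| ≤ max |Real.log a| |Real.log A| :=
    fun t h1 h2 => abs_le_max_abs_abs (Real.log_le_log ha h1) (Real.log_le_log (ha.trans_le h1) h2)
  refine ⟨_, fun y hy hay => ⟨key _ (hay.trans (h.le_fatou hN hev hPc hc hy)) (hA y hy),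
    fun k => key _ (hay.trans (h.le_rescaled hN hPc hc hy k))
      ((h.rescaled_le_fatou hN hev hPc hc hy k).trans (hA y hy))⟩⟩

theorem norm_transferPlus_le (h : IsBranchSystem P b p g) {f : ℝ → ℂ} {C : ℝ} (hC : 0 ≤ C)
    (hf : ∀ y ∈ imageInter P p, p (0 : Fin N).succ ≤ y → ‖f y‖ ≤ C) (x : ℝ) :
    ‖transferPlus g f x‖ ≤ N * C := by
  rw [transferPlus]
  refine (norm_sum_le _ _).trans ((Finset.sum_le_card_nsmul _ _ C fun j hj => ?_).trans ?_)
  · exact hf _ (h.mem_imageInter j x) (h.succ_zero_le_g (Finset.ne_of_mem_erase hj) x)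
  · rw [nsmul_eq_mul]
    refine mul_le_mul_of_nonneg_right ?_ hC
    have := Finset.card_le_univ (Finset.univ.erase (0 : Fin N))
    rw [Fintype.card_fin] at this
    exact_mod_cast this

theorem differentiable_fatouPow (h : IsBranchSystem P b p g) (hN : 2 ≤ N)
    (hev : ∀ x, realEval R x = P.eval x) (hPc : P.derivative.eval 0 = c) (hc : 1 < c) {x : ℝ}
    (hx : x ∈ imageInter P p) (hx0 : x ≠ 0) : Differentiable ℂ fun s => fatouPow R c p s x :=
  differentiable_ofReal_cpow
    ((lt_of_le_of_ne (h.nonneg_of_mem hx) hx0.symm).trans_le (h.le_fatou hN hev hPc hc hx))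

theorem fatou_pos (h : IsBranchSystem P b p g) (hN : 2 ≤ N)
    (hev : ∀ x, realEval R x = P.eval x) (hPc : P.derivative.eval 0 = c) (hc : 1 < c) {x : ℝ}
    (hx : x ∈ imageInter P p) (hx0 : x ≠ 0) : 0 < fatou R c p x :=
  (lt_of_le_of_ne (h.nonneg_of_mem hx) hx0.symm).trans_le (h.le_fatou hN hev hPc hc hx)

theorem differentiable_cutPow (h : IsBranchSystem P b p g) (hN : 2 ≤ N)
    (hev : ∀ x, realEval R x = P.eval x) (hPc : P.derivative.eval 0 = c) (hc : 1 < c)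
    {a : ℝ} (ha : 0 < a) (hab : P.eval a ≤ b) (x : ℝ) :
    Differentiable ℂ fun s => cutPow R P c p a s x := by
  by_cases hx : x ∈ Ioc a (P.eval a)
  · simp only [cutPow, indicator_of_mem hx]
    exact h.differentiable_fatouPow hN hev hPc hc
      (h.Icc_subset_imageInter ⟨(ha.trans hx.1).le, hx.2.trans hab⟩) (ha.trans hx.1).ne'
  · simp only [cutPow, indicator_of_notMem hx]
    exact differentiable_const 0

theorem le_eval_of_mem_lap_zero (h : IsBranchSystem P b p g) (hN : 2 ≤ N)
    (hc : 0 < P.derivative.eval 0) {u : ℝ} (hu : u ∈ lap p 0) : u ≤ P.eval u := by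
  refine le_trans ?_ (h.mul_le_eval hN hc hu)
  rw [h.lap_zero] at hu
  refine le_mul_of_one_le_left hu.1 ?_
  rw [one_le_div h.succ_zero_pos]
  exact (h.succ_zero_lt hN).le

/-- Branches other than the first land to the right of a, so the cutoff does not affect them. On the
first one, ℛ(x) = c ℛ(g_0 x) absorbs the factor c^(-s/2), and a < g_0(x) means P(a) < x. -/
theorem transfer_indicator_fatouPow (h : IsBranchSystem P b p g) (hN : 2 ≤ N)
    (hev : ∀ x, realEval R x = P.eval x) (hPc : P.derivative.eval 0 = c) (hc : 1 < c)
    {a : ℝ} (ha : 0 < a) (hap : a < p (0 : Fin N).succ) (s : ℂ) {x : ℝ}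
    (hx : x ∈ imageInter P p) :
    (c : ℂ) ^ (-s / 2) * transfer g ((Ioi a).indicator (fatouPow R c p s)) x =
      (c : ℂ) ^ (-s / 2) * transferPlus g (fatouPow R c p s) x +
        (Ioi (P.eval a)).indicator (fatouPow R c p s) x := by
  have hal : a ∈ lap p 0 := by rw [h.lap_zero]; exact ⟨ha.le, hap.le⟩
  rw [transfer_eq_add]
  simp only
  have h1 : transferPlus g ((Ioi a).indicator (fatouPow R c p s)) x =
      transferPlus g (fatouPow R c p s) x :=
    Finset.sum_congr rfl fun j hj => indicator_of_mem
      (hap.trans_le (h.succ_zero_le_g (Finset.ne_of_mem_erase hj) x)) _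
  rw [h1, mul_add, add_comm]
  congr 1
  have h2 : a < g 0 x ↔ P.eval a < x := by
    conv_rhs => rw [← h.right_inv hx 0]
    exact (h.strictMonoOn_zero.lt_iff_lt hal (h.mem_lap 0 x)).symm
  by_cases h3 : P.eval a < x
  · have h4 : g 0 x ∈ Ioi a := h2.2 h3
    rw [indicator_of_mem h4, indicator_of_mem (show x ∈ Ioi (P.eval a) from h3), fatouPow, fatouPow,
      h.fatou_eq_mul hN hev hPc hc hx, Complex.ofReal_mul,
      Complex.mul_cpow_ofReal_nonneg (by linarith)
        (h.fatou_pos hN hev hPc hc (h.mem_imageInter 0 x) (ha.trans h4).ne').le]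
  · have h4 : g 0 x ∉ Ioi a := fun h5 => h3 (h2.1 h5)
    rw [indicator_of_notMem h4, indicator_of_notMem (show x ∉ Ioi (P.eval a) from h3), mul_zero]

theorem differentiableOn_regularPart (h : IsBranchSystem P b p g) (hN : 2 ≤ N)
    (hev : ∀ x, realEval R x = P.eval x) (hPc : P.derivative.eval 0 = c) (hc : 1 < c)
    {a : ℝ} (ha : 0 < a) (hab : P.eval a ≤ b) {ξ M Ξ : ℂ → ℂ} (hξ : Differentiable ℂ ξ)
    (hM : Differentiable ℂ M) (hΞ : Differentiable ℂ Ξ) {q η : ℝ} (hq : 0 < q)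
    (hqη : ∀ x : ℝ, η < x → c ^ (-x / 2) * q < 1)
    (hb : ∀ T : ℝ, ∃ (C : ℝ) (m₀ : ℕ), ∀ m ≥ m₀, ∀ z ∈ Icc 0 b, ∀ s : ℂ, ‖s‖ ≤ T →
      ‖deviation g (cutPow R P c p a) Ξ m s z‖ ≤ C * q ^ m) {z₀ : ℝ} (hz : z₀ ∈ imageInter P p) :
    DifferentiableOn ℂ (regularPart R P c p g a ξ M Ξ z₀) {s | η < s.re} := by
  have hc0 : 0 < c := by linarith
  have hcne : (c : ℂ) ≠ 0 := by exact_mod_cast hc0.ne'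
  have hfirst : Differentiable ℂ fun s => if 0 < z₀ ∧ z₀ ≤ a then fatouPow R c p s z₀ else 0 := by
    split_ifs with h0
    · exact h.differentiable_fatouPow hN hev hPc hc hz h0.1.ne'
    · exact differentiable_const 0
  have hw : Differentiable ℂ fun s : ℂ => (c : ℂ) ^ (-s / 2) :=
    (differentiable_id.neg.div_const 2).const_cpow (Or.inl hcne)
  have hf := h.differentiable_cutPow hN hev hPc hc ha hab
  refine (hfirst.add (hM.sub hξ)).differentiableOn.add ?_
  intro s₀ hs₀
  obtain ⟨η', h1, h2⟩ := exists_between (show η < s₀.re from hs₀)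
  obtain ⟨C, hC⟩ := h.exists_norm_deviation_le hf hΞ hq hb (‖s₀‖ + 1) z₀
  -- The bounds on the deviations are uniform only for bounded s, and the geometric ratio only for
  -- Re s bounded away from η; hence the intersection.
  set U : Set ℂ := {s | η' < s.re} ∩ Metric.ball 0 (‖s₀‖ + 1)
  have hU : IsOpen U :=
    (isOpen_lt continuous_const Complex.continuous_re).inter Metric.isOpen_ball
  have hs₀U : s₀ ∈ U := ⟨h2, by simp⟩
  have hsum : Summable fun m : ℕ => |C| * (c ^ (-η' / 2) * q) ^ m :=
    (summable_geometric_of_lt_one (by positivity) (hqη η' h1)).mul_left _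
  have hd := Complex.differentiableOn_tsum_of_summable_norm (U := U)
    (F := fun (m : ℕ) (s : ℂ) => ((c : ℂ) ^ (-s / 2)) ^ m * deviation g (cutPow R P c p a) Ξ m s z₀) hsum
    (fun m => ((hw.pow m).mul
      (differentiable_deviation hf hΞ m z₀)).differentiableOn) hU
    (fun m s hs => by
      rw [norm_mul, norm_pow, norm_cpow_neg_half hc0]
      have h3 : c ^ (-s.re / 2) ≤ c ^ (-η' / 2) :=
        Real.rpow_le_rpow_of_exponent_le hc.le (by have : η' < s.re := hs.1; linarith)
      have h4 : ‖deviation g (cutPow R P c p a) Ξ m s z₀‖ ≤ |C| * q ^ m :=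
        (hC m s (mem_ball_zero_iff.1 hs.2).le).trans
          (mul_le_mul_of_nonneg_right (le_abs_self C) (by positivity))
      calc (c ^ (-s.re / 2)) ^ m * ‖deviation g (cutPow R P c p a) Ξ m s z₀‖
          ≤ (c ^ (-η' / 2)) ^ m * (|C| * q ^ m) := by gcongr
        _ = _ := by rw [mul_pow]; ring)
  exact (hd.differentiableAt (hU.mem_nhds hs₀U)).differentiableWithinAt

/-- Dominated convergence replaces the rescaled powers by powers of ℛ. A telescoping identity then
trades the sum over all branches but the first for a sum over the fundamental domain, whose mean
part is an explicit geometric series. -/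
theorem tendsto_zetaApprox (h : IsBranchSystem P b p g) (hN : 2 ≤ N)
    (hR : R = P.map Complex.ofRealHom)
    (hev : ∀ x, realEval R x = P.eval x) (hPc : P.derivative.eval 0 = c) (hc : 1 < c)
    {a : ℝ} (ha : 0 < a) (hap : a < p (0 : Fin N).succ) {ξ M Ξ : ℂ → ℂ}
    (hΞ : ∀ s, Ξ s = (1 - N * (c : ℂ) ^ (-s / 2)) * M s + N * (c : ℂ) ^ (-s / 2) * ξ s)
    {z₀ : ℝ} (hz : z₀ ∈ imageInter P p) {s : ℂ} (hs : dR N c < s.re) :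
    Tendsto (fun n => zetaApprox R c z₀ n s) atTop
      (𝓝 (decomposed N c ξ (regularPart R P c p g a ξ M Ξ z₀) s)) := by
  have hc0 : 0 < c := by linarith
  set w : ℂ := (c : ℂ) ^ (-s / 2) with hw
  have hwN : ‖w‖ * N < 1 := by
    rw [hw, norm_cpow_neg_half hc0]; exact rpow_mul_lt_one_of_dR_lt hc hN hs
  obtain ⟨D, hD⟩ := h.exists_abs_log_le hN hev hPc hc ha
  have hp := h.succ_zero_pos
  set B := Real.exp (‖s‖ * D)
  have hB : 0 ≤ B := (Real.exp_pos _).le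
  have hS : ∀ j, ∀ x ∈ imageInter P p, g j x ∈ imageInter P p := fun j x _ => h.mem_imageInter j x
  have hφ : ∀ k, ∀ x, ‖transferPlus g (rescaledPow c g k s) x‖ ≤ N * B := fun k x =>
    h.norm_transferPlus_le hB (fun y hy hpy => by
      rw [rescaledPow, if_neg (hp.trans_le hpy).ne']
      exact norm_ofReal_cpow_le ((hp.trans_le hpy).trans_le (h.le_rescaled hN hPc hc hy k))
        ((hD y hy (hap.le.trans hpy)).2 k) s) x
  have hφa : ∀ y ∈ imageInter P p, a ≤ y → ‖fatouPow R c p s y‖ ≤ B := fun y hy hay =>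
    norm_ofReal_cpow_le (h.fatou_pos hN hev hPc hc hy (ha.trans_le hay).ne') (hD y hy hay).1 s
  have hφ' : ∀ x, ‖transferPlus g (fatouPow R c p s) x‖ ≤ N * B :=
    h.norm_transferPlus_le hB fun y hy hpy => hφa y hy (hap.le.trans hpy)
  have hpow : ∀ y ∈ imageInter P p, y ≠ 0 →
      Tendsto (fun k => rescaledPow c g k s y) atTop (𝓝 (fatouPow R c p s y)) := by
    intro y hy hy0
    have hF : 0 < fatou R c p y :=
      (lt_of_le_of_ne (h.nonneg_of_mem hy) hy0.symm).trans_le (h.le_fatou hN hev hPc hc hy)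
    simp only [rescaledPow, if_neg hy0]
    exact (continuousAt_cpow_const (Complex.ofReal_mem_slitPlane.2 hF)).tendsto.comp
      ((Complex.continuous_ofReal.tendsto _).comp (h.tendsto_fatou hN hev hPc hc hy))
  let bound : ℕ → ℝ := fun m => (‖w‖ * (N * B)) * (‖w‖ * N) ^ m
  have hbsum : Summable bound :=
    (summable_geometric_of_lt_one (by positivity) hwN).mul_left _
  have hbnd : ∀ (m : ℕ) (f : ℝ → ℂ), (∀ x, ‖f x‖ ≤ N * B) →
      ‖w ^ (m + 1) * (transfer g)^[m] f z₀‖ ≤ bound m := by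
    intro m f hf
    rw [norm_mul, norm_pow]
    refine (mul_le_mul_of_nonneg_left (norm_transfer_iterate_le hS (fun x _ => hf x) m z₀ hz)
      (by positivity)).trans
      (le_of_eq ?_)
    simp only [bound]
    rw [mul_pow]; ring
  -- The number of terms grows with n, so the sums are extended by zero and dominated by a geometric
  -- series of ratio ‖w‖ N < 1.
  have hmain : Tendsto (fun n => ∑' m, if m < n then
      w ^ (m + 1) * (transfer g)^[m] (transferPlus g (rescaledPow c g (n - 1 - m) s)) z₀ else 0)
      atTop (𝓝 (∑' m, w ^ (m + 1) *
        (transfer g)^[m] (transferPlus g (fatouPow R c p s)) z₀)) := by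
    refine tendsto_tsum_of_dominated_convergence hbsum (fun m => ?_) (Eventually.of_forall fun n m => ?_)
    · have h1 : Tendsto (fun k => w ^ (m + 1) *
          (transfer g)^[m] (transferPlus g (rescaledPow c g k s)) z₀) atTop
          (𝓝 (w ^ (m + 1) * (transfer g)^[m] (transferPlus g (fatouPow R c p s)) z₀)) := by
        refine (tendsto_transfer_iterate hS (fun x hx => ?_) m z₀ hz).const_mul _
        refine tendsto_finsetSum _ fun j hj => hpow _ (hS j x hx) ?_
        exact (hp.trans_le (h.succ_zero_le_g (Finset.ne_of_mem_erase hj) x)).ne'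
      have h2 : Tendsto (fun n : ℕ => n - 1 - m) atTop atTop :=
        (tendsto_sub_atTop_nat m).comp (tendsto_sub_atTop_nat 1)
      refine (h1.comp h2).congr' ?_
      filter_upwards [eventually_gt_atTop m] with n hn
      simp [hn]
    · split_ifs with hmn
      · exact hbnd m _ (hφ _)
      · rw [norm_zero]; positivity
  have hsumeq : ∀ n, (∑' m, if m < n then
      w ^ (m + 1) * (transfer g)^[m] (transferPlus g (rescaledPow c g (n - 1 - m) s)) z₀ else 0) =
      ∑ m ∈ Finset.range n,
        w ^ (m + 1) * (transfer g)^[m] (transferPlus g (rescaledPow c g (n - 1 - m) s)) z₀ := by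
    intro n
    rw [tsum_eq_sum (s := Finset.range n) fun m hm => if_neg (by simpa using hm)]
    exact Finset.sum_congr rfl fun m hm => if_pos (Finset.mem_range.1 hm)
  have hlast : Tendsto (fun n => rescaledPow c g n s z₀) atTop
      (𝓝 (if z₀ = 0 then 0 else fatouPow R c p s z₀)) := by
    split_ifs with h0
    · simp only [rescaledPow, if_pos h0]; exact tendsto_const_nhds
    · exact hpow z₀ hz h0
  have htot := hmain.add hlast
  simp only [hsumeq] at htot
  have hvalue : decomposed N c ξ (regularPart R P c p g a ξ M Ξ z₀) s =
      (∑' m, w ^ (m + 1) * (transfer g)^[m] (transferPlus g (fatouPow R c p s)) z₀) +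
        if z₀ = 0 then 0 else fatouPow R c p s z₀ := by
    have hNw : ‖(N : ℂ) * w‖ < 1 := by
      rw [norm_mul, Complex.norm_natCast, mul_comm]; exact hwN
    have hne : 1 - (N : ℂ) * w ≠ 0 := by
      intro h0
      rw [← sub_eq_zero.1 h0, norm_one] at hNw
      exact lt_irrefl _ hNw
    have hw0 : w ≠ 0 := by
      rw [hw, Complex.cpow_ne_zero_iff]
      exact Or.inl (by exact_mod_cast hc0.ne')
    have h1 : Summable fun m => w ^ (m + 1) *
        (transfer g)^[m] (transferPlus g (fatouPow R c p s)) z₀ :=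
      Summable.of_norm_bounded hbsum fun m => hbnd m _ hφ'
    set u : ℝ → ℂ := (Ioi a).indicator (fatouPow R c p s) with hu
    have hle : a ≤ P.eval a := h.le_eval_of_mem_lap_zero hN (by linarith)
      (by rw [h.lap_zero]; exact ⟨ha.le, hap.le⟩)
    have hsplit : ∀ x, (Ioi (P.eval a)).indicator (fatouPow R c p s) x =
        u x - cutPow R P c p a s x := by
      intro x
      simp only [hu, cutPow, indicator_apply, mem_Ioi, mem_Ioc]
      by_cases h3 : P.eval a < x
      · rw [if_pos h3, if_pos (hle.trans_lt h3), if_neg (fun h4 => absurd h4.2 (not_le.2 h3)),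
          sub_zero]
      · by_cases h4 : a < x
        · rw [if_neg h3, if_pos h4, if_pos ⟨h4, not_lt.1 h3⟩, sub_self]
        · rw [if_neg h3, if_neg h4, if_neg (fun h5 => h4 h5.1), sub_self]
    -- With u the power of ℛ cut off to (a, ∞), the functional equation reads w L u = w L₊ φ + u -
    -- f, with f the restriction to the fundamental domain. Applying w^m L^m makes the terms in u
    -- telescope.
    have hstep : ∀ m, w ^ m * (transfer g)^[m] (cutPow R P c p a s) z₀ =
        w ^ (m + 1) * (transfer g)^[m] (transferPlus g (fatouPow R c p s)) z₀ +
          (w ^ m * (transfer g)^[m] u z₀ - w ^ (m + 1) * (transfer g)^[m + 1] u z₀) := by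
      intro m
      have h4 : w * (transfer g)^[m + 1] u z₀ =
          w * (transfer g)^[m] (transferPlus g (fatouPow R c p s)) z₀ +
            ((transfer g)^[m] u z₀ - (transfer g)^[m] (cutPow R P c p a s) z₀) := by
        have h5 : (transfer g)^[m] u z₀ = (transfer g)^[m] (fun y =>
            (Ioi (P.eval a)).indicator (fatouPow R c p s) y + cutPow R P c p a s y) z₀ :=
          congrArg (fun f => (transfer g)^[m] f z₀) (funext fun y => by rw [hsplit, sub_add_cancel])
        rw [Function.iterate_succ_apply, h5, transfer_iterate_add, add_sub_cancel_right,
          ← transfer_iterate_const_mul, ← transfer_iterate_const_mul, ← transfer_iterate_add]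
        exact transfer_iterate_congr hS (fun x hx =>
          h.transfer_indicator_fatouPow hN hev hPc hc ha hap s hx) m z₀ hz
      rw [pow_succ, mul_assoc, mul_assoc, h4]
      ring
    have hub : ∀ x ∈ imageInter P p, ‖u x‖ ≤ B := by
      intro x hx
      by_cases h6 : x ∈ Ioi a
      · rw [hu, indicator_of_mem h6]
        exact hφa x hx (mem_Ioi.1 h6).le
      · rw [hu, indicator_of_notMem h6, norm_zero]
        exact hB
    have hulim : Tendsto (fun m => w ^ m * (transfer g)^[m] u z₀) atTop (𝓝 0) := by
      refine squeeze_zero_norm (a := fun m => B * (‖w‖ * N) ^ m) (fun m => ?_) ?_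
      · rw [norm_mul, norm_pow]
        refine (mul_le_mul_of_nonneg_left (norm_transfer_iterate_le hS hub m z₀ hz)
          (by positivity)).trans (le_of_eq ?_)
        rw [mul_pow]; ring
      · simpa using (tendsto_pow_atTop_nhds_zero_of_lt_one (by positivity) hwN).const_mul B
    have hfb : ∀ x ∈ imageInter P p, ‖cutPow R P c p a s x‖ ≤ B := by
      intro x hx
      by_cases h6 : x ∈ Ioc a (P.eval a)
      · rw [cutPow, indicator_of_mem h6]
        exact hφa x hx h6.1.le
      · rw [cutPow, indicator_of_notMem h6, norm_zero]
        exact hB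
    have hfs : Summable fun m => w ^ m * (transfer g)^[m] (cutPow R P c p a s) z₀ := by
      refine Summable.of_norm_bounded (g := fun m => B * (‖w‖ * N) ^ m)
        ((summable_geometric_of_lt_one (by positivity) hwN).mul_left _) fun m => ?_
      rw [norm_mul, norm_pow]
      refine (mul_le_mul_of_nonneg_left (norm_transfer_iterate_le hS hfb m z₀ hz)
        (by positivity)).trans (le_of_eq ?_)
      rw [mul_pow]; ring
    have htsum : ∑' m, w ^ m * (transfer g)^[m] (cutPow R P c p a s) z₀ =
        (∑' m, w ^ (m + 1) * (transfer g)^[m] (transferPlus g (fatouPow R c p s)) z₀) + u z₀ := by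
      refine tendsto_nhds_unique hfs.hasSum.tendsto_sum_nat ?_
      have h7 := (h1.hasSum.tendsto_sum_nat).add ((hulim.const_sub (u z₀)))
      rw [sub_zero] at h7
      refine h7.congr fun n => ?_
      simp only [hstep, Finset.sum_add_distrib]
      rw [Finset.sum_range_sub']
      simp
    have h2 : HasSum (fun m : ℕ => Ξ s * ((N : ℂ) * w) ^ m) (Ξ s * (1 - (N : ℂ) * w)⁻¹) :=
      (hasSum_geometric_of_norm_lt_one hNw).mul_left _
    have h3 : ∑' m, w ^ m * deviation g (cutPow R P c p a) Ξ m s z₀ =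
        (∑' m, w ^ m * (transfer g)^[m] (cutPow R P c p a s) z₀) - Ξ s * (1 - (N : ℂ) * w)⁻¹ := by
      rw [← h2.tsum_eq, ← hfs.tsum_sub h2.summable]
      refine tsum_congr fun m => ?_
      rw [deviation, mul_pow]; ring
    have hz₀ : (if z₀ = 0 then 0 else fatouPow R c p s z₀) =
        (if 0 < z₀ ∧ z₀ ≤ a then fatouPow R c p s z₀ else 0) + u z₀ := by
      have hz0 := h.nonneg_of_mem hz
      simp only [hu, indicator_apply, mem_Ioi]
      rcases hz0.eq_or_lt with h8 | h8
      · rw [← h8]; simp [ha.le]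
      · rw [if_neg h8.ne']
        by_cases h9 : z₀ ≤ a
        · rw [if_pos ⟨h8, h9⟩, if_neg (not_lt.2 h9), add_zero]
        · rw [if_neg (fun h10 => h9 h10.2), if_pos (not_le.1 h9), zero_add]
    -- The assumption on Ξ gives Ξ/(1 - N w) = (M - ξ) + ξ/(1 - N w), which yields the singular term
    -- and the entire correction.
    rw [decomposed, regularPart, ← hw, h3, htsum, hΞ, ← hw, hz₀]
    field_simp
    ring
  rw [hvalue]
  refine htot.congr fun n => ?_
  rw [h.zetaApprox_eq hN hR hc hz]

theorem isContinuation (h : IsBranchSystem P b p g) (hN : 2 ≤ N)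
    (hR : R = P.map Complex.ofRealHom)
    (hev : ∀ x, realEval R x = P.eval x) (hPc : P.derivative.eval 0 = c) (hc : 1 < c)
    {a : ℝ} (ha : 0 < a) (hap : a < p (0 : Fin N).succ) (hab : P.eval a ≤ b)
    {ξ M Ξ : ℂ → ℂ} (hξ : Differentiable ℂ ξ) (hM : Differentiable ℂ M) (hΞ : Differentiable ℂ Ξ)
    (hΞM : ∀ s, Ξ s = (1 - N * (c : ℂ) ^ (-s / 2)) * M s + N * (c : ℂ) ^ (-s / 2) * ξ s)
    (hξ0 : ξ (dR N c) ≠ 0) {q η : ℝ} (hq : 0 < q)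
    (hη : η < dR N c) (hqη : ∀ x : ℝ, η < x → c ^ (-x / 2) * q < 1)
    (hb : ∀ T : ℝ, ∃ (C : ℝ) (m₀ : ℕ), ∀ m ≥ m₀, ∀ z ∈ Icc 0 b, ∀ s : ℂ, ‖s‖ ≤ T →
      ‖deviation g (cutPow R P c p a) Ξ m s z‖ ≤ C * q ^ m) {z₀ : ℝ} (hz : z₀ ∈ imageInter P p) :
    IsContinuation R N c z₀ ξ (regularPart R P c p g a ξ M Ξ z₀) η := by
  have hopen : IsOpen {s : ℂ | η < s.re} := isOpen_lt continuous_const Complex.continuous_re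
  have han : AnalyticOnNhd ℂ (regularPart R P c p g a ξ M Ξ z₀) {s | η < s.re} :=
    (h.differentiableOn_regularPart hN hev hPc hc ha hab hξ hM hΞ hq hqη hb hz).analyticOnNhd hopen
  have hD := differentiable_denominator hc N
  refine ⟨han, fun s hs => h.tendsto_zetaApprox hN hR hev hPc hc ha hap hΞM hz hs, fun s hs => ?_,
    fun s hs hord => ?_, meromorphicOrderAt_decomposed_dR hc hN hξ hξ0 (han _ (by simpa using hη))⟩
  · exact (((hξ.analyticAt s).meromorphicAt).fun_div (hD.analyticAt s).meromorphicAt).fun_add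
      (han s hs).meromorphicAt
  · refine exists_int_of_denominator_eq_zero hc hN ?_
    by_contra hne
    have : AnalyticAt ℂ (decomposed N c ξ (regularPart R P c p g a ξ M Ξ z₀)) s :=
      ((hξ.analyticAt s).fun_div (hD.analyticAt s) hne).fun_add (han s hs)
    exact absurd hord (not_lt.2 this.meromorphicOrderAt_nonneg)

end IsBranchSystem

/-! ### Integrals of powers of ℛ against the measure -/

namespace IsSelfSimilar

variable {R : ℂ[X]} {P : ℝ[X]} {b c : ℝ} {N : ℕ} {p : Fin (N + 1) → ℝ} {g : Fin N → ℝ → ℝ}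
  {κ : Measure ℝ}

theorem measurableSet_juliaPlus (hm : IsRealModel R P c b) (hhull : hull R = Icc 0 b) :
    MeasurableSet (juliaPlus R p) := by
  refine hm.isCompact.isClosed.measurableSet.inter (MeasurableSet.iUnion fun j =>
    MeasurableSet.iUnion fun _ => ?_)
  change MeasurableSet (lap p j ∩ realEval R ⁻¹' hull R)
  have hev : realEval R = fun x => P.eval x := funext hm.realEval_eq
  rw [hhull, hev]
  exact measurableSet_Icc.inter (P.continuous.measurable measurableSet_Icc)

theorem isFiniteMeasure_restrict (hκ : IsSelfSimilar b g κ) (A : Set ℝ) :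
    IsFiniteMeasure (κ.restrict A) := by
  have := hκ.isProbability
  infer_instance

variable [NeZero N]

theorem juliaPlus_subset (h : IsBranchSystem P b p g) (hm : IsRealModel R P c b) :
    juliaPlus R p ⊆ Icc (p (0 : Fin N).succ) b := by
  rintro x ⟨hx, hx'⟩
  simp only [mem_iUnion] at hx'
  obtain ⟨j, hj, hxj⟩ := hx'
  refine ⟨?_, (hm.subset_Icc hx).2⟩
  refine le_trans (h.laps.strictMono.monotone (Fin.le_def.2 ?_)) hxj.1.1
  simp only [Fin.val_succ, Fin.coe_ofNat_eq_mod, Nat.zero_mod, Fin.val_castSucc]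
  omega

theorem g_mem_juliaPlus (h : IsBranchSystem P b p g) (hm : IsRealModel R P c b)
    (hhull : hull R = Icc 0 b) {y : ℝ} (hy : y ∈ realJulia R) {j : Fin N} (hj : j ≠ 0) :
    g j y ∈ juliaPlus R p := by
  have h1 := h.right_inv (h.Icc_subset_imageInter (hm.subset_Icc hy)) j
  refine ⟨(hm.eval_mem_iff _).1 (h1.symm ▸ hy), mem_iUnion₂.2 ⟨j, ?_, h.mem_lap j y, ?_⟩⟩
  · exact fun h0 => hj (Fin.ext (by simpa using h0))
  · change realEval R (g j y) ∈ hull R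
    rw [hm.realEval_eq, h1, hhull]
    exact hm.subset_Icc hy

theorem aemeasurable_log_fatou (h : IsBranchSystem P b p g) (hN : 2 ≤ N)
    (hm : IsRealModel R P c b) (hc : 1 < c) {A : Set ℝ} (hA : MeasurableSet A)
    (hAb : A ⊆ Icc 0 b) : AEMeasurable (fun x => Real.log (fatou R c p x)) (κ.restrict A) := by
  have h1 : AEMeasurable (fatou R c p) (κ.restrict A) :=
    aemeasurable_restrict_of_monotoneOn hA
      ((h.monotoneOn_fatou hN hm.realEval_eq hm.derivative_eval_zero hc).mono
        (hAb.trans h.Icc_subset_imageInter))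
  exact Real.measurable_log.comp_aemeasurable h1

theorem integrableExpSet_log_fatou (hκ : IsSelfSimilar b g κ) (h : IsBranchSystem P b p g)
    (hN : 2 ≤ N) (hm : IsRealModel R P c b) (hc : 1 < c) {A : Set ℝ} (hA : MeasurableSet A)
    {a : ℝ} (ha : 0 < a) (hAa : A ⊆ Icc a b) :
    ProbabilityTheory.integrableExpSet (fun x => Real.log (fatou R c p x)) (κ.restrict A) =
      univ := by
  have := hκ.isFiniteMeasure_restrict A
  obtain ⟨D, hD⟩ := h.exists_abs_log_le hN hm.realEval_eq hm.derivative_eval_zero hc ha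
  have hAb : A ⊆ Icc 0 b := hAa.trans (Icc_subset_Icc_left ha.le)
  refine eq_univ_of_forall fun t => ?_
  refine ProbabilityTheory.integrable_exp_mul_of_mem_Icc (a := -D) (b := D)
    (aemeasurable_log_fatou h hN hm hc hA hAb) ?_
  filter_upwards [ae_restrict_mem hA] with x hx
  exact abs_le.1 (hD x (h.Icc_subset_imageInter (hAb hx)) (hAa hx).1).1

theorem fatou_pos (h : IsBranchSystem P b p g) (hN : 2 ≤ N) (hm : IsRealModel R P c b)
    (hc : 1 < c) {a : ℝ} (ha : 0 < a) {x : ℝ} (hx : x ∈ Icc a b) : 0 < fatou R c p x :=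
  h.fatou_pos hN hm.realEval_eq hm.derivative_eval_zero hc
    (h.Icc_subset_imageInter ⟨ha.le.trans hx.1, hx.2⟩) (ha.trans_le hx.1).ne'

/-- The power is exp(-(s/2) log ℛ), so the integral is a moment generating function. As log ℛ is
bounded on A, it is entire in s. -/
theorem integral_fatouPow_eq_complexMGF (h : IsBranchSystem P b p g) (hN : 2 ≤ N)
    (hm : IsRealModel R P c b) (hc : 1 < c) {A : Set ℝ} (hA : MeasurableSet A)
    {a : ℝ} (ha : 0 < a) (hAa : A ⊆ Icc a b) (s : ℂ) :
    ∫ x in A, fatouPow R c p s x ∂κ =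
      ProbabilityTheory.complexMGF (fun x => Real.log (fatou R c p x)) (κ.restrict A) (-s / 2) := by
  refine setIntegral_congr_fun hA fun x hx => ?_
  have hF := fatou_pos h hN hm hc ha (hAa hx)
  simp only [fatouPow]
  rw [Complex.cpow_def_of_ne_zero (by exact_mod_cast hF.ne'), Complex.ofReal_log hF.le, mul_comm]

theorem differentiable_integral_fatouPow (hκ : IsSelfSimilar b g κ) (h : IsBranchSystem P b p g)
    (hN : 2 ≤ N) (hm : IsRealModel R P c b) (hc : 1 < c) {A : Set ℝ} (hA : MeasurableSet A)
    {a : ℝ} (ha : 0 < a) (hAa : A ⊆ Icc a b) :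
    Differentiable ℂ fun s => ∫ x in A, fatouPow R c p s x ∂κ := by
  have h1 : Differentiable ℂ (ProbabilityTheory.complexMGF
      (fun x => Real.log (fatou R c p x)) (κ.restrict A)) := fun s =>
    (ProbabilityTheory.analyticAt_complexMGF (by
      rw [hκ.integrableExpSet_log_fatou h hN hm hc hA ha hAa, interior_univ]
      trivial)).differentiableAt
  rw [funext (integral_fatouPow_eq_complexMGF (κ := κ) h hN hm hc hA ha hAa)]
  exact h1.comp (differentiable_id.neg.div_const 2)

theorem integrableOn_fatouPow (hκ : IsSelfSimilar b g κ) (h : IsBranchSystem P b p g) (hN : 2 ≤ N)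
    (hm : IsRealModel R P c b) (hc : 1 < c) {A : Set ℝ} (hA : MeasurableSet A)
    {a : ℝ} (ha : 0 < a) (hAa : A ⊆ Icc a b) (s : ℂ) :
    IntegrableOn (fatouPow R c p s) A κ := by
  have := hκ.isFiniteMeasure_restrict A
  have hAb : A ⊆ Icc 0 b := hAa.trans (Icc_subset_Icc_left ha.le)
  obtain ⟨D, hD⟩ := h.exists_abs_log_le hN hm.realEval_eq hm.derivative_eval_zero hc ha
  have h1 : AEMeasurable (fatouPow R c p s) (κ.restrict A) := by
    have := aemeasurable_log_fatou (κ := κ) h hN hm hc hA hAb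
    refine (Complex.measurable_exp.comp_aemeasurable
      ((Complex.measurable_ofReal.comp_aemeasurable this).mul_const (-s / 2))).congr ?_
    filter_upwards [ae_restrict_mem hA] with x hx
    have hF := fatou_pos h hN hm hc ha (hAa hx)
    simp only [Function.comp, fatouPow]
    rw [Complex.cpow_def_of_ne_zero (by exact_mod_cast hF.ne'), Complex.ofReal_log hF.le]
  refine Integrable.of_bound h1.aestronglyMeasurable (Real.exp (‖s‖ * D)) ?_
  filter_upwards [ae_restrict_mem hA] with x hx
  exact norm_ofReal_cpow_le (fatou_pos h hN hm hc ha (hAa hx))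
    (hD x (h.Icc_subset_imageInter (hAb hx)) (hAa hx).1).1 s

theorem differentiable_xi (hκ : IsSelfSimilar b g κ) (h : IsBranchSystem P b p g) (hN : 2 ≤ N)
    (hm : IsRealModel R P c b) (hc : 1 < c) (hhull : hull R = Icc 0 b) :
    Differentiable ℂ (xi R c p κ) :=
  hκ.differentiable_integral_fatouPow h hN hm hc (measurableSet_juliaPlus hm hhull)
    h.succ_zero_pos (juliaPlus_subset h hm)

/-- Cutting off to J₊ removes the first branch almost everywhere, as overlaps of laps are null, and
leaves the other branches unchanged on J. So L₊ inherits the rule that L multiplies integrals by N.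
-/
theorem integrable_transferPlus_fatouPow (hκ : IsSelfSimilar b g κ) (h : IsBranchSystem P b p g)
    (hN : 2 ≤ N) (hm : IsRealModel R P c b) (hc : 1 < c) (hhull : hull R = Icc 0 b)
    (hJ : κ (realJulia R)ᶜ = 0) (s : ℂ) :
    Integrable (transferPlus g (fatouPow R c p s)) κ ∧
      ∫ x, transferPlus g (fatouPow R c p s) x ∂κ = N * xi R c p κ s := by
  have hms := measurableSet_juliaPlus (p := p) hm hhull
  have h1 := hκ.integrable_transfer h
    ((integrable_indicator_iff hms).2 (hκ.integrableOn_fatouPow h hN hm hc hms h.succ_zero_pos (juliaPlus_subset h hm) s))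
  have h2 : transfer g ((juliaPlus R p).indicator (fatouPow R c p s)) =ᵐ[κ]
      transferPlus g (fatouPow R c p s) := by
    have h3 : ∀ᵐ x ∂κ, ∀ j : Fin N, j ≠ 0 → g 0 x ∉ lap p j := by
      rw [ae_all_iff]
      intro j
      by_cases hj : j = 0
      · exact ae_of_all _ fun x hj' => absurd hj hj'
      · have : κ (g 0 ⁻¹' lap p j) = 0 := hκ.measure_preimage_lap h hN (Ne.symm hj)
        filter_upwards [measure_eq_zero_iff_ae_notMem.1 this] with x hx _ using hx
    filter_upwards [h3, show ∀ᵐ x ∂κ, x ∈ realJulia R from hJ] with x hx hxJ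
    rw [transfer_eq_add]
    simp only
    rw [indicator_of_notMem, zero_add]
    · exact Finset.sum_congr rfl fun j hj =>
        indicator_of_mem (g_mem_juliaPlus h hm hhull hxJ (Finset.ne_of_mem_erase hj)) _
    · rintro ⟨-, hx'⟩
      simp only [mem_iUnion] at hx'
      obtain ⟨j, hj, hxj⟩ := hx'
      exact hx j (fun h0 => hj (by rw [h0]; simp)) hxj.1
  refine ⟨h1.1.congr h2, ?_⟩
  rw [← integral_congr_ae h2, h1.2, integral_indicator hms]
  rfl

/-- At a real argument the integrand is positive, and J₊ has positive mass because the cell of the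
second branch has mass 1/N. -/
theorem xi_dR_ne_zero (hκ : IsSelfSimilar b g κ) (h : IsBranchSystem P b p g) (hN : 2 ≤ N)
    (hm : IsRealModel R P c b) (hc : 1 < c) (hhull : hull R = Icc 0 b)
    (hbal : IsBalancedMeasure R p κ) (x : ℝ) : xi R c p κ (x : ℂ) ≠ 0 := by
  have := hκ.isFiniteMeasure_restrict (juliaPlus R p)
  have hpos : κ (juliaPlus R p) ≠ 0 := by
    intro h0
    have h1 := hbal.balanced [⟨1, hN⟩]
    have h2 : κ (cell R p [⟨1, hN⟩]) ≤ 0 := by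
      calc κ (cell R p [⟨1, hN⟩]) ≤ κ (juliaPlus R p ∪ (realJulia R)ᶜ) := by
            refine MeasureTheory.measure_mono fun x hx => ?_
            by_cases hxJ : x ∈ realJulia R
            · exact Or.inl ⟨hxJ, mem_iUnion₂.2 ⟨⟨1, hN⟩, one_ne_zero, hx⟩⟩
            · exact Or.inr hxJ
        _ ≤ κ (juliaPlus R p) + κ (realJulia R)ᶜ := measure_union_le _ _
        _ = 0 := by rw [h0, hbal.support, add_zero]
    rw [h1] at h2
    simp at h2
  have : NeZero (κ.restrict (juliaPlus R p)) := ⟨by rwa [Ne, Measure.restrict_eq_zero]⟩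
  have h3 : (-(x : ℂ) / 2) = ((-x / 2 : ℝ) : ℂ) := by push_cast; rfl
  have hms := measurableSet_juliaPlus (p := p) hm hhull
  have hsub := juliaPlus_subset h hm
  have h4 := integral_fatouPow_eq_complexMGF (κ := κ) h hN hm hc hms h.succ_zero_pos hsub x
  rw [h3, ProbabilityTheory.complexMGF_ofReal] at h4
  change ∫ x' in juliaPlus R p, fatouPow R c p x x' ∂κ ≠ 0
  rw [h4]
  refine Complex.ofReal_ne_zero.2 (ProbabilityTheory.mgf_pos' NeZero.out ?_).ne'
  have := hκ.integrableExpSet_log_fatou h hN hm hc hms h.succ_zero_pos hsub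
  exact (eq_univ_iff_forall.1 this) (-x / 2)

/-- The functional equation for the cutoff to (a, b] is integrated. With M the integral over (a, b],
Ξ that over (a, P(a)] and w = c^(-s/2), it reads w N M = w N ξ + (M - Ξ). -/
theorem integral_cutPow (h : IsBranchSystem P b p g) (hκ : IsSelfSimilar b g κ)
    (hN : 2 ≤ N) (hm : IsRealModel R P c b) (hc : 1 < c) (hhull : hull R = Icc 0 b)
    (hJ : κ (realJulia R)ᶜ = 0) {a : ℝ} (ha : 0 < a) (hap : a < p (0 : Fin N).succ)
    (hab : P.eval a ≤ b) (s : ℂ) :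
    ∫ x in Ioc a (P.eval a), fatouPow R c p s x ∂κ =
      (1 - N * (c : ℂ) ^ (-s / 2)) * (∫ x in Ioc a b, fatouPow R c p s x ∂κ) +
        N * (c : ℂ) ^ (-s / 2) * xi R c p κ s := by
  have hle : a ≤ P.eval a := h.le_eval_of_mem_lap_zero hN
    (by rw [hm.derivative_eval_zero]; linarith) (by rw [h.lap_zero]; exact ⟨ha.le, hap.le⟩)
  have hint : ∀ u v, a ≤ u → v ≤ b → IntegrableOn (fatouPow R c p s) (Ioc u v) κ :=
    fun u v hu hv => hκ.integrableOn_fatouPow h hN hm hc measurableSet_Ioc ha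
      (fun x hx => ⟨hu.trans hx.1.le, hx.2.trans hv⟩) s
  have h1 := hκ.integrable_transfer h
    ((integrable_indicator_iff measurableSet_Ioc).2 (hint a b le_rfl le_rfl))
  have h2 := hκ.integrable_transferPlus_fatouPow h hN hm hc hhull hJ s
  have h3 : (fun x => (c : ℂ) ^ (-s / 2) *
      transfer g ((Ioc a b).indicator (fatouPow R c p s)) x) =ᵐ[κ] fun x =>
      (c : ℂ) ^ (-s / 2) * transferPlus g (fatouPow R c p s) x +
        (Ioc (P.eval a) b).indicator (fatouPow R c p s) x := by
    filter_upwards [show ∀ᵐ x ∂κ, x ∈ Icc 0 b from hκ.compl_Icc] with x hx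
    have h4 := h.transfer_indicator_fatouPow hN hm.realEval_eq hm.derivative_eval_zero hc ha hap s
      (h.Icc_subset_imageInter hx)
    have h5 : ∀ (u y : ℝ), y ∈ Icc 0 b → (Ioc u b).indicator (fatouPow R c p s) y =
        (Ioi u).indicator (fatouPow R c p s) y := by
      intro u y hy
      simp only [indicator_apply, mem_Ioc, mem_Ioi, hy.2, and_true]
    rw [h5 _ x hx, ← h4]
    congr 1
    exact Finset.sum_congr rfl fun j _ => h5 _ _ (h.mem_Icc j x)
  have h6 := integral_congr_ae h3
  rw [integral_const_mul, h1.2, integral_add (h2.1.const_mul _)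
    ((integrable_indicator_iff measurableSet_Ioc).2 (hint _ b hle le_rfl)), integral_const_mul, h2.2,
    integral_indicator measurableSet_Ioc, integral_indicator measurableSet_Ioc] at h6
  have h7 := setIntegral_union (μ := κ) (f := fatouPow R c p s) (Ioc_disjoint_Ioc_of_le (le_refl (P.eval a)))
    measurableSet_Ioc (hint a (P.eval a) le_rfl hab) (hint (P.eval a) b hle le_rfl)
  rw [Ioc_union_Ioc_eq_Ioc hle hab] at h7
  linear_combination (-1 : ℂ) * h7 + h6

/-- A bound for the oscillation of the iterates of the transfer operator bounds the deviation. -/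
theorem norm_deviation_le (hκ : IsSelfSimilar b g κ) (h : IsBranchSystem P b p g)
    (hN : 2 ≤ N) (hm : IsRealModel R P c b) (hc : 1 < c) {a : ℝ} (ha : 0 < a)
    (hab : P.eval a ≤ b) {m : ℕ} {s : ℂ} {z C : ℝ}
    (hC : ∀ y ∈ Icc 0 b, ‖(transfer g)^[m] (cutPow R P c p a s) z -
      (transfer g)^[m] (cutPow R P c p a s) y‖ ≤ C) :
    ‖deviation g (cutPow R P c p a)
      (fun s => ∫ x in Ioc a (P.eval a), fatouPow R c p s x ∂κ) m s z‖ ≤ C := by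
  have h1 : Integrable (cutPow R P c p a s) κ := (integrable_indicator_iff measurableSet_Ioc).2
    (hκ.integrableOn_fatouPow h hN hm hc measurableSet_Ioc ha
      (fun x hx => ⟨hx.1.le, hx.2.trans hab⟩) s)
  have h2 := hκ.norm_transfer_iterate_sub_le h h1 m hC
  rwa [cutPow, integral_indicator measurableSet_Ioc] at h2

end IsSelfSimilar

/-! ### Bounded oscillation by monotone domination -/

namespace IsBranchSystem

variable {P : ℝ[X]} {b : ℝ} {N : ℕ} {p : Fin (N + 1) → ℝ} {g : Fin N → ℝ → ℝ}

theorem monotoneOn_or_antitoneOn_comp (h : IsBranchSystem P b p g) {H : ℝ → ℝ}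
    (hH : MonotoneOn H (Icc 0 b)) (j : Fin N) :
    Monotone (fun x => H (g j x)) ∨ Monotone (fun x => -H (g j x)) := by
  rcases h.mono j with hj | hj
  · exact Or.inl fun x y hxy => hH (h.mem_Icc j x) (h.mem_Icc j y) (hj hxy)
  · exact Or.inr fun x y hxy => neg_le_neg (hH (h.mem_Icc j y) (h.mem_Icc j x) (hj hxy))

/-- The variation of a monotone function does not increase under the transfer operator. -/
theorem sum_abs_sub_le (h : IsBranchSystem P b p g) {H : ℝ → ℝ} (hH : MonotoneOn H (Icc 0 b))
    (x y : ℝ) : ∑ j, |H (g j x) - H (g j y)| ≤ H b - H 0 := by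
  have hmem : ∀ i, p i ∈ Icc 0 b := fun i => by
    rw [← h.laps.zero, ← h.laps.last]
    exact ⟨h.laps.strictMono.monotone (Fin.zero_le _), h.laps.strictMono.monotone (Fin.le_last _)⟩
  have h1 : ∀ j, |H (g j x) - H (g j y)| ≤ H (p j.succ) - H (p j.castSucc) := by
    intro j
    have h2 : ∀ x, H (p j.castSucc) ≤ H (g j x) ∧ H (g j x) ≤ H (p j.succ) := fun x =>
      ⟨hH (hmem _) (h.mem_Icc j x) (h.mem_lap j x).1, hH (h.mem_Icc j x) (hmem _) (h.mem_lap j x).2⟩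
    rw [abs_le]
    constructor <;> linarith [h2 x, h2 y]
  refine (Finset.sum_le_sum fun j _ => h1 j).trans (le_of_eq ?_)
  have h3 := Fin.sum_univ_succ fun i => H (p i)
  have h4 := Fin.sum_univ_castSucc fun i => H (p i)
  rw [Finset.sum_sub_distrib, ← h.laps.zero, ← h.laps.last]
  linarith

/-- A function dominated by a monotone function `H` has bounded oscillation under all iterates of
the transfer operator. -/
theorem norm_transfer_iterate_sub_le_of_monotoneOn (h : IsBranchSystem P b p g) (m : ℕ) :
    ∀ {f : ℝ → ℂ} {H : ℝ → ℝ}, MonotoneOn H (Icc 0 b) →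
      (∀ x ∈ Icc 0 b, ∀ y ∈ Icc 0 b, ‖f x - f y‖ ≤ |H x - H y|) →
      ∀ x ∈ Icc 0 b, ∀ y ∈ Icc 0 b,
        ‖(transfer g)^[m] f x - (transfer g)^[m] f y‖ ≤ H b - H 0 := by
  induction m with
  | zero =>
    intro f H hH hf x hx y hy
    refine (hf x hx y hy).trans ?_
    have h0 : (0 : ℝ) ∈ Icc 0 b := ⟨le_rfl, h.b_pos.le⟩
    have hb : b ∈ Icc 0 b := ⟨h.b_pos.le, le_rfl⟩
    rw [abs_le]
    constructor <;>
      linarith [hH h0 hx hx.1, hH h0 hy hy.1, hH hx hb hx.2, hH hy hb hy.2]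
  | succ m ih =>
    intro f H hH hf x hx y hy
    -- Along a decreasing branch the sign is reversed, so all compositions become increasing. Their
    -- sum dominates the transferred function, and its increase over [0, b] is at most that of H
    -- because the laps tile [0, b].
    have hex : ∀ j, ∃ K : ℝ → ℝ, Monotone K ∧ ∀ x y, |H (g j x) - H (g j y)| = |K x - K y| := by
      intro j
      rcases h.monotoneOn_or_antitoneOn_comp hH j with hj | hj
      · exact ⟨_, hj, fun _ _ => rfl⟩
      · exact ⟨_, hj, fun x y => by rw [neg_sub_neg, abs_sub_comm]⟩
    choose K hK hKH using hex
    have hsum : ∀ x y, |(∑ j, K j x) - ∑ j, K j y| = ∑ j, |H (g j x) - H (g j y)| := by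
      have hle : ∀ x y, x ≤ y → |(∑ j, K j x) - ∑ j, K j y| = ∑ j, |H (g j x) - H (g j y)| := by
        intro x y hxy
        rw [abs_sub_comm, ← Finset.sum_sub_distrib, abs_of_nonneg
          (Finset.sum_nonneg fun j _ => sub_nonneg.2 (hK j hxy))]
        refine Finset.sum_congr rfl fun j _ => ?_
        rw [hKH, abs_sub_comm, abs_of_nonneg (sub_nonneg.2 (hK j hxy))]
      intro x y
      rcases le_total x y with hxy | hxy
      · exact hle x y hxy
      · rw [abs_sub_comm, hle y x hxy]
        exact Finset.sum_congr rfl fun j _ => abs_sub_comm _ _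
    have hmono : Monotone fun x => ∑ j, K j x := fun x y hxy =>
      Finset.sum_le_sum fun j _ => hK j hxy
    rw [Function.iterate_succ_apply]
    refine (ih (H := fun x => ∑ j, K j x) (hmono.monotoneOn _) (fun x _ y _ => ?_) x hx y hy).trans ?_
    · rw [hsum, transfer, transfer, ← Finset.sum_sub_distrib]
      exact (norm_sum_le _ _).trans
        (Finset.sum_le_sum fun j _ => hf _ (h.mem_Icc j x) _ (h.mem_Icc j y))
    · have := hsum b 0
      rw [abs_of_nonneg (sub_nonneg.2 (hmono h.b_pos.le))] at this
      rw [this]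
      exact h.sum_abs_sub_le hH b 0

end IsBranchSystem

theorem exists_norm_ofReal_cpow_sub_le {a A : ℝ} (ha : 0 < a) (T : ℝ) :
    ∃ K, 0 ≤ K ∧ ∀ x ∈ Icc a A, ∀ y ∈ Icc a A, ∀ s : ℂ, ‖s‖ ≤ T →
      ‖(x : ℂ) ^ (-s / 2) - (y : ℂ) ^ (-s / 2)‖ ≤ K * |x - y| := by
  set D := max |Real.log a| |Real.log A|
  have hD : ∀ t ∈ Icc a A, |Real.log t| ≤ D := fun t ht =>
    abs_le_max_abs_abs (Real.log_le_log ha ht.1) (Real.log_le_log (ha.trans_le ht.1) ht.2)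
  have hD0 : 0 ≤ D := (abs_nonneg _).trans (le_max_left _ _)
  refine ⟨|T| * Real.exp (|T| * D) / a, by positivity, fun x hx y hy s hs => ?_⟩
  have hs' : ‖s‖ ≤ |T| := hs.trans (le_abs_self T)
  have hder : ∀ t ∈ Icc a A, HasDerivWithinAt (fun t : ℝ => (t : ℂ) ^ (-s / 2))
      ((-s / 2) * (t : ℂ) ^ (-s / 2 - 1) * 1) (Icc a A) t := by
    intro t ht
    have h1 : ((t : ℝ) : ℂ) ∈ Complex.slitPlane :=
      Complex.ofReal_mem_slitPlane.2 (ha.trans_le ht.1)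
    exact (((hasDerivAt_id (t : ℂ)).cpow_const (c := -s / 2) h1).comp_ofReal).hasDerivWithinAt
  have hbound : ∀ t ∈ Icc a A,
      ‖(-s / 2) * (t : ℂ) ^ (-s / 2 - 1) * 1‖ ≤ |T| * Real.exp (|T| * D) / a := by
    intro t ht
    have ht0 : 0 < t := ha.trans_le ht.1
    have htne : (t : ℂ) ≠ 0 := by exact_mod_cast ht0.ne'
    rw [mul_one, Complex.cpow_sub _ _ htne, Complex.cpow_one, norm_mul, norm_div, norm_div, norm_neg,
      Complex.norm_real, Real.norm_of_nonneg ht0.le, Complex.norm_ofNat, mul_div_assoc]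
    have h2 := (norm_ofReal_cpow_le ht0 (hD t ht) s).trans
      (Real.exp_le_exp.2 (mul_le_mul_of_nonneg_right hs' hD0))
    refine mul_le_mul (by linarith [norm_nonneg s]) ?_ (by positivity) (by positivity)
    exact div_le_div₀ (Real.exp_pos _).le h2 ha ht.1
  have := (convex_Icc a A).norm_image_sub_le_of_norm_hasDerivWithin_le hder hbound hy hx
  simpa [Real.norm_eq_abs] using this

namespace IsBranchSystem

variable {R : ℂ[X]} {P : ℝ[X]} {b c : ℝ} {N : ℕ} {p : Fin (N + 1) → ℝ} {g : Fin N → ℝ → ℝ}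
  [NeZero N]

theorem exists_norm_transfer_iterate_cutPow_sub_le (h : IsBranchSystem P b p g) (hN : 2 ≤ N)
    (hev : ∀ x, realEval R x = P.eval x) (hPc : P.derivative.eval 0 = c) (hc : 1 < c) {a : ℝ}
    (ha : 0 < a) (hap : a < p (0 : Fin N).succ) (T : ℝ) :
    ∃ C, ∀ (m : ℕ), ∀ x ∈ Icc 0 b, ∀ y ∈ Icc 0 b, ∀ s : ℂ, ‖s‖ ≤ T →
      ‖(transfer g)^[m] (cutPow R P c p a s) x - (transfer g)^[m] (cutPow R P c p a s) y‖ ≤ C := by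
  obtain ⟨A, hA⟩ := h.exists_fatou_le hN hev hPc hc
  obtain ⟨K, hK0, hK⟩ := exists_norm_ofReal_cpow_sub_le (A := A) ha T
  obtain ⟨D, hD⟩ := h.exists_abs_log_le hN hev hPc hc ha
  have hmono := (h.monotoneOn_fatou hN hev hPc hc).mono h.Icc_subset_imageInter
  have hle : a ≤ P.eval a := h.le_eval_of_mem_lap_zero hN (by rw [hPc]; linarith)
    (by rw [h.lap_zero]; exact ⟨ha.le, hap.le⟩)
  have hab : a ≤ b := (hap.trans (h.succ_zero_lt hN)).le
  set B := Real.exp (|T| * |D|)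
  have hB : 0 ≤ B := (Real.exp_pos _).le
  -- The first term controls the Lipschitz dependence on ℛ inside the fundamental domain; the two
  -- steps of height B pay for the jumps at a and P(a).
  let H : ℝ → ℝ := fun x => K * fatou R c p (max a x) + (if a < x then B else 0) +
    (if P.eval a < x then B else 0)
  refine ⟨H b - H 0, fun m x hx y hy s hs => ?_⟩
  have hmem : ∀ x ∈ Icc 0 b, max a x ∈ Icc 0 b := fun x hx =>
    ⟨ha.le.trans (le_max_left _ _), max_le hab hx.2⟩
  have hF : MonotoneOn (fun x => fatou R c p (max a x)) (Icc 0 b) := fun x hx y hy hxy =>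
    hmono (hmem x hx) (hmem y hy) (max_le_max le_rfl hxy)
  have hsteps : ∀ u : ℝ, Monotone fun x : ℝ => if u < x then B else 0 := by
    intro u x y hxy
    simp only
    split_ifs with h1 h2
    · exact le_rfl
    · exact absurd (h1.trans_le hxy) h2
    · exact hB
    · exact le_rfl
  have hH : MonotoneOn H (Icc 0 b) := fun x hx y hy hxy =>
    add_le_add (add_le_add (mul_le_mul_of_nonneg_left (hF hx hy hxy) hK0) (hsteps a hxy))
      (hsteps _ hxy)
  have hφB : ∀ x ∈ Icc 0 b, a < x → ‖fatouPow R c p s x‖ ≤ B := fun x hx hax =>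
    (norm_ofReal_cpow_le (h.fatou_pos hN hev hPc hc (h.Icc_subset_imageInter hx) (ha.trans hax).ne')
      (hD x (h.Icc_subset_imageInter hx) hax.le).1 s).trans
      (Real.exp_le_exp.2 (mul_le_mul (hs.trans (le_abs_self T)) (le_abs_self D)
        ((abs_nonneg _).trans (hD x (h.Icc_subset_imageInter hx) hax.le).1) (abs_nonneg T)))
  have hφ : ∀ x ∈ Icc 0 b, ∀ y ∈ Icc 0 b, a < x → a < y →
      ‖fatouPow R c p s x - fatouPow R c p s y‖ ≤ K * |fatou R c p x - fatou R c p y| := by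
    intro x hx y hy hax hay
    have h1 : ∀ x ∈ Icc 0 b, a < x → fatou R c p x ∈ Icc a A := fun x hx hax =>
      ⟨hax.le.trans (h.le_fatou hN hev hPc hc (h.Icc_subset_imageInter hx)),
        hA x (h.Icc_subset_imageInter hx)⟩
    exact hK _ (h1 x hx hax) _ (h1 y hy hay) s hs
  have key : ∀ x ∈ Icc 0 b, ∀ y ∈ Icc 0 b, x ≤ y →
      ‖cutPow R P c p a s x - cutPow R P c p a s y‖ ≤ H y - H x := by
    intro x hx y hy hxy
    have hFxy := mul_le_mul_of_nonneg_left (hF hx hy hxy) hK0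
    simp only at hFxy
    simp only [H, cutPow, indicator_apply, mem_Ioc]
    by_cases hya : a < y
    · by_cases hyP : P.eval a < y
      · have h1 : ¬ (a < y ∧ y ≤ P.eval a) := fun h2 => absurd h2.2 (not_le.2 hyP)
        rw [if_neg h1, if_pos hya, if_pos hyP, sub_zero]
        by_cases hxa : a < x
        · by_cases hxP : P.eval a < x
          · have h1 : ¬ (a < x ∧ x ≤ P.eval a) := fun h2 => absurd h2.2 (not_le.2 hxP)
            rw [if_neg h1, if_pos hxa, if_pos hxP, norm_zero]
            linarith
          · rw [if_pos ⟨hxa, not_lt.1 hxP⟩, if_pos hxa, if_neg hxP]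
            linarith [hφB x hx hxa]
        · have h1 : ¬ P.eval a < x := fun h2 => hxa (hle.trans_lt h2)
          rw [if_neg fun h2 => hxa h2.1, if_neg hxa, if_neg h1, norm_zero]
          linarith
      · have h2 : ¬ P.eval a < x := fun h2 => hyP (h2.trans_le hxy)
        rw [if_pos (show a < y ∧ y ≤ P.eval a from ⟨hya, not_lt.1 hyP⟩), if_pos hya, if_neg hyP,
          if_neg h2]
        by_cases hxa : a < x
        · rw [if_pos ⟨hxa, not_lt.1 h2⟩, if_pos hxa]
          have h3 := hφ x hx y hy hxa hya
          rw [max_eq_right hxa.le, max_eq_right hya.le] at hFxy ⊢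
          rw [abs_sub_comm, abs_of_nonneg (sub_nonneg.2 (hmono hx hy hxy))] at h3
          linarith
        · rw [if_neg fun h2 => hxa h2.1, if_neg hxa, zero_sub, norm_neg]
          linarith [hφB y hy hya]
    · have h1 : ¬ a < x := fun h2 => hya (h2.trans_le hxy)
      rw [if_neg fun h2 => h1 h2.1, if_neg fun h2 => hya h2.1, if_neg h1, if_neg hya,
        if_neg fun h2 => h1 (hle.trans_lt h2), if_neg fun h2 => hya (hle.trans_lt h2), sub_zero,
        norm_zero]
      linarith
  refine h.norm_transfer_iterate_sub_le_of_monotoneOn m hH (fun x hx y hy => ?_) x hx y hy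
  rcases le_total x y with hxy | hxy
  · exact (key x hx y hy hxy).trans (by rw [abs_sub_comm]; exact le_abs_self _)
  · rw [norm_sub_rev]
    exact (key y hy x hx hxy).trans (le_abs_self _)

end IsBranchSystem

/-! ### Cauchy kernels and rapid decay in the totally disconnected case -/

/-- The oscillation of the iterates of the transfer operator is `O(qᵐ)`, locally uniformly in the
parameter. -/
def OscillationDecays (b q : ℝ) {N : ℕ} (g : Fin N → ℝ → ℝ) (f : ℂ → ℝ → ℂ) : Prop :=
  ∀ T : ℝ, ∃ (C : ℝ) (m₀ : ℕ), ∀ m ≥ m₀, ∀ x ∈ Icc 0 b, ∀ y ∈ Icc 0 b, ∀ s : ℂ, ‖s‖ ≤ T →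
    ‖(transfer g)^[m] (f s) x - (transfer g)^[m] (f s) y‖ ≤ C * q ^ m

theorem OscillationDecays.add {b q : ℝ} {N : ℕ} {g : Fin N → ℝ → ℝ}
    {f f' : ℂ → ℝ → ℂ} (hf : OscillationDecays b q g f) (hf' : OscillationDecays b q g f') :
    OscillationDecays b q g fun s x => f s x + f' s x := by
  intro T
  obtain ⟨C, m₀, h⟩ := hf T
  obtain ⟨C', m₁, h'⟩ := hf' T
  refine ⟨C + C', max m₀ m₁, fun m hm x hx y hy s hs => ?_⟩
  rw [transfer_iterate_add, transfer_iterate_add, add_sub_add_comm, add_mul]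
  exact (norm_add_le _ _).trans (add_le_add
    (h m ((le_max_left _ _).trans hm) x hx y hy s hs)
    (h' m ((le_max_right _ _).trans hm) x hx y hy s hs))

namespace IsBranchSystem

variable {R : ℂ[X]} {P : ℝ[X]} {b c : ℝ} {N : ℕ} {p : Fin (N + 1) → ℝ} {g : Fin N → ℝ → ℝ}

/-- This is the logarithmic derivative of R - x at t, since the branch values are exactly the roots
of R - x. -/
theorem sum_inv_sub (h : IsBranchSystem P b p g) (hN : 2 ≤ N) (hR : R = P.map Complex.ofRealHom)
    {x : ℝ} (hx : x ∈ imageInter P p) {t : ℂ} (ht : R.eval t ≠ x) :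
    ∑ j, (t - (g j x : ℝ))⁻¹ = R.derivative.eval t * (R.eval t - x)⁻¹ := by
  have hfac : R - C (x : ℂ) = C (P.leadingCoeff : ℂ) *
      ((Finset.univ.val.map fun j => ((g j x : ℝ) : ℂ)).map fun a => X - C a).prod := by
    have := congrArg (Polynomial.map Complex.ofRealHom) (h.sub_C_eq_prod hN hx)
    rw [hR, Multiset.map_map]
    change _ = _ * ∏ j, (X - C ((g j x : ℝ) : ℂ))
    simpa [Polynomial.map_prod] using this
  have hlc : (P.leadingCoeff : ℂ) ≠ 0 := by
    have : P ≠ 0 := by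
      rintro rfl
      have := h.natDegree_eq
      simp at this
      omega
    exact_mod_cast leadingCoeff_ne_zero.2 this
  have hroots : (R - C (x : ℂ)).roots = Finset.univ.val.map fun j => ((g j x : ℝ) : ℂ) := by
    rw [hfac, roots_C_mul _ hlc, roots_multiset_prod_X_sub_C]
  have h1 := (IsAlgClosed.splits (R - C (x : ℂ))).eval_derivative_div_eval_of_ne_zero (x := t)
    (by simpa [sub_eq_zero] using ht)
  rw [hroots, Multiset.map_map] at h1
  simp only [derivative_sub, derivative_C, sub_zero, eval_sub, eval_C, Function.comp_def,
    one_div] at h1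
  rw [← div_eq_mul_inv, h1]
  rfl

theorem eval_iterate_ne (h : IsBranchSystem P b p g) (hR : R = P.map Complex.ofRealHom) {x : ℝ}
    (hx : x ∈ imageInter P p) {m : ℕ} {t : ℂ} (ht : (fun w => R.eval w)^[m + 1] t ≠ x) (j : Fin N) :
    (fun w => R.eval w)^[m] t ≠ (g j x : ℝ) := by
  intro h0
  refine ht ?_
  rw [Function.iterate_succ_apply', h0, hR, eval_ofReal_map, h.right_inv hx]

/-- The product over the orbit is the derivative of the m-th iterate by the chain rule, so this is
the logarithmic derivative of the m-th iterate minus x. -/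
theorem transfer_iterate_inv_sub (h : IsBranchSystem P b p g) (hN : 2 ≤ N)
    (hR : R = P.map Complex.ofRealHom) (t : ℂ) (m : ℕ) : ∀ x ∈ imageInter P p,
    (fun w => R.eval w)^[m] t ≠ x → (transfer g)^[m] (fun y : ℝ => (t - y)⁻¹) x =
      (∏ i ∈ Finset.range m, R.derivative.eval ((fun w => R.eval w)^[i] t)) *
        ((fun w => R.eval w)^[m] t - x)⁻¹ := by
  induction m with
  | zero => intro x _ _; simp
  | succ m ih =>
    intro x hx ht
    rw [Function.iterate_succ_apply', transfer, Finset.prod_range_succ, mul_assoc]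
    rw [Function.iterate_succ_apply'] at ht ⊢
    rw [← h.sum_inv_sub hN hR hx ht, Finset.mul_sum]
    refine Finset.sum_congr rfl fun j _ => ih _ (h.mem_imageInter j x) ?_
    exact h.eval_iterate_ne hR hx (by rwa [Function.iterate_succ_apply']) j

theorem continuousOn_transfer_iterate_inv_sub (h : IsBranchSystem P b p g) (hN : 2 ≤ N)
    (hR : R = P.map Complex.ofRealHom) {γ : Set ℂ} {m : ℕ} {x : ℝ} (hx : x ∈ imageInter P p)
    (hγ : ∀ t ∈ γ, (fun w => R.eval w)^[m] t ≠ x) :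
    ContinuousOn (fun t : ℂ => (transfer g)^[m] (fun y : ℝ => (t - y)⁻¹) x) γ := by
  refine ContinuousOn.congr ?_ fun t ht => h.transfer_iterate_inv_sub hN hR t m x hx (hγ t ht)
  refine ContinuousOn.mul ?_ (ContinuousOn.inv₀ ?_ fun t ht => sub_ne_zero.2 (hγ t ht))
  · exact (continuous_finsetProd _ fun i _ =>
      R.derivative.continuous.comp (continuous_eval_iterate R i)).continuousOn
  · exact ((continuous_eval_iterate R m).sub continuous_const).continuousOn

/-- The transfer operator commutes with Cauchy integrals. -/
theorem transfer_iterate_eq_circleIntegral (h : IsBranchSystem P b p g) (hN : 2 ≤ N)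
    (hR : R = P.map Complex.ofRealHom) {z₀ : ℂ} {r : ℝ} (hr : 0 ≤ r) {φ : ℂ → ℂ}
    (hφ : ContinuousOn φ (Metric.sphere z₀ r)) {f : ℝ → ℂ}
    (hf : ∀ x ∈ imageInter P p, (x : ℂ) ∉ Metric.sphere z₀ r →
      f x = (2 * Real.pi * Complex.I : ℂ)⁻¹ • ∮ t in C(z₀, r), (t - x)⁻¹ • φ t) (m : ℕ) :
    ∀ x ∈ imageInter P p, (∀ t ∈ Metric.sphere z₀ r, (fun w => R.eval w)^[m] t ≠ x) →
      (transfer g)^[m] f x = (2 * Real.pi * Complex.I : ℂ)⁻¹ •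
        ∮ t in C(z₀, r), (transfer g)^[m] (fun y : ℝ => (t - y)⁻¹) x • φ t := by
  induction m with
  | zero => exact fun x hx ht => hf x hx fun h0 => ht _ h0 rfl
  | succ m ih =>
    intro x hx ht
    have hne : ∀ j, ∀ t ∈ Metric.sphere z₀ r, (fun w => R.eval w)^[m] t ≠ (g j x : ℝ) :=
      fun j t htγ => h.eval_iterate_ne hR hx (ht t htγ) j
    have h1 : ∀ j, CircleIntegrable
        (fun t => (transfer g)^[m] (fun y : ℝ => (t - y)⁻¹) (g j x) • φ t) z₀ r := fun j =>
      ((h.continuousOn_transfer_iterate_inv_sub hN hR (h.mem_imageInter j x) (hne j)).smul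
        hφ).circleIntegrable hr
    simp only [Function.iterate_succ_apply']
    rw [transfer, Finset.sum_congr rfl fun j _ => ih _ (h.mem_imageInter j x) (hne j),
      ← Finset.smul_sum, ← circleIntegral.integral_fun_sum fun j _ => h1 j]
    simp only [transfer, Finset.sum_smul]

/-- The roots of R lie in [0, b], so for ‖w‖ ≥ 2b each summand of R'/R is at most 2/‖w‖. Along an
escaping orbit the derivative of the iterate thus gains at most a factor 2N per step relative to the
orbit itself. -/
theorem norm_mul_derivative_le (h : IsBranchSystem P b p g) (hN : 2 ≤ N)
    (hR : R = P.map Complex.ofRealHom) {w : ℂ} (hw : 2 * b ≤ ‖w‖) (hRw : R.eval w ≠ 0) :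
    ‖w‖ * ‖R.derivative.eval w‖ ≤ 2 * N * ‖R.eval w‖ := by
  have h0 : (0 : ℝ) ∈ imageInter P p := h.Icc_subset_imageInter ⟨le_rfl, h.b_pos.le⟩
  have hb := h.b_pos
  have hw0 : 0 < ‖w‖ := by linarith
  have h1 := h.sum_inv_sub hN hR h0 (t := w) (by simpa using hRw)
  have h2 : ‖∑ j, (w - (g j 0 : ℝ))⁻¹‖ ≤ N * (2 / ‖w‖) := by
    refine (norm_sum_le _ _).trans ((Finset.sum_le_card_nsmul _ _ (2 / ‖w‖) fun j _ => ?_).trans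
      (le_of_eq (by simp)))
    have h3 : ‖w‖ / 2 ≤ ‖w - (g j 0 : ℝ)‖ := by
      have h4 := norm_sub_norm_le w ((g j 0 : ℝ) : ℂ)
      rw [Complex.norm_real, Real.norm_of_nonneg (h.mem_Icc j 0).1] at h4
      linarith [(h.mem_Icc j 0).2]
    rw [norm_inv, ← inv_div]
    exact inv_anti₀ (by positivity) h3
  have hR0 : 0 < ‖R.eval w‖ := norm_pos_iff.2 hRw
  rw [h1, Complex.ofReal_zero, sub_zero, norm_mul, norm_inv, ← div_eq_mul_inv, div_le_iff₀ hR0] at h2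
  calc ‖w‖ * ‖R.derivative.eval w‖ ≤ ‖w‖ * (N * (2 / ‖w‖) * ‖R.eval w‖) := by gcongr
    _ = _ := by field_simp

end IsBranchSystem

namespace IsBranchSystem

variable {R : ℂ[X]} {P : ℝ[X]} {b c : ℝ} {N : ℕ} {p : Fin (N + 1) → ℝ} {g : Fin N → ℝ → ℝ}

/-- Away from the Julia set the images of the Cauchy kernel under the iterates of the transfer
operator have superexponentially small oscillation. -/
theorem exists_norm_transfer_iterate_inv_sub_le (h : IsBranchSystem P b p g) (hN : 2 ≤ N)
    (hR : R = P.map Complex.ofRealHom) {γ : Set ℂ} (hγ : IsCompact γ)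
    (hdisj : ∀ t ∈ γ, t ∉ filledJulia R) {q : ℝ} (hq : 0 < q) :
    ∃ (C : ℝ) (m₀ : ℕ), 0 ≤ C ∧ ∀ m ≥ m₀, ∀ t ∈ γ,
      (∀ x ∈ Icc 0 b, (fun w => R.eval w)^[m] t ≠ (x : ℝ)) ∧
      ∀ x ∈ Icc 0 b, ∀ y ∈ Icc 0 b,
        ‖(transfer g)^[m] (fun u : ℝ => (t - u)⁻¹) x -
          (transfer g)^[m] (fun u : ℝ => (t - u)⁻¹) y‖ ≤ C * q ^ m := by
  have hRdeg : R.natDegree = N := by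
    rw [hR, natDegree_map_eq_of_injective Complex.ofRealHom.injective, h.natDegree_eq]
  have hR0 : R.eval 0 = 0 := by
    have := eval_ofReal_map P 0
    rw [h.eval_zero, Complex.ofReal_zero] at this
    rwa [hR]
  have hb := h.b_pos
  -- The escape rate is chosen so that the growth 2N of the derivative, divided by B, is at most q.
  set B := max 2 (2 * N / q)
  have hB2 : 2 ≤ B := le_max_left _ _
  have hB0 : 0 < B := by linarith
  have hNB : 2 * (N : ℝ) ≤ q * B := by
    have : 2 * N / q ≤ B := le_max_right _ _
    rw [div_le_iff₀ hq] at this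
    linarith
  obtain ⟨ρ₀, hρ₀, hexp₀⟩ := exists_radius_expanding R (by omega) hR0 B
  set ρ := max ρ₀ (2 * b + 1)
  have hρ : 1 ≤ ρ := hρ₀.trans (le_max_left _ _)
  have hρb : 2 * b + 1 ≤ ρ := le_max_right _ _
  have hexp : ∀ z : ℂ, ρ ≤ ‖z‖ → B * ‖z‖ ≤ ‖R.eval z‖ := fun z hz =>
    hexp₀ z ((le_max_left _ _).trans hz)
  obtain ⟨n₀, hn₀⟩ := exists_uniform_escape hγ hdisj hB2 hρ hexp
  set W : ℕ → ℂ → ℂ := fun n t => (fun w => R.eval w)^[n] t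
  set D : ℕ → ℂ → ℂ := fun n t => ∏ i ∈ Finset.range n, R.derivative.eval (W i t)
  obtain ⟨M, hM⟩ := hγ.exists_bound_of_continuousOn (f := D n₀)
    (continuous_finsetProd _ fun i _ =>
      R.derivative.continuous.comp (continuous_eval_iterate R i)).continuousOn
  have hprod : ∀ t ∈ γ, ∀ k, ‖D (n₀ + k) t‖ ≤ |M| * (2 * N) ^ k * ‖W (n₀ + k) t‖ := by
    intro t ht k
    induction k with
    | zero =>
      rw [pow_zero, mul_one, add_zero]
      refine (hM t ht).trans ((le_abs_self M).trans (le_mul_of_one_le_right (abs_nonneg M) ?_))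
      exact hρ.trans (hn₀ t ht 0).2
    | succ k ih =>
      have hw := (hn₀ t ht k).2
      change ρ ≤ ‖W (n₀ + k) t‖ at hw
      have h1 : W (n₀ + (k + 1)) t = R.eval (W (n₀ + k) t) := by
        rw [← add_assoc]
        exact Function.iterate_succ_apply' _ _ _
      have h2 : R.eval (W (n₀ + k) t) ≠ 0 := by
        rw [← norm_pos_iff]
        exact lt_of_lt_of_le (by nlinarith) (hexp _ hw)
      have h3 := h.norm_mul_derivative_le hN hR (by linarith) h2
      have h4 : D (n₀ + (k + 1)) t = D (n₀ + k) t * R.derivative.eval (W (n₀ + k) t) := by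
        rw [← add_assoc]
        exact Finset.prod_range_succ _ _
      rw [h4, norm_mul, h1]
      calc ‖D (n₀ + k) t‖ * ‖R.derivative.eval (W (n₀ + k) t)‖
          ≤ |M| * (2 * N) ^ k * ‖W (n₀ + k) t‖ * ‖R.derivative.eval (W (n₀ + k) t)‖ := by gcongr
        _ = |M| * (2 * N) ^ k * (‖W (n₀ + k) t‖ * ‖R.derivative.eval (W (n₀ + k) t)‖) := by ring
        _ ≤ |M| * (2 * N) ^ k * (2 * N * ‖R.eval (W (n₀ + k) t)‖) := by gcongr
        _ = _ := by rw [pow_succ]; ring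
  refine ⟨4 * b * |M| / q ^ n₀, n₀, by positivity, fun m hm t ht => ?_⟩
  obtain ⟨k, rfl⟩ := Nat.exists_eq_add_of_le hm
  obtain ⟨hBk, hw⟩ := hn₀ t ht k
  change B ^ k ≤ ‖W (n₀ + k) t‖ at hBk
  change ρ ≤ ‖W (n₀ + k) t‖ at hw
  have hw0 : 0 < ‖W (n₀ + k) t‖ := by linarith
  have hdist : ∀ x ∈ Icc 0 b, ‖W (n₀ + k) t‖ / 2 ≤ ‖W (n₀ + k) t - (x : ℝ)‖ := by
    intro x hx
    have h4 := norm_sub_norm_le (W (n₀ + k) t) ((x : ℝ) : ℂ)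
    rw [Complex.norm_real, Real.norm_of_nonneg hx.1] at h4
    linarith [hx.2]
  have hne : ∀ x ∈ Icc 0 b, W (n₀ + k) t - (x : ℝ) ≠ 0 := fun x hx h0 => by
    have := hdist x hx
    rw [h0, norm_zero] at this
    linarith
  refine ⟨fun x hx => sub_ne_zero.1 (hne x hx), fun x hx y hy => ?_⟩
  rw [h.transfer_iterate_inv_sub hN hR t _ x (h.Icc_subset_imageInter hx) (sub_ne_zero.1 (hne x hx)),
    h.transfer_iterate_inv_sub hN hR t _ y (h.Icc_subset_imageInter hy) (sub_ne_zero.1 (hne y hy)),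
    ← mul_sub, norm_mul]
  change ‖D (n₀ + k) t‖ * ‖(W (n₀ + k) t - (x : ℝ))⁻¹ - (W (n₀ + k) t - (y : ℝ))⁻¹‖ ≤ _
  -- The difference of two kernels is of order 1/‖W‖², while the derivative product is of order
  -- (2N)^k ‖W‖. One factor 1/‖W‖ ≤ 1/B^k remains and gives the decay.
  have h5 : ‖(W (n₀ + k) t - (x : ℝ))⁻¹ - (W (n₀ + k) t - (y : ℝ))⁻¹‖ ≤
      b / (‖W (n₀ + k) t‖ / 2 * (‖W (n₀ + k) t‖ / 2)) := by
    rw [inv_sub_inv (hne x hx) (hne y hy), norm_div, norm_mul]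
    refine div_le_div₀ hb.le ?_ (by positivity)
      (mul_le_mul (hdist x hx) (hdist y hy) (by positivity) (norm_nonneg _))
    rw [sub_sub_sub_cancel_left, ← Complex.ofReal_sub, Complex.norm_real, Real.norm_eq_abs, abs_le]
    constructor <;> linarith [hx.1, hx.2, hy.1, hy.2]
  calc _ ≤ |M| * (2 * N) ^ k * ‖W (n₀ + k) t‖ *
        (b / (‖W (n₀ + k) t‖ / 2 * (‖W (n₀ + k) t‖ / 2))) :=
        mul_le_mul (hprod t ht k) h5 (norm_nonneg _) (by positivity)
    _ = 4 * b * |M| * ((2 * N) ^ k / ‖W (n₀ + k) t‖) := by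
        field_simp
        ring
    _ ≤ 4 * b * |M| * ((q * B) ^ k / B ^ k) := by gcongr
    _ = _ := by
        rw [mul_pow, mul_div_assoc, div_self (by positivity), mul_one, pow_add]
        field_simp

end IsBranchSystem

theorem dist_ofReal_ofReal (x y : ℝ) : dist (x : ℂ) (y : ℂ) = |x - y| := by
  rw [Complex.dist_eq, ← Complex.ofReal_sub, Complex.norm_real, Real.norm_eq_abs]

/-- The circle with diameter [u, v] meets the real line only at u and v, and J is real. -/
theorem IsRealModel.notMem_filledJulia {R : ℂ[X]} {P : ℝ[X]} {c b : ℝ} (hm : IsRealModel R P c b)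
    {u v : ℝ} (hu : u ∉ realJulia R) (hv : v ∉ realJulia R) {t : ℂ}
    (ht : t ∈ Metric.sphere (((u + v) / 2 : ℝ) : ℂ) ((v - u) / 2)) : t ∉ filledJulia R := by
  rw [← hm.julia_eq]
  intro htJ
  have h1 : t = (t.re : ℂ) := Complex.ext rfl (by simpa using hm.im_eq_zero t htJ)
  have h2 : t.re ∈ realJulia R := by
    change (t.re : ℂ) ∈ julia R
    rwa [← h1]
  rw [h1, Metric.mem_sphere, dist_ofReal_ofReal] at ht
  rcases abs_choice (t.re - (u + v) / 2) with h3 | h3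
  · rw [show t.re = v by linarith] at h2
    exact hv h2
  · rw [show t.re = u by linarith] at h2
    exact hu h2

theorem IsRealModel.exists_notMem {R : ℂ[X]} (htd : IsTotallyDisconnected (julia R)) {u v : ℝ}
    (huv : u < v) : ∃ a ∈ Ioo u v, a ∉ realJulia R := by
  by_contra! h
  obtain ⟨x, hx⟩ := exists_between huv
  obtain ⟨y, hy⟩ := exists_between hx.2
  have h1 : ((↑) '' Ioo u v : Set ℂ) ⊆ julia R := by
    rintro _ ⟨z, hz, rfl⟩
    exact h z hz
  have h2 := htd _ h1 (isPreconnected_Ioo.image _ Complex.continuous_ofReal.continuousOn)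
    (mem_image_of_mem _ hx) (mem_image_of_mem _ ⟨hx.1.trans hy.1, hy.2⟩)
  exact hy.1.ne (Complex.ofReal_injective h2)

namespace IsBranchSystem

variable {R : ℂ[X]} {P : ℝ[X]} {b c : ℝ} {N : ℕ} {p : Fin (N + 1) → ℝ} {g : Fin N → ℝ → ℝ}

/-- The Cauchy integral over the circle with diameter [u, v] reproduces F^(-s/2) inside and vanishes
outside, so it realizes the cutoff. Commuting L^m with the integral reduces the oscillation to that
of the kernel. -/
theorem oscillationDecays_indicator (h : IsBranchSystem P b p g) (hN : 2 ≤ N)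
    (hR : R = P.map Complex.ofRealHom) {U : Set ℂ} {F : ℂ → ℂ} (hF : DifferentiableOn ℂ F U)
    (hslit : ∀ t ∈ U, F t ∈ Complex.slitPlane) {u v : ℝ} (huv : u < v)
    (hball : Metric.closedBall (((u + v) / 2 : ℝ) : ℂ) ((v - u) / 2) ⊆ U)
    (hFx : ∀ x ∈ Ioc u v, F x = (fatou R c p x : ℝ))
    (hdisj : ∀ t ∈ Metric.sphere (((u + v) / 2 : ℝ) : ℂ) ((v - u) / 2), t ∉ filledJulia R)
    {q : ℝ} (hq : 0 < q) :
    OscillationDecays b q g fun s => (Ioc u v).indicator (fatouPow R c p s) := by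
  intro T
  set z₀ : ℂ := (((u + v) / 2 : ℝ) : ℂ) with hz₀
  set r : ℝ := (v - u) / 2 with hr
  have hr0 : 0 < r := by rw [hr]; linarith
  obtain ⟨C, m₀, hC0, hC⟩ := h.exists_norm_transfer_iterate_inv_sub_le hN hR
    (isCompact_sphere z₀ r) hdisj hq
  have hsU : Metric.sphere z₀ r ⊆ U := Metric.sphere_subset_closedBall.trans hball
  obtain ⟨M, hM⟩ := ((isCompact_closedBall (0 : ℂ) T).prod
    (isCompact_sphere z₀ r)).exists_bound_of_continuousOn
    (f := fun w : ℂ × ℂ => F w.2 ^ (-w.1 / 2))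
    (ContinuousOn.cpow (hF.continuousOn.comp continuousOn_snd fun w hw => hsU hw.2)
      (continuous_fst.neg.div_const 2).continuousOn fun w hw => hslit _ (hsU hw.2))
  refine ⟨r * (C * M), m₀, fun m hm x hx y hy s hs => ?_⟩
  set φ : ℂ → ℂ := fun t => F t ^ (-s / 2)
  have hφU : DifferentiableOn ℂ φ U := fun t ht => (hF t ht).cpow_const (hslit t ht)
  have hφs : ContinuousOn φ (Metric.sphere z₀ r) := hφU.continuousOn.mono hsU
  -- Points on the circle are excluded, so it does not matter which endpoint the half-open interval
  -- contains.
  have hrep : ∀ x ∈ imageInter P p, (x : ℂ) ∉ Metric.sphere z₀ r →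
      (Ioc u v).indicator (fatouPow R c p s) x =
        (2 * Real.pi * Complex.I : ℂ)⁻¹ • ∮ t in C(z₀, r), (t - x)⁻¹ • φ t := by
    intro x _ hxs
    rw [Metric.mem_sphere, dist_ofReal_ofReal] at hxs
    by_cases hx : x ∈ Ioc u v
    · have hxb : (x : ℂ) ∈ Metric.ball z₀ r := by
        rw [Metric.mem_ball, dist_ofReal_ofReal]
        refine lt_of_le_of_ne (abs_le.2 ?_) hxs
        rw [hr]
        constructor <;> linarith [hx.1, hx.2]
      rw [(hφU.diffContOnCl_ball hball).two_pi_i_inv_smul_circleIntegral_sub_inv_smul hxb,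
        indicator_of_mem hx, fatouPow]
      simp only [φ]
      rw [hFx x hx]
    · have hxb : ∀ t ∈ Metric.closedBall z₀ r, t - x ≠ 0 := by
        intro t ht h0
        rw [sub_eq_zero.1 h0, Metric.mem_closedBall, dist_ofReal_ofReal] at ht
        have h1 := abs_lt.1 (lt_of_le_of_ne ht hxs)
        rw [hr] at h1
        exact hx ⟨by linarith, by linarith⟩
      rw [indicator_of_notMem hx, DiffContOnCl.circleIntegral_eq_zero hr0.le, smul_zero]
      refine DifferentiableOn.diffContOnCl_ball (U := Metric.closedBall z₀ r) ?_ le_rfl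
      exact ((differentiableOn_id.sub_const _).inv hxb).smul (hφU.mono hball)
  have hx' := h.Icc_subset_imageInter hx
  have hy' := h.Icc_subset_imageInter hy
  have hxne : ∀ t ∈ Metric.sphere z₀ r, (fun w => R.eval w)^[m] t ≠ x := fun t ht =>
    (hC m hm t ht).1 x hx
  have hyne : ∀ t ∈ Metric.sphere z₀ r, (fun w => R.eval w)^[m] t ≠ y := fun t ht =>
    (hC m hm t ht).1 y hy
  have hint : ∀ x ∈ imageInter P p,
      (∀ t ∈ Metric.sphere z₀ r, (fun w => R.eval w)^[m] t ≠ (x : ℝ)) →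
      CircleIntegrable (fun t => (transfer g)^[m] (fun u : ℝ => (t - u)⁻¹) x • φ t) z₀ r :=
    fun x hx hne =>
      ((h.continuousOn_transfer_iterate_inv_sub hN hR hx hne).smul hφs).circleIntegrable hr0.le
  rw [h.transfer_iterate_eq_circleIntegral hN hR hr0.le hφs hrep m x hx' hxne,
    h.transfer_iterate_eq_circleIntegral hN hR hr0.le hφs hrep m y hy' hyne, ← smul_sub,
    ← circleIntegral.integral_sub (hint x hx' hxne) (hint y hy' hyne)]
  refine (circleIntegral.norm_two_pi_i_inv_smul_integral_le_of_norm_le_const hr0.le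
    (C := C * q ^ m * M) fun t ht => ?_).trans (le_of_eq (by ring))
  rw [← sub_smul, norm_smul]
  exact mul_le_mul ((hC m hm t ht).2 x hx y hy)
    (hM (s, t) ⟨by simpa using hs, ht⟩) (norm_nonneg _) (by positivity)

variable [NeZero N]

/-- If the Julia set is totally disconnected, the oscillation decays faster than any geometric
sequence, for a suitable fundamental domain. -/
theorem exists_oscillationDecays_cutPow (h : IsBranchSystem P b p g) (hN : 2 ≤ N)
    (hm : IsRealModel R P c b) (hc : 1 < c) (htd : IsTotallyDisconnected (julia R)) :
    ∃ a, 0 < a ∧ a < p (0 : Fin N).succ ∧ P.eval a ≤ b ∧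
      ∀ q, 0 < q → OscillationDecays b q g (cutPow R P c p a) := by
  have hPc := hm.derivative_eval_zero
  have hc0 : 0 < c := by linarith
  obtain ⟨δ, hδ, F, hF, hlim⟩ := h.exists_tendsto_rescaled hN hPc hc
  -- The bounds δ/c and b/c, with P(a) ≤ c a, keep the whole fundamental domain inside the Koenigs
  -- disc and inside [0, b].
  obtain ⟨a, ⟨ha, ha'⟩, haJ⟩ := IsRealModel.exists_notMem htd
    (show (0 : ℝ) < min (p (0 : Fin N).succ) (min (δ / c) (b / c)) from
      lt_min h.succ_zero_pos (lt_min (by positivity) (div_pos h.b_pos hc0)))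
  have hap : a < p (0 : Fin N).succ := ha'.trans_le (min_le_left _ _)
  have hal : a ∈ lap p 0 := by rw [h.lap_zero]; exact ⟨ha.le, hap.le⟩
  have hPa := h.eval_le_mul hN hPc hc hal
  have haδ : P.eval a < δ := by
    have : a < δ / c := ha'.trans_le ((min_le_right _ _).trans (min_le_left _ _))
    rw [lt_div_iff₀ hc0] at this
    linarith
  have hab : P.eval a ≤ b := by
    have : a < b / c := ha'.trans_le ((min_le_right _ _).trans (min_le_right _ _))
    rw [lt_div_iff₀ hc0] at this
    linarith
  refine ⟨a, ha, hap, hab, fun q hq => ?_⟩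
  have hS : ∀ x ∈ Icc a (P.eval a), x ∈ imageInter P p := fun x hx =>
    h.Icc_subset_imageInter ⟨ha.le.trans hx.1, hx.2.trans hab⟩
  have hFx : ∀ x ∈ Icc a (P.eval a), F x = (fatou R c p x : ℝ) := fun x hx =>
    tendsto_nhds_unique (hlim x (hS x hx) (hx.2.trans_lt haδ))
      ((Complex.continuous_ofReal.tendsto _).comp (h.tendsto_fatou hN hm.realEval_eq hPc hc (hS x hx)))
  set U : Set ℂ := Metric.ball 0 δ ∩ F ⁻¹' Complex.slitPlane
  have hU : IsOpen U :=
    hF.continuousOn.isOpen_inter_preimage Metric.isOpen_ball Complex.isOpen_slitPlane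
  have hKU : ((↑) '' Icc a (P.eval a) : Set ℂ) ⊆ U := by
    rintro _ ⟨x, hx, rfl⟩
    refine ⟨?_, ?_⟩
    · rw [mem_ball_zero_iff, Complex.norm_real, Real.norm_of_nonneg (ha.le.trans hx.1)]
      exact hx.2.trans_lt haδ
    · rw [mem_preimage, hFx x hx, Complex.ofReal_mem_slitPlane]
      exact h.fatou_pos hN hm.realEval_eq hPc hc (hS x hx) (ha.trans_le hx.1).ne'
  obtain ⟨ε, hε, hεU⟩ := (isCompact_Icc.image Complex.continuous_ofReal).exists_thickening_subset_open
    hU hKU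
  have hshort : ∀ u v, a ≤ u → u < v → v ≤ P.eval a → v - u < ε → u ∉ realJulia R →
      v ∉ realJulia R → OscillationDecays b q g fun s => (Ioc u v).indicator (fatouPow R c p s) := by
    intro u v hau huv hvP hvu hu hv
    refine h.oscillationDecays_indicator hN hm.map_eq (hF.mono inter_subset_left)
      (fun t ht => ht.2) huv (fun t ht => hεU ?_)
      (fun x hx => hFx x ⟨hau.trans hx.1.le, hx.2.trans hvP⟩)
      (fun t ht => hm.notMem_filledJulia hu hv ht) hq
    rw [Metric.mem_thickening_iff]
    refine ⟨_, mem_image_of_mem _ (⟨?_, ?_⟩ : (u + v) / 2 ∈ Icc a (P.eval a)),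
      (Metric.mem_closedBall.1 ht).trans_lt ?_⟩ <;> linarith
  -- The domain is cut at points off J into pieces shorter than ε, whose circles stay where F is
  -- holomorphic with values in the slit plane. The new cut lies between v - 2ε/3 and v - ε/3, so
  -- each step advances by at least ε/3.
  have hchain : ∀ k : ℕ, ∀ v, a < v → v ≤ P.eval a → v < a + k * (ε / 3) → v ∉ realJulia R →
      OscillationDecays b q g fun s => (Ioc a v).indicator (fatouPow R c p s) := by
    intro k
    induction k with
    | zero =>
      intro v hav _ hv
      rw [Nat.cast_zero, zero_mul, add_zero] at hv
      exact absurd hv hav.not_gt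
    | succ k ih =>
      intro v hav hvP hv hvJ
      by_cases hva : v - a < ε
      · exact hshort a v le_rfl hav hvP hva haJ hvJ
      · obtain ⟨u, hu, huJ⟩ := IsRealModel.exists_notMem htd
          (show v - 2 * (ε / 3) < v - ε / 3 by linarith)
        push_cast at hv
        have hau : a < u := by linarith [hu.1]
        have huv : u < v := by linarith [hu.2]
        have h1 := ih u hau (huv.le.trans hvP) (by linarith [hu.2]) huJ
        have h2 := hshort u v hau.le huv hvP (by linarith [hu.1]) huJ hvJ
        have h3 := h1.add h2
        convert! h3 using 1
        funext s
        rw [← Ioc_union_Ioc_eq_Ioc hau.le huv.le,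
          indicator_union_of_disjoint (Ioc_disjoint_Ioc_of_le le_rfl)]
  have hlt : a < P.eval a := by
    refine lt_of_lt_of_le ?_ (h.mul_le_eval hN (by rw [hPc]; exact hc0) hal)
    refine lt_mul_of_one_lt_left ha ?_
    rw [one_lt_div h.succ_zero_pos]
    exact h.succ_zero_lt hN
  obtain ⟨k, hk⟩ := exists_nat_gt ((P.eval a - a) / (ε / 3))
  -- Complete invariance of J puts P(a) off J along with a.
  refine hchain k _ hlt le_rfl ?_ fun h0 => haJ ((hm.eval_mem_iff a).1 h0)
  rw [div_lt_iff₀ (by positivity)] at hk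
  linarith

end IsBranchSystem

/-! ### Assembly of the continuation -/

theorem IsRealModel.hull_eq {R : ℂ[X]} {P : ℝ[X]} {c b : ℝ} (hm : IsRealModel R P c b) :
    hull R = Icc 0 b := by
  refine Subset.antisymm (convexHull_min hm.subset_Icc (convex_Icc 0 b)) ?_
  rw [← segment_eq_Icc hm.b_pos.le]
  exact segment_subset_convexHull hm.zero_mem hm.b_mem

theorem IsBranchSystem.isMonotonePartition {R : ℂ[X]} {P : ℝ[X]} {c b : ℝ} {N : ℕ}
    {p : Fin (N + 1) → ℝ} {g : Fin N → ℝ → ℝ} (h : IsBranchSystem P b p g)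
    (hm : IsRealModel R P c b) : IsMonotonePartition R p := by
  refine ⟨h.laps.strictMono, by rw [hm.hull_eq, h.laps.zero, h.laps.last], fun j => ?_⟩
  have hev : realEval R = fun x => P.eval x := funext hm.realEval_eq
  rw [hev]
  rcases h.laps.lap j with ⟨h1, -⟩ | ⟨h1, -⟩
  · exact Or.inl h1.monotoneOn
  · exact Or.inr h1.antitoneOn

theorem IsRealModel.baseInterval_eq {R : ℂ[X]} {P : ℝ[X]} {c b : ℝ} {N : ℕ}
    (hm : IsRealModel R P c b) (p : Fin (N + 1) → ℝ) : baseInterval R p = imageInter P p := by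
  have hev : realEval R = fun x => P.eval x := funext hm.realEval_eq
  rw [baseInterval, hev, imageInter]

theorem dR_pos {c : ℝ} (hc : 1 < c) {N : ℕ} (hN : 2 ≤ N) : 0 < dR N c := by
  have : 0 < Real.log N := Real.log_pos (by exact_mod_cast (by omega : 1 < N))
  have := Real.log_pos hc
  rw [dR]
  positivity

/-- The regular part for the fundamental domain `(a, P(a)]` and the measure `κ`. -/
def measureRegularPart (R : ℂ[X]) (P : ℝ[X]) (c b : ℝ) {N : ℕ} (p : Fin (N + 1) → ℝ)
    (g : Fin N → ℝ → ℝ) (κ : Measure ℝ) (a z₀ : ℝ) : ℂ → ℂ :=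
  regularPart R P c p g a (xi R c p κ) (fun s => ∫ x in Ioc a b, fatouPow R c p s x ∂κ)
    (fun s => ∫ x in Ioc a (P.eval a), fatouPow R c p s x ∂κ) z₀

namespace IsSelfSimilar

variable {R : ℂ[X]} {P : ℝ[X]} {b c : ℝ} {N : ℕ} {p : Fin (N + 1) → ℝ} {g : Fin N → ℝ → ℝ}
  {κ : Measure ℝ} [NeZero N]

theorem isContinuation (hκ : IsSelfSimilar b g κ) (h : IsBranchSystem P b p g) (hN : 2 ≤ N)
    (hm : IsRealModel R P c b) (hc : 1 < c) {a : ℝ} (ha : 0 < a) (hap : a < p (0 : Fin N).succ)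
    (hab : P.eval a ≤ b) {q η : ℝ} (hq : 0 < q) (hη : η < dR N c)
    (hqη : ∀ x : ℝ, η < x → c ^ (-x / 2) * q < 1)
    (hdec : OscillationDecays b q g (cutPow R P c p a)) {z₀ : ℝ} (hz : z₀ ∈ baseInterval R p) :
    IsContinuation R N c z₀ (xi R c p κ) (measureRegularPart R P c b p g κ a z₀) η := by
  have hhull := hm.hull_eq
  have hbal := hκ.isBalancedMeasure h hN hm hhull
  rw [hm.baseInterval_eq] at hz
  refine h.isContinuation hN hm.map_eq hm.realEval_eq hm.derivative_eval_zero hc ha hap hab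
    (hκ.differentiable_xi h hN hm hc hhull)
    (hκ.differentiable_integral_fatouPow h hN hm hc measurableSet_Ioc ha Ioc_subset_Icc_self)
    (hκ.differentiable_integral_fatouPow h hN hm hc measurableSet_Ioc ha
      fun x hx => ⟨hx.1.le, hx.2.trans hab⟩)
    (fun s => integral_cutPow h hκ hN hm hc hhull hbal.support ha hap hab s)
    (hκ.xi_dR_ne_zero h hN hm hc hhull hbal _) hq hη hqη (fun T => ?_) hz
  obtain ⟨C, m₀, hC⟩ := hdec T
  exact ⟨C, m₀, fun m hm' z hz s hs => hκ.norm_deviation_le h hN hm hc ha hab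
    fun y hy => hC m hm' z hz y hy s hs⟩

/-- Bounded oscillation is decay at rate q = 1, and the series then needs only c^(-Re s/2) < 1. -/
theorem isContinuation_zero (hκ : IsSelfSimilar b g κ) (h : IsBranchSystem P b p g) (hN : 2 ≤ N)
    (hm : IsRealModel R P c b) (hc : 1 < c) {a : ℝ} (ha : 0 < a) (hap : a < p (0 : Fin N).succ)
    (hab : P.eval a ≤ b) {z₀ : ℝ} (hz : z₀ ∈ baseInterval R p) :
    IsContinuation R N c z₀ (xi R c p κ) (measureRegularPart R P c b p g κ a z₀) 0 := by
  refine hκ.isContinuation h hN hm hc ha hap hab one_pos (dR_pos hc hN) (fun x hx => ?_)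
    (fun T => ?_) hz
  · rw [mul_one]
    exact Real.rpow_lt_one_of_one_lt_of_neg hc (by linarith)
  · obtain ⟨C, hC⟩ := h.exists_norm_transfer_iterate_cutPow_sub_le hN hm.realEval_eq
      hm.derivative_eval_zero hc ha hap T
    exact ⟨C, 0, fun m _ x hx y hy s hs => by simpa using hC m x hx y hy s hs⟩

/-- The rate q = c^(-ε/2) is exactly what convergence for Re s > -ε requires, and every positive
rate is available. -/
theorem isContinuation_neg (hκ : IsSelfSimilar b g κ) (h : IsBranchSystem P b p g) (hN : 2 ≤ N)
    (hm : IsRealModel R P c b) (hc : 1 < c) {a : ℝ} (ha : 0 < a) (hap : a < p (0 : Fin N).succ)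
    (hab : P.eval a ≤ b) (hdec : ∀ q, 0 < q → OscillationDecays b q g (cutPow R P c p a))
    {ε : ℝ} (hε : 0 < ε) {z₀ : ℝ} (hz : z₀ ∈ baseInterval R p) :
    IsContinuation R N c z₀ (xi R c p κ) (measureRegularPart R P c b p g κ a z₀) (-ε) := by
  have hc0 : 0 < c := by linarith
  have hq : 0 < c ^ (-ε / 2) := Real.rpow_pos_of_pos hc0 _
  refine hκ.isContinuation h hN hm hc ha hap hab hq (by linarith [dR_pos hc hN]) (fun x hx => ?_)
    (hdec _ hq) hz
  rw [← Real.rpow_add hc0]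
  exact Real.rpow_lt_one_of_one_lt_of_neg hc (by linarith)

end IsSelfSimilar

end PolyZeta

end

theorem theorem2 (R : ℂ[X]) (N : ℕ) (c : ℝ) (hdeg : R.natDegree = N) (hN : 2 ≤ N)
    (hR0 : R.eval 0 = 0) (hRc : R.derivative.eval 0 = (c : ℂ)) (hc : 1 < c)
    (hJ : ∀ z ∈ PolyZeta.julia R, z.im = 0 ∧ 0 ≤ z.re) :
    ∃ p : Fin (N + 1) → ℝ, PolyZeta.IsMonotonePartition R p ∧
    ∃ κ : Measure ℝ, PolyZeta.IsBalancedMeasure R p κ ∧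
      AnalyticOnNhd ℂ (PolyZeta.xi R c p κ) Set.univ ∧
      ∃ ψ : ℝ → ℂ → ℂ,
        (∀ z₀ ∈ PolyZeta.baseInterval R p,
          PolyZeta.IsContinuation R N c z₀ (PolyZeta.xi R c p κ) (ψ z₀) 0) ∧
        (IsTotallyDisconnected (PolyZeta.julia R) →
          (∃ ε : ℝ, 0 < ε ∧ ∀ z₀ ∈ PolyZeta.baseInterval R p, ∃ ψ' : ℂ → ℂ,
            Set.EqOn ψ' (ψ z₀) {s | 0 < s.re} ∧
            PolyZeta.IsContinuation R N c z₀ (PolyZeta.xi R c p κ) ψ' (-ε)) ∧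
          (∀ r : ℝ, (∀ z ∈ PolyZeta.julia R, R.derivative.eval z ≠ 0) →
            IsGreatest ((fun z : ℂ => ‖R.derivative.eval z‖⁻¹) '' PolyZeta.julia R) r → r < 1 →
            ∀ ε : ℝ, ε = -(2 * Real.log r / Real.log c) →
            0 < ε ∧ ∀ z₀ ∈ PolyZeta.baseInterval R p, ∃ ψ' : ℂ → ℂ,
              Set.EqOn ψ' (ψ z₀) {s | 0 < s.re} ∧
              PolyZeta.IsContinuation R N c z₀ (PolyZeta.xi R c p κ) ψ' (-ε))) := by
  have : NeZero N := ⟨by omega⟩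
  obtain ⟨P, b, hm⟩ := PolyZeta.exists_isRealModel (by omega) hR0 hRc hc hJ
  have hPdeg : P.natDegree = N := by
    rw [← hdeg, hm.map_eq, natDegree_map_eq_of_injective Complex.ofRealHom.injective]
  obtain ⟨p, hp⟩ := hm.exists_isLapPartition hPdeg hN
  obtain ⟨g, h⟩ := hp.exists_isBranchSystem hPdeg hm.eval_zero hm.b_pos
  obtain ⟨κ, hκ1, hκ2, hκ3⟩ := PolyZeta.exists_balanced_measure (by omega) h.continuous
    (isCompact_Icc (a := (0 : ℝ)) (b := b)) h.mem_Icc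
  have hκ : PolyZeta.IsSelfSimilar b g κ := ⟨hκ1, hκ2, hκ3⟩
  have hc0 : 0 < c := by linarith
  -- The cut a is fixed before ψ is defined, so that in the totally disconnected case the same
  -- formula serves on every half-plane.
  obtain ⟨a, ha, hap, hab, hdec⟩ : ∃ a, 0 < a ∧ a < p (0 : Fin N).succ ∧ P.eval a ≤ b ∧
      (IsTotallyDisconnected (PolyZeta.julia R) →
        ∀ q, 0 < q → PolyZeta.OscillationDecays b q g (PolyZeta.cutPow R P c p a)) := by
    by_cases htd : IsTotallyDisconnected (PolyZeta.julia R)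
    · obtain ⟨a, ha, hap, hab, hdec⟩ := h.exists_oscillationDecays_cutPow hN hm hc htd
      exact ⟨a, ha, hap, hab, fun _ => hdec⟩
    · obtain ⟨a, ha, ha'⟩ := exists_between
        (lt_min h.succ_zero_pos (div_pos hm.b_pos hc0) : 0 < min (p (0 : Fin N).succ) (b / c))
      have hap := ha'.trans_le (min_le_left _ _)
      refine ⟨a, ha, hap, ?_, fun h0 => absurd h0 htd⟩
      have h1 := h.eval_le_mul hN hm.derivative_eval_zero hc
        (u := a) (by rw [h.lap_zero]; exact ⟨ha.le, hap.le⟩)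
      have h2 := ha'.trans_le (min_le_right _ _)
      rw [lt_div_iff₀ hc0] at h2
      linarith
  refine ⟨p, h.isMonotonePartition hm, κ, hκ.isBalancedMeasure h hN hm hm.hull_eq,
    (hκ.differentiable_xi h hN hm hc hm.hull_eq).differentiableOn.analyticOnNhd isOpen_univ,
    fun z₀ => PolyZeta.measureRegularPart R P c b p g κ a z₀,
    fun z₀ hz => hκ.isContinuation_zero h hN hm hc ha hap hab hz, fun htd => ⟨?_, ?_⟩⟩
  -- Any positive ε would do, and the extension is ψ itself because its defining series converges
  -- further to the left.
  · exact ⟨1, one_pos, fun z₀ hz => ⟨_, fun _ _ => rfl,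
      hκ.isContinuation_neg h hN hm hc ha hap hab (hdec htd) one_pos hz⟩⟩
  -- Since every positive ε is admissible, only the positivity of the prescribed value has to be
  -- checked, and it follows from 0 < r < 1.
  · rintro r hne ⟨⟨z, hz, rfl⟩, -⟩ hr ε rfl
    have hr0 : 0 < ‖R.derivative.eval z‖⁻¹ := inv_pos.2 (norm_pos_iff.2 (hne z hz))
    have hε : 0 < -(2 * Real.log ‖R.derivative.eval z‖⁻¹ / Real.log c) :=
      neg_pos.2 (div_neg_of_neg_of_pos (by linarith [Real.log_neg hr0 hr]) (Real.log_pos hc))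
    exact ⟨hε, fun z₀ hz => ⟨_, fun _ _ => rfl,
      hκ.isContinuation_neg h hN hm hc ha hap hab (hdec htd) hε hz⟩⟩
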